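/- **Definitions.** A generalized Boolean algebra is a distributive lattice $\mathcal B$ with relative complements and least element $\emptyset$; morphisms preserve $\cup,\cap,\setminus,\emptyset$; an ideal is a non-empty downward closed subset that is closed under $\cup$; and $\mathcal B/\mathcal I$ is the quotient by $A\sim A'\iff \exists U\in\mathcal I:\ A\cup U=A'\cup U$. A generalized Boolean dynamical system $(\mathcal B,\mathcal L,\theta,\mathcal I)$ consists of a generalized Boolean algebra $\mathcal B$, a set $\mathcal L$ of letters, and for every $a\in\mathcal L$ a morphism $\theta_a:\mathcal B\to\mathcal B$ and an ideal $\mathcal I_a$ of $\mathcal B$ containing $\{A: A\subseteq\theta_a(A')\text{ for some }A'\in\mathcal B\}$. Put $\Delta_A=\{a\in\mathcal L:\theta_a(A)\neq\emptyset\}$. A set $A\in\mathcal B$ is regular, $A\in\mathcal B_{\rm reg}$, if $0<|\Delta_{A'}|<\infty$ for every $\emptyset\ne A'\subseteq A$, and singular otherwise. A set $V$ is a sink if $\Delta_V=\emptyset$, and $U$ has no sinks if $U\cap V=\emptyset$ for every sink $V$. For a commutative unital ring $R$, $L_R(\mathcal B,\mathcal L,\theta,\mathcal I)$ is the (not necessarily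 unital) associative $R$-algebra generated by symbols $p_A$ $(A\in\mathcal B)$ and $s_{a,C},s_{a,C}^*$ $(a\in\mathcal L,\ C\in\mathcal I_a)$ with the relations 1. $p_\emptyset=0$, $p_{A\cap A'}=p_Ap_{A'}$, $p_{A\cup A'}=p_A+p_{A'}-p_{A\cap A'}$; 2. $p_As_{a,C}=s_{a,C}\,p_{\theta_a(A)}$, $s_{a,C}^*p_A=p_{\theta_a(A)}s_{a,C}^*$; 3. $s_{a,C}^*s_{a',C'}=\delta_{a,a'}\,p_{C\cap C'}$; 4. $s_{a,C}\,p_A=s_{a,C\cap A}$, $p_As_{a,C}^*=s_{a,C\cap A}^*$; 5. $p_A=\sum_{a\in\Delta_A}s_{a,\theta_a(A)}s_{a,\theta_a(A)}^*$ for $A\in\mathcal B_{\rm reg}$. **Construction.** Let $\mathcal L=\{a_i: i\in N\}$ be countable, enumerated without repetitions by a set $N\subseteq\{1,2,\dots\}$ ($N=\{1,2,\dots\}$ is the typical case; finite alphabets are allowed). Let $X_0=\{\emptyset\}$ and, for $i\ge 1$, $X_i=\{U\in\mathcal B: U\text{ has no sinks and }\Delta_U\subseteq\{a_j: j\in N,\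 j<i\}\}$. These are ideals with $X_i\subseteq X_{i+1}$. Let $\mathcal B_i=\mathcal B/X_i$, write $[A]_i$ for the class of $A$ in $\mathcal B_i$, and let $\mathcal B^F=\bigoplus_{i\ge0}\mathcal B_i$ be the generalized Boolean algebra of families $(x_i)_{i\ge 0}$, $x_i\in\mathcal B_i$, with $x_i=\emptyset$ for all but finitely many $i$ (componentwise operations; $\mathcal B_i$ is regarded as the $i$-th summand). Let $\mathcal L^F=\mathcal L\sqcup\{b_1,b_2,\dots\}$. Let $\theta^F_{b_i}([A]_{i-1})=[A]_i$ for $i\ge 1$ and $\theta^F_{a_i}([A]_i)=[\theta_{a_i}(A)]_0$ for $i\in N$, where $\theta^F_{b_i}$ is $\emptyset$ on all summands other than $\mathcal B_{i-1}$ and $\theta^F_{a_i}$ is $\emptyset$ on all summands other than $\mathcal B_i$. Let $\mathcal I^F_{a_i}=\{[A]_0:A\in\mathcal I_{a_i}\}$ and $\mathcal I^F_{b_i}=\mathcal B_i$. Then $(\mathcal B^F,\mathcal L^F,\theta^F,\mathcal I^F)$ is a generalized Boolean dynamical system. **Theorem.** Let $R$ be a commutative unital ring and $(\mathcal B,\mathcal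 L,\theta,\mathcal I)$ a generalized Boolean dynamical system with countable alphabet, enumerated as above. Then $(\mathcal B^F)_{\rm reg}=\mathcal B^F$, and the $R$-algebras $L_R(\mathcal B,\mathcal L,\theta,\mathcal I)$ and $L_R(\mathcal B^F,\mathcal L^F,\theta^F,\mathcal I^F)$ are Morita equivalent. Here $R$-algebras $A$ and $C$, not necessarily unital, are called Morita equivalent if they are related by a surjective Morita context: there are $R$-linear bimodules ${}_AM_C$ and ${}_CN_A$ with $AM=M=MC$ and $CN=N=NA$, and surjective $R$-linear bimodule maps $\varphi:M\otimes_CN\to A$ and $\psi:N\otimes_AM\to C$ with $\varphi(m\otimes n)m'=m\,\psi(n\otimes m')$ and $\psi(n\otimes m)n'=n\,\varphi(m\otimes n')$ for all $m,m'\in M$ and $n,n'\in N$. -/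

import Mathlib

noncomputable section

namespace BooleanDynamics

universe u v w

/-! ### Generalized Boolean algebras: morphisms and quotients by ideals -/

/-- A morphism of generalized Boolean algebras: it preserves joins, meets, relative complements
and the minimal element. -/
structure GBAHom (B : Type u) (C : Type v) [GeneralizedBooleanAlgebra B]
    [GeneralizedBooleanAlgebra C] where
  toFun : B → C
  map_sup : ∀ x y, toFun (x ⊔ y) = toFun x ⊔ toFun y
  map_inf : ∀ x y, toFun (x ⊓ y) = toFun x ⊓ toFun y
  map_sdiff : ∀ x y, toFun (x \ y) = toFun x \ toFun y
  map_bot : toFun ⊥ = ⊥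

instance {B : Type u} {C : Type v} [GeneralizedBooleanAlgebra B] [GeneralizedBooleanAlgebra C] :
    CoeFun (GBAHom B C) (fun _ => B → C) := ⟨GBAHom.toFun⟩

section Quotient

variable {B : Type v} [GeneralizedBooleanAlgebra B]

/-- `A ∼ A'` if and only if `A ∪ U = A' ∪ U` for some `U` in the ideal. -/
def idealSetoid (I : Order.Ideal B) : Setoid B where
  r A A' := ∃ U ∈ I, A ⊔ U = A' ⊔ U
  iseqv :=
    { refl := fun _ => ⟨⊥, I.bot_mem, rfl⟩
      symm := fun ⟨U, hU, h⟩ => ⟨U, hU, h.symm⟩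
      trans := by
        rintro A₁ A₂ A₃ ⟨U, hU, h⟩ ⟨V, hV, h'⟩
        refine ⟨U ⊔ V, I.sup_mem hU hV, ?_⟩
        rw [← sup_assoc, h, sup_right_comm, h', sup_assoc, sup_comm V U] }

/-- The quotient `B / I` of a generalized Boolean algebra by an ideal. -/
def IdealQuotient (I : Order.Ideal B) : Type v := Quotient (idealSetoid I)

/-- The class `[A]` of `A` in `B / I`. -/
def IdealQuotient.mk (I : Order.Ideal B) (A : B) : IdealQuotient I :=
  Quotient.mk (idealSetoid I) A

theorem IdealQuotient.mk_eq {I : Order.Ideal B} {A A' : B} :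
    IdealQuotient.mk I A = IdealQuotient.mk I A' ↔ ∃ U ∈ I, A ⊔ U = A' ⊔ U :=
  Quotient.eq (r := idealSetoid I)

theorem sup_congr_ideal {I : Order.Ideal B} {a b c d : B} (h : ∃ U ∈ I, a ⊔ U = b ⊔ U)
    (h' : ∃ U ∈ I, c ⊔ U = d ⊔ U) : ∃ U ∈ I, (a ⊔ c) ⊔ U = (b ⊔ d) ⊔ U := by
  obtain ⟨U, hU, h⟩ := h
  obtain ⟨V, hV, h'⟩ := h'
  refine ⟨U ⊔ V, I.sup_mem hU hV, ?_⟩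
  rw [sup_sup_sup_comm, h, h', sup_sup_sup_comm]

theorem inf_congr_ideal {I : Order.Ideal B} {a b c d : B} (h : ∃ U ∈ I, a ⊔ U = b ⊔ U)
    (h' : ∃ U ∈ I, c ⊔ U = d ⊔ U) : ∃ U ∈ I, (a ⊓ c) ⊔ U = (b ⊓ d) ⊔ U := by
  obtain ⟨U, hU, h⟩ := h
  obtain ⟨V, hV, h'⟩ := h'
  refine ⟨U ⊔ V, I.sup_mem hU hV, ?_⟩
  have e1 : a ⊔ (U ⊔ V) = b ⊔ (U ⊔ V) := by rw [← sup_assoc, h, sup_assoc]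
  have e2 : c ⊔ (U ⊔ V) = d ⊔ (U ⊔ V) := by
    rw [sup_comm U V, ← sup_assoc, h', sup_assoc]
  rw [sup_inf_right, sup_inf_right, e1, e2]

theorem sdiff_congr_ideal {I : Order.Ideal B} {a b c d : B} (h : ∃ U ∈ I, a ⊔ U = b ⊔ U)
    (h' : ∃ U ∈ I, c ⊔ U = d ⊔ U) : ∃ U ∈ I, (a \ c) ⊔ U = (b \ d) ⊔ U := by
  obtain ⟨U, hU, h⟩ := h
  obtain ⟨V, hV, h'⟩ := h'
  refine ⟨U ⊔ V, I.sup_mem hU hV, ?_⟩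
  have key : ∀ x y W : B, (x \ y) ⊔ W = ((x ⊔ W) \ (y ⊔ W)) ⊔ W := by
    intro x y W
    rw [sup_sdiff, sdiff_eq_bot_iff.2 (le_sup_right : W ≤ y ⊔ W), sup_bot_eq,
      ← sdiff_sdiff_left, sdiff_sup_self]
  have e1 : a ⊔ (U ⊔ V) = b ⊔ (U ⊔ V) := by rw [← sup_assoc, h, sup_assoc]
  have e2 : c ⊔ (U ⊔ V) = d ⊔ (U ⊔ V) := by
    rw [sup_comm U V, ← sup_assoc, h', sup_assoc]
  rw [key a c, key b d, e1, e2]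

/-- The quotient carries the operations induced on representatives. -/
instance (I : Order.Ideal B) : Max (IdealQuotient I) :=
  ⟨Quotient.map₂ (· ⊔ ·) (fun _ _ h _ _ h' => sup_congr_ideal h h')⟩

instance (I : Order.Ideal B) : Min (IdealQuotient I) :=
  ⟨Quotient.map₂ (· ⊓ ·) (fun _ _ h _ _ h' => inf_congr_ideal h h')⟩

instance (I : Order.Ideal B) : SDiff (IdealQuotient I) :=
  ⟨Quotient.map₂ (· \ ·) (fun _ _ h _ _ h' => sdiff_congr_ideal h h')⟩

instance (I : Order.Ideal B) : Bot (IdealQuotient I) := ⟨IdealQuotient.mk I ⊥⟩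

/-- `B / I` is again a generalized Boolean algebra. -/
instance (I : Order.Ideal B) : GeneralizedBooleanAlgebra (IdealQuotient I) where
  __ := Lattice.mk' (α := IdealQuotient I)
    (by rintro ⟨a⟩ ⟨b⟩; exact congrArg (IdealQuotient.mk I) (sup_comm a b))
    (by rintro ⟨a⟩ ⟨b⟩ ⟨c⟩; exact congrArg (IdealQuotient.mk I) (sup_assoc a b c))
    (by rintro ⟨a⟩ ⟨b⟩; exact congrArg (IdealQuotient.mk I) (inf_comm a b))
    (by rintro ⟨a⟩ ⟨b⟩ ⟨c⟩; exact congrArg (IdealQuotient.mk I) (inf_assoc a b c))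
    (by rintro ⟨a⟩ ⟨b⟩; exact congrArg (IdealQuotient.mk I) sup_inf_self)
    (by rintro ⟨a⟩ ⟨b⟩; exact congrArg (IdealQuotient.mk I) inf_sup_self)
  le_sup_inf := by
    rintro ⟨a⟩ ⟨b⟩ ⟨c⟩
    refine congrArg (IdealQuotient.mk I) (?_ : (a ⊔ b) ⊓ (a ⊔ c) ⊔ (a ⊔ b ⊓ c) = a ⊔ b ⊓ c)
    rw [← sup_inf_left, sup_idem]
  sdiff := (· \ ·)
  bot := ⊥
  sup_inf_sdiff := by
    rintro ⟨a⟩ ⟨b⟩; exact congrArg (IdealQuotient.mk I) (sup_inf_sdiff a b)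
  inf_inf_sdiff := by
    rintro ⟨a⟩ ⟨b⟩; exact congrArg (IdealQuotient.mk I) (inf_inf_sdiff a b)

/-- A morphism `f : B → C` such that for `U ∈ I` one has `f U ∈ J` induces `B / I → C / J`. -/
def IdealQuotient.map {C : Type w} [GeneralizedBooleanAlgebra C] (I : Order.Ideal B)
    (J : Order.Ideal C) (f : GBAHom B C) (h : ∀ U ∈ I, f U ∈ J) :
    GBAHom (IdealQuotient I) (IdealQuotient J) where
  toFun := Quotient.map f (by
    rintro A A' ⟨U, hU, e⟩
    exact ⟨f U, h U hU, by rw [← f.map_sup, e, f.map_sup]⟩)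
  map_sup := by
    rintro ⟨a⟩ ⟨b⟩; exact congrArg (IdealQuotient.mk J) (f.map_sup a b)
  map_inf := by
    rintro ⟨a⟩ ⟨b⟩; exact congrArg (IdealQuotient.mk J) (f.map_inf a b)
  map_sdiff := by
    rintro ⟨a⟩ ⟨b⟩; exact congrArg (IdealQuotient.mk J) (f.map_sdiff a b)
  map_bot := congrArg (IdealQuotient.mk J) f.map_bot

theorem IdealQuotient.map_mk {C : Type w} [GeneralizedBooleanAlgebra C] (I : Order.Ideal B)
    (J : Order.Ideal C) (f : GBAHom B C) (h : ∀ U ∈ I, f U ∈ J) (A : B) :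
    IdealQuotient.map I J f h (IdealQuotient.mk I A) = IdealQuotient.mk J (f A) := rfl

/-- The identity morphism. -/
def GBAHom.id (B : Type v) [GeneralizedBooleanAlgebra B] : GBAHom B B where
  toFun A := A
  map_sup _ _ := rfl
  map_inf _ _ := rfl
  map_sdiff _ _ := rfl
  map_bot := rfl

end Quotient

/-! ### Direct sums of generalized Boolean algebras -/

section DirectSum

variable {B : ℕ → Type v} [∀ i, GeneralizedBooleanAlgebra (B i)]

variable (B) in
/-- `⨁ i, B i`: the formal finite disjoint unions `⨆ i, x i` with `x i ∈ B i`, that is, the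
families `x` with `x i = ∅` for all but finitely many `i`. -/
def FinSum : Type v := {x : ∀ i, B i // {i | x i ≠ ⊥}.Finite}

instance : LE (FinSum B) := ⟨fun x y => x.1 ≤ y.1⟩
instance : LT (FinSum B) := ⟨fun x y => x.1 < y.1⟩
instance : Bot (FinSum B) := ⟨⟨⊥, by simp⟩⟩

instance : Max (FinSum B) := ⟨fun x y => ⟨x.1 ⊔ y.1, (x.2.union y.2).subset (by
  intro i hi
  by_contra h
  simp only [Set.mem_union, Set.mem_ofPred_eq, not_or, not_not] at h
  exact hi (by simp [h.1, h.2]))⟩⟩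

instance : Min (FinSum B) := ⟨fun x y => ⟨x.1 ⊓ y.1, x.2.subset (by
  intro i hi h
  exact hi (by simp [h]))⟩⟩

instance : SDiff (FinSum B) := ⟨fun x y => ⟨x.1 \ y.1, x.2.subset (by
  intro i hi h
  exact hi (by simp [h]))⟩⟩

/-- The operations of `⨁ i, B i` are computed level by level. -/
instance : GeneralizedBooleanAlgebra (FinSum B) :=
  Function.Injective.generalizedBooleanAlgebra (fun x : FinSum B => x.1) Subtype.val_injective
    Iff.rfl Iff.rfl (fun _ _ => rfl) (fun _ _ => rfl) rfl (fun _ _ => rfl)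

/-- The copy of `x ∈ B i` in the `i`-th level of `⨁ i, B i`. -/
def FinSum.single (i : ℕ) (x : B i) : FinSum B :=
  ⟨Function.update ⊥ i x, (Set.finite_singleton i).subset (by
    intro j hj
    by_contra h
    exact hj (by rw [Function.update_of_ne h]; rfl))⟩

theorem FinSum.single_val (i : ℕ) (x : B i) :
    (FinSum.single i x).1 = Function.update (⊥ : ∀ i, B i) i x := rfl

theorem FinSum.ext_iff' {x y : FinSum B} : x = y ↔ ∀ i, x.1 i = y.1 i :=
  ⟨fun h _ => by rw [h], fun h => Subtype.ext (funext h)⟩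

theorem FinSum.single_op (f : ∀ i, B i → B i → B i) (hf : ∀ i, f i ⊥ ⊥ = ⊥) (i : ℕ) (x y : B i)
    (j : ℕ) : (FinSum.single i (f i x y)).1 j
      = f j ((FinSum.single i x).1 j) ((FinSum.single i y).1 j) := by
  simp only [FinSum.single_val]
  by_cases h : j = i
  · subst h; simp
  · simp [Function.update_of_ne h, hf]

/-- The endomorphism of `⨁ i, B i` that is `g : B i → B j` on level `i` (with values in level
`j`) and `∅` on all other levels. -/
def FinSum.shift (i j : ℕ) (g : GBAHom (B i) (B j)) : GBAHom (FinSum B) (FinSum B) where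
  toFun x := FinSum.single j (g (x.1 i))
  map_sup x y := FinSum.ext_iff'.2 fun k => by
    change (FinSum.single j (g (x.1 i ⊔ y.1 i))).1 k = _
    rw [g.map_sup]
    exact FinSum.single_op (fun _ a b => a ⊔ b) (fun _ => sup_idem _) j _ _ k
  map_inf x y := FinSum.ext_iff'.2 fun k => by
    change (FinSum.single j (g (x.1 i ⊓ y.1 i))).1 k = _
    rw [g.map_inf]
    exact FinSum.single_op (fun _ a b => a ⊓ b) (fun _ => inf_idem _) j _ _ k
  map_sdiff x y := FinSum.ext_iff'.2 fun k => by
    change (FinSum.single j (g (x.1 i \ y.1 i))).1 k = _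
    rw [g.map_sdiff]
    exact FinSum.single_op (fun _ a b => a \ b) (fun _ => sdiff_self) j _ _ k
  map_bot := FinSum.ext_iff'.2 fun k => by
    change (FinSum.single j (g ⊥)).1 k = ⊥
    rw [g.map_bot, FinSum.single_val]
    by_cases h : k = j
    · subst h; simp
    · simp [Function.update_of_ne h]

end DirectSum

/-! ### Generalized Boolean dynamical systems -/

/-- A generalized Boolean dynamical system `(B, L, θ, I)`: an action `θ a` of every letter and
ideals `I a` containing `{A | ∃ A', A ⊆ θ a A'}`. -/
structure GBDS (B : Type v) (L : Type w) [GeneralizedBooleanAlgebra B] where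
  θ : L → GBAHom B B
  I : L → Order.Ideal B
  mem_I : ∀ (a : L) (A A' : B), A ≤ θ a A' → A ∈ I a

namespace GBDS

variable {B : Type v} {L : Type w} [GeneralizedBooleanAlgebra B] (S : GBDS B L)

/-- `Δ_A`, the set of letters that act nontrivially on `A`. -/
def Δ (A : B) : Set L := {a | S.θ a A ≠ ⊥}

/-- The regular sets: every nonempty `A' ⊆ A` satisfies `0 < |Δ_{A'}| < ∞`. -/
def regular : Set B := {A | ∀ A' ≤ A, A' ≠ ⊥ → (S.Δ A').Nonempty ∧ (S.Δ A').Finite}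

/-- The sinks: `|Δ_A| = 0`. -/
def sink : Set B := {A | S.Δ A = ∅}

/-- `U` has no sinks: it has empty intersection with every sink. -/
def NoSinks (U : B) : Prop := ∀ V ∈ S.sink, U ⊓ V = ⊥

/-! ### The algebra of a generalized Boolean dynamical system -/

/-- The generators `p_A` for `A ∈ B`, and `s_{a,A}`, `s_{a,A}^*` for `a ∈ L` and `A ∈ I a`. -/
inductive Gen : Type (max v w)
  | p (A : B) : Gen
  | s (a : L) (A : {A // A ∈ S.I a}) : Gen
  | sStar (a : L) (A : {A // A ∈ S.I a}) : Gen

variable (R : Type u) [CommRing R]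

/-- The free (non-unital) associative `R`-algebra on the generators. -/
abbrev FreeAlg : Type (max u v w) := MonoidAlgebra R (FreeSemigroup S.Gen)

/-- The free generator `p_A`. -/
def fp (A : B) : S.FreeAlg R := MonoidAlgebra.single (FreeSemigroup.of (Gen.p A)) 1

/-- The free generator `s_{a,A}`. -/
def fs (a : L) (A : B) (h : A ∈ S.I a) : S.FreeAlg R :=
  MonoidAlgebra.single (FreeSemigroup.of (Gen.s a ⟨A, h⟩)) 1

/-- The free generator `s_{a,A}^*`. -/
def fsStar (a : L) (A : B) (h : A ∈ S.I a) : S.FreeAlg R :=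
  MonoidAlgebra.single (FreeSemigroup.of (Gen.sStar a ⟨A, h⟩)) 1

theorem inf_mem_I {a : L} {A : B} (h : A ∈ S.I a) (A' : B) : A ⊓ A' ∈ S.I a :=
  (S.I a).lower inf_le_left h

theorem θ_mem_I (a : L) (A : B) : S.θ a A ∈ S.I a := S.mem_I a _ A le_rfl

/-- The defining relations. -/
inductive Rel : S.FreeAlg R → S.FreeAlg R → Prop
  | p_bot : Rel (S.fp R ⊥) 0
  | p_inf (A A' : B) : Rel (S.fp R (A ⊓ A')) (S.fp R A * S.fp R A')
  | p_sup (A A' : B) : Rel (S.fp R (A ⊔ A')) (S.fp R A + S.fp R A' - S.fp R (A ⊓ A'))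
  | p_s (A : B) (a : L) (C : B) (hC : C ∈ S.I a) :
      Rel (S.fp R A * S.fs R a C hC) (S.fs R a C hC * S.fp R (S.θ a A))
  | sStar_p (A : B) (a : L) (C : B) (hC : C ∈ S.I a) :
      Rel (S.fsStar R a C hC * S.fp R A) (S.fp R (S.θ a A) * S.fsStar R a C hC)
  | sStar_s_self (a : L) (C C' : B) (hC : C ∈ S.I a) (hC' : C' ∈ S.I a) :
      Rel (S.fsStar R a C hC * S.fs R a C' hC') (S.fp R (C ⊓ C'))
  | sStar_s_ne (a a' : L) (h : a ≠ a') (C C' : B) (hC : C ∈ S.I a) (hC' : C' ∈ S.I a') :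
      Rel (S.fsStar R a C hC * S.fs R a' C' hC') 0
  | s_p (a : L) (C C' : B) (hC : C ∈ S.I a) :
      Rel (S.fs R a C hC * S.fp R C') (S.fs R a (C ⊓ C') (S.inf_mem_I hC C'))
  | p_sStar (a : L) (C C' : B) (hC : C ∈ S.I a) :
      Rel (S.fp R C' * S.fsStar R a C hC) (S.fsStar R a (C ⊓ C') (S.inf_mem_I hC C'))
  | cuntzKrieger (A : B) (hA : A ∈ S.regular) (F : Finset L) (hF : ∀ a, a ∈ F ↔ a ∈ S.Δ A) :
      Rel (S.fp R A) (∑ a ∈ F, S.fs R a (S.θ a A) (S.θ_mem_I a A) *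
        S.fsStar R a (S.θ a A) (S.θ_mem_I a A))

/-- The congruence of `R`-algebras generated by the relations. (In a non-unital algebra the
scalar multiples of the relations have to be included.) -/
def con : RingCon (S.FreeAlg R) :=
  ringConGen fun x y => ∃ (r : R) (x' y' : S.FreeAlg R), S.Rel R x' y' ∧ x = r • x' ∧ y = r • y'

theorem con_smul (r : R) {x y : S.FreeAlg R} (h : S.con R x y) : S.con R (r • x) (r • y) := by
  change RingConGen.Rel _ _ _ at h
  change RingConGen.Rel _ _ _
  induction h with
  | of x y h =>
    obtain ⟨t, x', y', h, rfl, rfl⟩ := h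
    exact .of _ _ ⟨r * t, x', y', h, by rw [mul_smul], by rw [mul_smul]⟩
  | refl x => exact .refl _
  | symm _ ih => exact .symm ih
  | trans _ _ ih ih' => exact .trans ih ih'
  | add _ _ ih ih' => rw [smul_add, smul_add]; exact .add ih ih'
  | mul _ h' ih _ => rw [← smul_mul_assoc, ← smul_mul_assoc]; exact .mul ih h'

/-- `L_R(B, L, θ, I)`: the (non-unital, associative) `R`-algebra generated by the symbols `p_A`,
`s_{a,A}`, `s_{a,A}^*` subject to the defining relations. -/
def Alg : Type (max u v w) := (S.con R).Quotient

instance : NonUnitalRing (S.Alg R) := inferInstanceAs (NonUnitalRing (S.con R).Quotient)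

/-- The quotient map from the free algebra. -/
def toAlg (x : S.FreeAlg R) : S.Alg R := ((x : (S.con R).Quotient))

theorem toAlg_surjective : Function.Surjective (S.toAlg R) := Quotient.mk''_surjective

instance : SMul R (S.Alg R) :=
  ⟨fun r => Quotient.map' (fun x => r • x) (fun _ _ h => S.con_smul R r h)⟩

theorem toAlg_smul (r : R) (x : S.FreeAlg R) : S.toAlg R (r • x) = r • S.toAlg R x := rfl
theorem toAlg_add (x y : S.FreeAlg R) : S.toAlg R (x + y) = S.toAlg R x + S.toAlg R y := rfl
theorem toAlg_mul (x y : S.FreeAlg R) : S.toAlg R (x * y) = S.toAlg R x * S.toAlg R y := rfl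
theorem toAlg_zero : S.toAlg R 0 = 0 := rfl

instance : Module R (S.Alg R) where
  one_smul x := by
    obtain ⟨x, rfl⟩ := S.toAlg_surjective R x
    rw [← toAlg_smul, one_smul]
  mul_smul r t x := by
    obtain ⟨x, rfl⟩ := S.toAlg_surjective R x
    simp only [← toAlg_smul, mul_smul]
  smul_zero r := by rw [← toAlg_zero, ← toAlg_smul, smul_zero]
  smul_add r x y := by
    obtain ⟨x, rfl⟩ := S.toAlg_surjective R x
    obtain ⟨y, rfl⟩ := S.toAlg_surjective R y
    simp only [← toAlg_smul, ← toAlg_add, smul_add]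
  add_smul r t x := by
    obtain ⟨x, rfl⟩ := S.toAlg_surjective R x
    simp only [← toAlg_smul, ← toAlg_add, add_smul]
  zero_smul x := by
    obtain ⟨x, rfl⟩ := S.toAlg_surjective R x
    rw [← toAlg_smul, zero_smul, toAlg_zero]

instance : IsScalarTower R (S.Alg R) (S.Alg R) where
  smul_assoc r x y := by
    obtain ⟨x, rfl⟩ := S.toAlg_surjective R x
    obtain ⟨y, rfl⟩ := S.toAlg_surjective R y
    simp only [smul_eq_mul, ← toAlg_smul, ← toAlg_mul, smul_mul_assoc]

instance : SMulCommClass R (S.Alg R) (S.Alg R) where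
  smul_comm r x y := by
    obtain ⟨x, rfl⟩ := S.toAlg_surjective R x
    obtain ⟨y, rfl⟩ := S.toAlg_surjective R y
    simp only [smul_eq_mul, ← toAlg_smul, ← toAlg_mul, mul_smul_comm]

/-! ### Desingularization -/

/-- `X_i`, with respect to the enumeration `e` of the alphabet in which the letter `a` is
`a_{e a + 1}`: the sets `U` without sinks such that `Δ_U ⊆ {a_1, …, a_{i-1}}`. For `i = 0, 1` the
second condition says `Δ_U = ∅`, so that `U = ∅`. -/
def X (e : L ↪ ℕ) (i : ℕ) : Order.Ideal B where
  carrier := {U | S.NoSinks U ∧ ∀ a ∈ S.Δ U, e a + 1 < i}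
  lower' := by
    rintro U V hVU ⟨h, h'⟩
    refine ⟨fun W hW => le_bot_iff.1 ((inf_le_inf_right W hVU).trans (h W hW).le),
      fun a ha => h' a fun hU => ha ?_⟩
    have := (S.θ a).map_inf V U
    rwa [inf_eq_left.2 hVU, hU, inf_bot_eq] at this
  nonempty' := ⟨⊥, fun _ _ => bot_inf_eq _, fun a ha => (ha (S.θ a).map_bot).elim⟩
  directed' := by
    rintro U ⟨hU, hU'⟩ V ⟨hV, hV'⟩
    refine ⟨U ⊔ V, ⟨fun W hW => ?_, fun a ha => ?_⟩, le_sup_left, le_sup_right⟩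
    · rw [inf_sup_right, hU W hW, hV W hW, sup_idem]
    · by_contra h
      refine ha ?_
      rw [(S.θ a).map_sup, not_not.1 fun h1 => h (hU' a h1), not_not.1 fun h1 => h (hV' a h1),
        sup_idem]

theorem mem_X {e : L ↪ ℕ} {i : ℕ} {U : B} :
    U ∈ S.X e i ↔ S.NoSinks U ∧ ∀ a ∈ S.Δ U, e a + 1 < i := Iff.rfl

theorem mem_X_zero {e : L ↪ ℕ} {U : B} : U ∈ S.X e 0 ↔ U = ⊥ := by
  refine ⟨fun ⟨h, h'⟩ => ?_, fun h => h ▸ (S.X e 0).bot_mem⟩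
  rw [← inf_idem U]
  exact h U (Set.eq_empty_of_forall_notMem fun a ha => absurd (h' a ha) (Nat.not_lt_zero _))

theorem X_mono (e : L ↪ ℕ) (i : ℕ) : ∀ U ∈ S.X e i, U ∈ S.X e (i + 1) :=
  fun _ hU => ⟨hU.1, fun a ha => (hU.2 a ha).trans (Nat.lt_succ_self i)⟩

theorem θ_mem_X_zero (e : L ↪ ℕ) (a : L) : ∀ U ∈ S.X e (e a + 1), S.θ a U ∈ S.X e 0 := by
  intro U hU
  rw [mem_X_zero]
  exact not_not.1 fun h => lt_irrefl _ (hU.2 a h)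

/-- `B_i = B / X_i`. -/
abbrev Level (e : L ↪ ℕ) (i : ℕ) : Type v := IdealQuotient (S.X e i)

/-- `B^F = ⨁ i, B / X_i`. -/
abbrev BF (e : L ↪ ℕ) : Type v := FinSum (S.Level e)

/-- `[A]_i`, viewed in the `i`-th level of `B^F`. -/
def cls (e : L ↪ ℕ) (i : ℕ) (A : B) : S.BF e := FinSum.single i (IdealQuotient.mk (S.X e i) A)

/-- The ideal `[K]_i = {[A]_i | A ∈ K}` of `B^F`, for an ideal `K` of `B`. -/
def clsIdeal (e : L ↪ ℕ) (i : ℕ) (K : Order.Ideal B) : Order.Ideal (S.BF e) where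
  carrier := {x | ∃ A ∈ K, x = S.cls e i A}
  lower' := by
    rintro _ y hy ⟨A, hA, rfl⟩
    obtain ⟨C, hC⟩ : ∃ C, y.1 i = IdealQuotient.mk (S.X e i) C :=
      ⟨_, (Quotient.out_eq (s := idealSetoid (S.X e i)) (y.1 i)).symm⟩
    refine ⟨C ⊓ A, K.lower inf_le_right hA, FinSum.ext_iff'.2 fun j => ?_⟩
    have hj := hy j
    change y.1 j ≤ Function.update ⊥ i _ j at hj
    change y.1 j = Function.update ⊥ i _ j
    by_cases h : j = i
    · subst h
      rw [Function.update_self] at hj ⊢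
      rw [← inf_eq_left.2 hj, hC]
      rfl
    · rw [Function.update_of_ne h] at hj ⊢
      exact le_bot_iff.1 hj
  nonempty' := ⟨_, ⊥, K.bot_mem, rfl⟩
  directed' := by
    rintro _ ⟨A, hA, rfl⟩ _ ⟨A', hA', rfl⟩
    have : S.cls e i (A ⊔ A') = S.cls e i A ⊔ S.cls e i A' := FinSum.ext_iff'.2 fun j =>
      FinSum.single_op (B := S.Level e) (fun _ a b => a ⊔ b) (fun _ => sup_idem _) i
        (IdealQuotient.mk (S.X e i) A) (IdealQuotient.mk (S.X e i) A') j
    exact ⟨_, ⟨A ⊔ A', K.sup_mem hA hA', rfl⟩, this ▸ le_sup_left, this ▸ le_sup_right⟩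

/-- The action `θ^F` of the alphabet `L^F = L ∪ {b_1, b_2, …}`, where `Sum.inr n` is `b_{n+1}`:
for the letter `a = a_i` it is `[A]_i ↦ [θ_a A]_0` and `∅` on the other levels; for `b_{n+1}` it is
the quotient map `[A]_n ↦ [A]_{n+1}` and `∅` on the other levels. -/
def θF (e : L ↪ ℕ) : L ⊕ ℕ → GBAHom (S.BF e) (S.BF e)
  | Sum.inl a => FinSum.shift (e a + 1) 0
      (IdealQuotient.map (S.X e (e a + 1)) (S.X e 0) (S.θ a) (S.θ_mem_X_zero e a))
  | Sum.inr n => FinSum.shift n (n + 1)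
      (IdealQuotient.map (S.X e n) (S.X e (n + 1)) (GBAHom.id B) (S.X_mono e n))

/-- The ideals `I^F`: `[I_a]_0` for a letter `a ∈ L`, and all of `B_{n+1}` for `b_{n+1}`. -/
def IF (e : L ↪ ℕ) : L ⊕ ℕ → Order.Ideal (S.BF e)
  | Sum.inl a => S.clsIdeal e 0 (S.I a)
  | Sum.inr n => S.clsIdeal e (n + 1) ⊤

/-- The generalized Boolean dynamical system `(B^F, L^F, θ^F, I^F)`. -/
def desing (e : L ↪ ℕ) : GBDS (S.BF e) (L ⊕ ℕ) where
  θ := S.θF e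
  I := S.IF e
  mem_I := by
    rintro (a | n) A x h
    · refine (S.IF e (Sum.inl a)).lower h ?_
      obtain ⟨C, hC⟩ : ∃ C, x.1 (e a + 1) = IdealQuotient.mk (S.X e (e a + 1)) C :=
        ⟨_, (Quotient.out_eq (s := idealSetoid (S.X e (e a + 1))) (x.1 (e a + 1))).symm⟩
      refine ⟨S.θ a C, S.θ_mem_I a C, ?_⟩
      change FinSum.single (B := S.Level e) 0 (IdealQuotient.map _ _ _ _ (x.1 (e a + 1))) = _
      rw [hC]
      rfl
    · refine (S.IF e (Sum.inr n)).lower h ?_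
      obtain ⟨C, hC⟩ : ∃ C, x.1 n = IdealQuotient.mk (S.X e n) C :=
        ⟨_, (Quotient.out_eq (s := idealSetoid (S.X e n)) (x.1 n)).symm⟩
      refine ⟨C, trivial, ?_⟩
      change FinSum.single (B := S.Level e) (n + 1) (IdealQuotient.map _ _ _ _ (x.1 n)) = _
      rw [hC]
      rfl

theorem desing_θ_inl (e : L ↪ ℕ) (a : L) (A : B) :
    (S.desing e).θ (Sum.inl a) (S.cls e (e a + 1) A) = S.cls e 0 (S.θ a A) := by
  change FinSum.single (B := S.Level e) 0 (IdealQuotient.map _ _ _ _ (Function.update (⊥ : ∀ i, S.Level e i) _ _ _)) = _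
  rw [Function.update_self]
  rfl

theorem desing_θ_inr (e : L ↪ ℕ) (n : ℕ) (A : B) :
    (S.desing e).θ (Sum.inr n) (S.cls e n A) = S.cls e (n + 1) A := by
  change FinSum.single (B := S.Level e) (n + 1) (IdealQuotient.map _ _ _ _ (Function.update (⊥ : ∀ i, S.Level e i) _ _ _)) = _
  rw [Function.update_self]
  rfl

end GBDS

/-! ### Morita equivalence of non-unital algebras -/

/-- A surjective Morita context between two (not necessarily unital) `R`-algebras: an
`A`-`C`-bimodule `M` and a `C`-`A`-bimodule `N`, both unital (`A M = M = M C`, `C N = N = N A`),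
and surjective bimodule maps `φ : M ⊗_C N → A` and `ψ : N ⊗_A M → C` with
`φ(m, n) m' = m ψ(n, m')` and `ψ(n, m) n' = n φ(m, n')`. -/
structure MoritaContext (R : Type u) [CommRing R] (A : Type v) (C : Type w)
    [NonUnitalRing A] [Module R A] [IsScalarTower R A A] [SMulCommClass R A A]
    [NonUnitalRing C] [Module R C] [IsScalarTower R C C] [SMulCommClass R C C] where
  M : Type (max v w)
  N : Type (max v w)
  [addM : AddCommGroup M]
  [modM : Module R M]
  [addN : AddCommGroup N]
  [modN : Module R N]
  /-- the left action `(a, m) ↦ a m` of `A` on `M` -/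
  AM : A →ₗ[R] M →ₗ[R] M
  /-- the right action `(m, c) ↦ m c` of `C` on `M` -/
  MC : M →ₗ[R] C →ₗ[R] M
  /-- the left action `(c, n) ↦ c n` of `C` on `N` -/
  CN : C →ₗ[R] N →ₗ[R] N
  /-- the right action `(n, a) ↦ n a` of `A` on `N` -/
  NA : N →ₗ[R] A →ₗ[R] N
  AM_mul : ∀ a a' m, AM (a * a') m = AM a (AM a' m)
  MC_mul : ∀ m c c', MC m (c * c') = MC (MC m c) c'
  AM_MC : ∀ a m c, MC (AM a m) c = AM a (MC m c)
  CN_mul : ∀ c c' n, CN (c * c') n = CN c (CN c' n)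
  NA_mul : ∀ n a a', NA n (a * a') = NA (NA n a) a'
  CN_NA : ∀ c n a, NA (CN c n) a = CN c (NA n a)
  AM_unital : Submodule.span R {x | ∃ a m, x = AM a m} = ⊤
  MC_unital : Submodule.span R {x | ∃ m c, x = MC m c} = ⊤
  CN_unital : Submodule.span R {x | ∃ c n, x = CN c n} = ⊤
  NA_unital : Submodule.span R {x | ∃ n a, x = NA n a} = ⊤
  φ : M →ₗ[R] N →ₗ[R] A
  ψ : N →ₗ[R] M →ₗ[R] C
  φ_balanced : ∀ m c n, φ (MC m c) n = φ m (CN c n)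
  φ_left : ∀ a m n, φ (AM a m) n = a * φ m n
  φ_right : ∀ m n a, φ m (NA n a) = φ m n * a
  ψ_balanced : ∀ n a m, ψ (NA n a) m = ψ n (AM a m)
  ψ_left : ∀ c n m, ψ (CN c n) m = c * ψ n m
  ψ_right : ∀ n m c, ψ n (MC m c) = ψ n m * c
  φ_ψ : ∀ m n m', AM (φ m n) m' = MC m (ψ n m')
  ψ_φ : ∀ n m n', CN (ψ n m) n' = NA n (φ m n')
  φ_surjective : Submodule.span R {x | ∃ m n, x = φ m n} = ⊤
  ψ_surjective : Submodule.span R {x | ∃ n m, x = ψ n m} = ⊤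

/-- Morita equivalence of `R`-algebras, in the form used for idempotent rings and rings with local
units, where there need not be a unit: existence of a surjective Morita context. -/
def MoritaEquivalent (R : Type u) [CommRing R] (A : Type v) (C : Type w)
    [NonUnitalRing A] [Module R A] [IsScalarTower R A A] [SMulCommClass R A A]
    [NonUnitalRing C] [Module R C] [IsScalarTower R C C] [SMulCommClass R C C] : Prop :=
  Nonempty (MoritaContext.{u, v, w} R A C)

end BooleanDynamics

end

noncomputable section

namespace BooleanDynamics

universe u v w x y

/-!
Let `E` and `F` be the algebras of `S` and of its desingularization, and let `Q` be the algebra of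
the system `S.minSystem` that has the same action as `S` and the smallest possible ideals. The
algebra `Q` is a full corner both of `E` and of `F`, and two algebras that share a full corner are
Morita equivalent.

The map `Q → E` is injective because `E` acts on the module coinduced from the regular module of
`Q`, where the elements of `Q` can be recognized. The map `Q → F` sends `p_A` to `p_{[A]_0}` and
`s_{a_i,C}` to a product `s_{b_1} ⋯ s_{b_i} s_{a_i,C}`, so that its image lives on level zero.

The algebra `F` acts by matrices over `E`, in which the projection of `[A]_i` becomes the diagonal
entry `p_A - ∑_{j < i} s_{a_j} s_{a_j}^*` at place `i`: this is the part of `p_A` that is left after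
the first letters have branched off, and it vanishes for `A ∈ X_i`. The composition
`Q → F → Mat(E)` is `Q → E`, placed at `(0, 0)`, hence injective; because the corner is full,
`F → Mat(E)` is then injective as well. Both `E` and `F` therefore embed in one algebra in which
their corners coincide.
-/

namespace GBDS

variable {B : Type v} {L : Type w} [GeneralizedBooleanAlgebra B] (S : GBDS B L)

/-! ### The universal property and the involution -/

/-- A representation of a generalized Boolean dynamical system in a non-unital ring: elements
`p C`, `s a C` and `t a C`, standing for `p_C`, `s_{a,C}` and `s_{a,C}^*`, that satisfy the
defining relations of `L_R(B, L, θ, I)`. -/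
structure Rep (A : Type x) [NonUnitalRing A] where
  p : B → A
  s : ∀ (a : L) (C : B), C ∈ S.I a → A
  t : ∀ (a : L) (C : B), C ∈ S.I a → A
  p_bot : p ⊥ = 0
  p_inf : ∀ C D, p (C ⊓ D) = p C * p D
  p_sup : ∀ C D, p (C ⊔ D) = p C + p D - p (C ⊓ D)
  p_s : ∀ D a C hC, p D * s a C hC = s a C hC * p (S.θ a D)
  t_p : ∀ D a C hC, t a C hC * p D = p (S.θ a D) * t a C hC
  t_s_self : ∀ a C D hC hD, t a C hC * s a D hD = p (C ⊓ D)
  t_s_ne : ∀ a b, a ≠ b → ∀ C D hC hD, t a C hC * s b D hD = 0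
  s_p : ∀ a C D hC, s a C hC * p D = s a (C ⊓ D) (S.inf_mem_I hC D)
  p_t : ∀ a C D hC, p D * t a C hC = t a (C ⊓ D) (S.inf_mem_I hC D)
  cuntzKrieger : ∀ C ∈ S.regular, ∀ F : Finset L, (∀ a, a ∈ F ↔ a ∈ S.Δ C) →
    p C = ∑ a ∈ F, s a (S.θ a C) (S.θ_mem_I a C) * t a (S.θ a C) (S.θ_mem_I a C)

variable (R : Type u) [CommRing R]

namespace Rep

variable {S} {A : Type x} [NonUnitalRing A]

/-- The image of a generator under a representation. -/
def onGen (ρ : S.Rep A) : S.Gen → A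
  | .p C => ρ.p C
  | .s a C => ρ.s a C.1 C.2
  | .sStar a C => ρ.t a C.1 C.2

variable [Module R A] [IsScalarTower R A A] [SMulCommClass R A A] (ρ : S.Rep A)

/-- The extension of a representation to the free algebra. -/
def freeLift : S.FreeAlg R →ₙₐ[R] A := MonoidAlgebra.liftMagma R (FreeSemigroup.lift ρ.onGen)

theorem freeLift_single (g : S.Gen) :
    ρ.freeLift R (MonoidAlgebra.single (FreeSemigroup.of g) 1) = ρ.onGen g := by
  simp [freeLift, MonoidAlgebra.liftMagma]

theorem freeLift_fp (C : B) : ρ.freeLift R (S.fp R C) = ρ.p C := ρ.freeLift_single R _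

theorem freeLift_fs (a : L) (C : B) (h) : ρ.freeLift R (S.fs R a C h) = ρ.s a C h :=
  ρ.freeLift_single R _

theorem freeLift_fsStar (a : L) (C : B) (h) : ρ.freeLift R (S.fsStar R a C h) = ρ.t a C h :=
  ρ.freeLift_single R _

theorem freeLift_eq_of_rel {x y : S.FreeAlg R} (h : S.Rel R x y) :
    ρ.freeLift R x = ρ.freeLift R y := by
  cases h <;> simp only [map_mul, map_add, map_sub, map_zero, map_sum, freeLift_fp, freeLift_fs,
    freeLift_fsStar]
  case p_bot => exact ρ.p_bot
  case p_inf => exact ρ.p_inf _ _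
  case p_sup => exact ρ.p_sup _ _
  case p_s => exact ρ.p_s _ _ _ _
  case sStar_p => exact ρ.t_p _ _ _ _
  case sStar_s_self => exact ρ.t_s_self _ _ _ _ _
  case sStar_s_ne h _ _ _ _ => exact ρ.t_s_ne _ _ h _ _ _ _
  case s_p => exact ρ.s_p _ _ _ _
  case p_sStar => exact ρ.p_t _ _ _ _
  case cuntzKrieger hA F hF => exact ρ.cuntzKrieger _ hA F hF

theorem freeLift_eq_of_con {x y : S.FreeAlg R} (h : S.con R x y) :
    ρ.freeLift R x = ρ.freeLift R y := by
  change RingConGen.Rel _ _ _ at h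
  induction h with
  | of x y h =>
    obtain ⟨r, x', y', h, rfl, rfl⟩ := h
    rw [map_smul, map_smul, ρ.freeLift_eq_of_rel R h]
  | refl x => rfl
  | symm _ ih => exact ih.symm
  | trans _ _ ih ih' => exact ih.trans ih'
  | add _ _ ih ih' => rw [map_add, map_add, ih, ih']
  | mul _ _ ih ih' => rw [map_mul, map_mul, ih, ih']

/-- The homomorphism `L_R(B, L, θ, I) → A` that a representation in an `R`-algebra `A` induces by
the universal property. -/
def lift : S.Alg R →ₙₐ[R] A where
  toFun := Quotient.lift (ρ.freeLift R) fun _ _ h => ρ.freeLift_eq_of_con R h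
  map_smul' r x := by
    obtain ⟨x, rfl⟩ := S.toAlg_surjective R x
    exact map_smul (ρ.freeLift R) r x
  map_zero' := map_zero (ρ.freeLift R)
  map_add' x y := by
    obtain ⟨x, rfl⟩ := S.toAlg_surjective R x
    obtain ⟨y, rfl⟩ := S.toAlg_surjective R y
    exact map_add (ρ.freeLift R) x y
  map_mul' x y := by
    obtain ⟨x, rfl⟩ := S.toAlg_surjective R x
    obtain ⟨y, rfl⟩ := S.toAlg_surjective R y
    exact map_mul (ρ.freeLift R) x y

end Rep

/-- The generator `p_A` of `L_R(B, L, θ, I)`. -/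
def P (A : B) : S.Alg R := S.toAlg R (S.fp R A)

/-- The generator `s_{a,A}` of `L_R(B, L, θ, I)`. -/
def s (a : L) (A : B) (h : A ∈ S.I a) : S.Alg R := S.toAlg R (S.fs R a A h)

/-- The generator `s_{a,A}^*` of `L_R(B, L, θ, I)`. -/
def t (a : L) (A : B) (h : A ∈ S.I a) : S.Alg R := S.toAlg R (S.fsStar R a A h)

section Lift

variable {S} {R} {A : Type x} [NonUnitalRing A] [Module R A] [IsScalarTower R A A]
  [SMulCommClass R A A] (ρ : S.Rep A)

@[simp] theorem Rep.lift_P (C : B) : ρ.lift R (S.P R C) = ρ.p C := ρ.freeLift_fp R C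

@[simp] theorem Rep.lift_s (a : L) (C : B) (h) : ρ.lift R (S.s R a C h) = ρ.s a C h :=
  ρ.freeLift_fs R a C h

@[simp] theorem Rep.lift_t (a : L) (C : B) (h) : ρ.lift R (S.t R a C h) = ρ.t a C h :=
  ρ.freeLift_fsStar R a C h

end Lift

theorem toAlg_sum {ι : Type*} (F : Finset ι) (f : ι → S.FreeAlg R) :
    S.toAlg R (∑ i ∈ F, f i) = ∑ i ∈ F, S.toAlg R (f i) :=
  map_sum (⟨⟨S.toAlg R, S.toAlg_zero R⟩, S.toAlg_add R⟩ : S.FreeAlg R →+ S.Alg R) f F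

theorem toAlg_eq_of_rel {x y : S.FreeAlg R} (h : S.Rel R x y) : S.toAlg R x = S.toAlg R y :=
  Quotient.sound (s := (S.con R).toSetoid)
    (RingConGen.Rel.of x y ⟨1, x, y, h, (one_smul _ _).symm, (one_smul _ _).symm⟩)

/-- The universal representation, by the generators of `L_R(B, L, θ, I)`. -/
def univRep : S.Rep (S.Alg R) where
  p := S.P R
  s := S.s R
  t := S.t R
  p_bot := S.toAlg_eq_of_rel R .p_bot
  p_inf C D := S.toAlg_eq_of_rel R (.p_inf C D)
  p_sup C D := S.toAlg_eq_of_rel R (.p_sup C D)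
  p_s D a C hC := S.toAlg_eq_of_rel R (.p_s D a C hC)
  t_p D a C hC := S.toAlg_eq_of_rel R (.sStar_p D a C hC)
  t_s_self a C D hC hD := S.toAlg_eq_of_rel R (.sStar_s_self a C D hC hD)
  t_s_ne a b h C D hC hD := S.toAlg_eq_of_rel R (.sStar_s_ne a b h C D hC hD)
  s_p a C D hC := S.toAlg_eq_of_rel R (.s_p a C D hC)
  p_t a C D hC := S.toAlg_eq_of_rel R (.p_sStar a C D hC)
  cuntzKrieger C hC F hF :=
    (S.toAlg_eq_of_rel R (.cuntzKrieger C hC F hF)).trans (S.toAlg_sum R F _)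

variable {S R}

@[elab_as_elim]
theorem alg_induction {motive : S.Alg R → Prop} (P : ∀ C, motive (S.P R C))
    (s : ∀ a C hC, motive (S.s R a C hC)) (t : ∀ a C hC, motive (S.t R a C hC))
    (mul : ∀ x y, motive x → motive y → motive (x * y))
    (add : ∀ x y, motive x → motive y → motive (x + y))
    (smul : ∀ (r : R) x, motive x → motive (r • x)) (z : S.Alg R) : motive z := by
  have monomial : ∀ m, motive (S.toAlg R (MonoidAlgebra.single m 1)) := fun m => by
    have of : ∀ g : S.Gen, motive (S.toAlg R (MonoidAlgebra.single (FreeSemigroup.of g) 1)) := by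
      rintro (C | ⟨a, C⟩ | ⟨a, C⟩)
      exacts [P C, s a C.1 C.2, t a C.1 C.2]
    induction m using FreeSemigroup.recOnMul with
    | ih1 g => exact of g
    | ih2 g m _ ih =>
      rw [← one_mul (1 : R), ← MonoidAlgebra.single_mul_single, toAlg_mul]
      exact mul _ _ (of g) ih
  obtain ⟨z, rfl⟩ := S.toAlg_surjective R z
  induction z using MonoidAlgebra.induction_linear with
  | zero => simpa only [zero_smul, toAlg_zero] using smul 0 _ (P ⊥)
  | add f g hf hg => exact add _ _ hf hg
  | single m r =>
    rw [← mul_one r, ← smul_eq_mul, ← MonoidAlgebra.smul_single, toAlg_smul]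
    exact smul r _ (monomial m)

variable (S R) in
/-- The representation in the opposite algebra that exchanges `s_{a,A}` and `s_{a,A}^*`; it
induces the involution of `L_R(B, L, θ, I)`. -/
def opRep : S.Rep (S.Alg R)ᵐᵒᵖ where
  p C := .op (S.P R C)
  s a C hC := .op (S.t R a C hC)
  t a C hC := .op (S.s R a C hC)
  p_bot := congrArg MulOpposite.op (S.univRep R).p_bot
  p_inf C D := congrArg MulOpposite.op (by rw [inf_comm]; exact (S.univRep R).p_inf D C)
  p_sup C D := congrArg MulOpposite.op ((S.univRep R).p_sup C D)
  p_s D a C hC := congrArg MulOpposite.op ((S.univRep R).t_p D a C hC)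
  t_p D a C hC := congrArg MulOpposite.op ((S.univRep R).p_s D a C hC)
  t_s_self a C D hC hD := congrArg MulOpposite.op (by
    rw [inf_comm]; exact (S.univRep R).t_s_self a D C hD hC)
  t_s_ne a b h C D hC hD :=
    congrArg MulOpposite.op ((S.univRep R).t_s_ne b a (Ne.symm h) D C hD hC)
  s_p a C D hC := congrArg MulOpposite.op ((S.univRep R).p_t a C D hC)
  p_t a C D hC := congrArg MulOpposite.op ((S.univRep R).s_p a C D hC)
  cuntzKrieger C hC F hF := by
    rw [(S.univRep R).cuntzKrieger C hC F hF |> (show S.P R C = _ from ·)]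
    exact map_sum MulOpposite.opAddEquiv _ F

instance : Star (S.Alg R) := ⟨fun z => ((S.opRep R).lift R z).unop⟩

@[simp] theorem star_P (C : B) : star (S.P R C) = S.P R C :=
  MulOpposite.op_injective ((S.opRep R).lift_P C)

@[simp] theorem star_s (a : L) (C : B) (hC) : star (S.s R a C hC) = S.t R a C hC :=
  MulOpposite.op_injective ((S.opRep R).lift_s a C hC)

@[simp] theorem star_t (a : L) (C : B) (hC) : star (S.t R a C hC) = S.s R a C hC :=
  MulOpposite.op_injective ((S.opRep R).lift_t a C hC)

theorem star_smul' (r : R) (z : S.Alg R) : star (r • z) = r • star z :=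
  MulOpposite.op_injective (map_smul ((S.opRep R).lift R) r z)

instance : StarRing (S.Alg R) where
  star_mul x y := MulOpposite.op_injective (map_mul ((S.opRep R).lift R) x y)
  star_add x y := MulOpposite.op_injective (map_add ((S.opRep R).lift R) x y)
  star_involutive z := by
    have star_add' (x y : S.Alg R) : star (x + y) = star x + star y :=
      MulOpposite.op_injective (map_add ((S.opRep R).lift R) x y)
    have star_mul' (x y : S.Alg R) : star (x * y) = star y * star x :=
      MulOpposite.op_injective (map_mul ((S.opRep R).lift R) x y)
    induction z using alg_induction with
    | P C => rw [star_P, star_P]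
    | s a C hC => rw [star_s, star_t]
    | t a C hC => rw [star_t, star_s]
    | mul x y hx hy => rw [star_mul', star_mul', hx, hy]
    | add x y hx hy => rw [star_add', star_add', hx, hy]
    | smul r x hx => rw [star_smul', star_smul', hx]

/-! ### Calculus with the generators -/

theorem P_bot : S.P R ⊥ = 0 := (S.univRep R).p_bot

theorem P_mul_P (C D : B) : S.P R C * S.P R D = S.P R (C ⊓ D) := ((S.univRep R).p_inf C D).symm

theorem P_sup (C D : B) : S.P R (C ⊔ D) = S.P R C + S.P R D - S.P R (C ⊓ D) :=
  (S.univRep R).p_sup C D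

theorem P_mul_P_of_le {C D : B} (h : C ≤ D) : S.P R C * S.P R D = S.P R C := by
  rw [P_mul_P, inf_eq_left.2 h]

theorem P_mul_P_of_ge {C D : B} (h : D ≤ C) : S.P R C * S.P R D = S.P R D := by
  rw [P_mul_P, inf_eq_right.2 h]

section Letter

variable {a : L} {C D : B}

theorem s_mul_P (hC : C ∈ S.I a) (D : B) :
    S.s R a C hC * S.P R D = S.s R a (C ⊓ D) (S.inf_mem_I hC _) := (S.univRep R).s_p _ _ _ _

theorem P_mul_s (hC : C ∈ S.I a) (D : B) :
    S.P R D * S.s R a C hC = S.s R a (C ⊓ S.θ a D) (S.inf_mem_I hC _) :=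
  ((S.univRep R).p_s D a C hC).trans (s_mul_P hC _)

theorem P_mul_t (hC : C ∈ S.I a) (D : B) :
    S.P R D * S.t R a C hC = S.t R a (C ⊓ D) (S.inf_mem_I hC _) := (S.univRep R).p_t _ _ _ _

theorem t_mul_P (hC : C ∈ S.I a) (D : B) :
    S.t R a C hC * S.P R D = S.t R a (C ⊓ S.θ a D) (S.inf_mem_I hC _) :=
  ((S.univRep R).t_p D a C hC).trans (P_mul_t hC _)

theorem t_mul_s_self (hC : C ∈ S.I a) (hD : D ∈ S.I a) :
    S.t R a C hC * S.s R a D hD = S.P R (C ⊓ D) := (S.univRep R).t_s_self _ _ _ _ _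

theorem t_mul_s_of_ne {b : L} (h : a ≠ b) (hC : C ∈ S.I a) (hD : D ∈ S.I b) :
    S.t R a C hC * S.s R b D hD = 0 := (S.univRep R).t_s_ne _ _ h _ _ _ _

theorem s_congr (h : C = D) (hC : C ∈ S.I a) (hD : D ∈ S.I a) :
    S.s R a C hC = S.s R a D hD := by subst h; rfl

theorem t_congr (h : C = D) (hC : C ∈ S.I a) (hD : D ∈ S.I a) :
    S.t R a C hC = S.t R a D hD := by subst h; rfl

theorem s_mul_P_of_le (hC : C ∈ S.I a) (h : C ≤ D) : S.s R a C hC * S.P R D = S.s R a C hC :=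
  (s_mul_P hC D).trans (s_congr (inf_eq_left.2 h) _ _)

theorem P_mul_t_of_le (hC : C ∈ S.I a) (h : C ≤ D) : S.P R D * S.t R a C hC = S.t R a C hC :=
  (P_mul_t hC D).trans (t_congr (inf_eq_left.2 h) _ _)

theorem P_mul_s_of_le (hC : C ∈ S.I a) (h : C ≤ S.θ a D) :
    S.P R D * S.s R a C hC = S.s R a C hC :=
  (P_mul_s hC D).trans (s_congr (inf_eq_left.2 h) _ _)

theorem s_eq_zero (h : C = ⊥) (hC : C ∈ S.I a) : S.s R a C hC = 0 := by
  rw [← s_mul_P_of_le hC h.le, P_bot, mul_zero]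

end Letter

/-! ### Local units -/

variable (S R) in
/-- The set of the commuting idempotents `p_A` and `s_{a,C} s_{a,C}^*`, from which the local units
of `L_R(B, L, θ, I)` are built. -/
def diagonal : Set (S.Alg R) :=
  {x | (∃ A, x = S.P R A) ∨ ∃ a C hC, x = S.s R a C hC * S.t R a C hC}

theorem isSelfAdjoint_of_mem_diagonal {x : S.Alg R} (hx : x ∈ S.diagonal R) :
    IsSelfAdjoint x := by
  obtain ⟨A, rfl⟩ | ⟨a, C, hC, rfl⟩ := hx
  · exact star_P A
  · rw [IsSelfAdjoint, star_mul, star_s, star_t]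

theorem P_mul_s_mul_t {a : L} {C : B} (hC : C ∈ S.I a) (A : B) :
    S.P R A * (S.s R a C hC * S.t R a C hC) =
      S.s R a C hC * S.P R (S.θ a A) * star (S.s R a C hC) := by
  rw [star_s, ← mul_assoc, P_mul_s, s_mul_P]

theorem s_mul_t_mul_s_mul_t {a : L} {C D : B} (hC : C ∈ S.I a) (hD : D ∈ S.I a) :
    S.s R a C hC * S.t R a C hC * (S.s R a D hD * S.t R a D hD) =
      S.s R a (C ⊓ D) (S.inf_mem_I hC D) * star (S.s R a (C ⊓ D) (S.inf_mem_I hC D)) := by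
  have hs : S.s R a C hC * S.P R (C ⊓ D) = S.s R a (C ⊓ D) (S.inf_mem_I hC D) :=
    (s_mul_P hC _).trans (s_congr (inf_eq_right.2 inf_le_left) _ _)
  have ht : S.P R (C ⊓ D) * S.t R a D hD = S.t R a (C ⊓ D) (S.inf_mem_I hC D) :=
    (P_mul_t hD _).trans (t_congr (inf_eq_right.2 inf_le_right) _ _)
  calc S.s R a C hC * S.t R a C hC * (S.s R a D hD * S.t R a D hD)
    _ = S.s R a C hC * (S.t R a C hC * S.s R a D hD) * S.t R a D hD := by simp only [mul_assoc]
    _ = S.s R a C hC * S.P R (C ⊓ D) * (S.P R (C ⊓ D) * S.t R a D hD) := by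
      rw [t_mul_s_self, mul_assoc, mul_assoc, ← mul_assoc (S.P R _) (S.P R _), P_mul_P, inf_idem]
    _ = _ := by rw [hs, ht, star_s]

theorem isSelfAdjoint_mul_of_mem_diagonal {x y : S.Alg R} (hx : x ∈ S.diagonal R)
    (hy : y ∈ S.diagonal R) : IsSelfAdjoint (x * y) := by
  have hPs (A : B) {a : L} {C : B} (hC : C ∈ S.I a) :
      IsSelfAdjoint (S.P R A * (S.s R a C hC * S.t R a C hC)) := by
    rw [P_mul_s_mul_t]
    exact IsSelfAdjoint.conjugate (star_P _) _
  obtain ⟨A, rfl⟩ | ⟨a, C, hC, rfl⟩ := id hx <;> obtain ⟨A', rfl⟩ | ⟨b, D, hD, rfl⟩ := id hy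
  · rw [P_mul_P]
    exact star_P _
  · exact hPs A hD
  · rw [← (((isSelfAdjoint_of_mem_diagonal hy).commute_iff
      (isSelfAdjoint_of_mem_diagonal hx)).2 (hPs A' hC)).eq]
    exact hPs A' hC
  · obtain rfl | hab := eq_or_ne a b
    · rw [s_mul_t_mul_s_mul_t]
      exact IsSelfAdjoint.mul_star_self _
    · rw [mul_assoc, ← mul_assoc (S.t R a C hC), t_mul_s_of_ne hab, zero_mul, mul_zero]
      exact IsSelfAdjoint.zero _

theorem commute_of_mem_closure_diagonal {x y : S.Alg R}
    (hx : x ∈ NonUnitalSubring.closure (S.diagonal R))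
    (hy : y ∈ NonUnitalSubring.closure (S.diagonal R)) : Commute x y := by
  have := NonUnitalSubring.isMulCommutative_closure (s := S.diagonal R) fun x hx y hy =>
    (((isSelfAdjoint_of_mem_diagonal hx).commute_iff (isSelfAdjoint_of_mem_diagonal hy)).2
      (isSelfAdjoint_mul_of_mem_diagonal hx hy)).eq
  exact congrArg Subtype.val
    (mul_comm' (⟨x, hx⟩ : NonUnitalSubring.closure (S.diagonal R)) ⟨y, hy⟩)

theorem exists_mem_closure_diagonal_mul_eq (z : S.Alg R) :
    ∃ u ∈ NonUnitalSubring.closure (S.diagonal R), u * z = z := by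
  have hP (A : B) : S.P R A ∈ NonUnitalSubring.closure (S.diagonal R) :=
    NonUnitalSubring.subset_closure (.inl ⟨A, rfl⟩)
  induction z using alg_induction with
  | P C => exact ⟨_, hP C, P_mul_P_of_le le_rfl⟩
  | s a C hC =>
    refine ⟨_, NonUnitalSubring.subset_closure (.inr ⟨a, C, hC, rfl⟩), ?_⟩
    rw [mul_assoc, t_mul_s_self, inf_idem, s_mul_P_of_le hC le_rfl]
  | t a C hC => exact ⟨_, hP C, P_mul_t_of_le hC le_rfl⟩
  | mul x y hx _ =>
    obtain ⟨u, hu, hux⟩ := hx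
    exact ⟨u, hu, by rw [← mul_assoc, hux]⟩
  | add x y hx hy =>
    obtain ⟨u, hu, hux⟩ := hx
    obtain ⟨v, hv, hvy⟩ := hy
    have huv : v * u * y = u * y := by
      rw [(commute_of_mem_closure_diagonal hv hu).eq, mul_assoc, hvy]
    refine ⟨u + v - v * u, sub_mem (add_mem hu hv) (mul_mem hv hu), ?_⟩
    rw [mul_add, sub_mul, sub_mul, add_mul, add_mul, huv, hvy, mul_assoc, hux]
    abel
  | smul r x hx =>
    obtain ⟨u, hu, hux⟩ := hx
    exact ⟨u, hu, by rw [mul_smul_comm, hux]⟩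

theorem exists_mul_eq_self (z : S.Alg R) : ∃ u, u * z = z :=
  let ⟨u, _, hu⟩ := exists_mem_closure_diagonal_mul_eq z
  ⟨u, hu⟩

theorem exists_self_mul_eq (z : S.Alg R) : ∃ u, z * u = z := by
  obtain ⟨u, hu⟩ := exists_mul_eq_self (star z)
  exact ⟨star u, star_injective (by rw [star_mul, star_star, hu])⟩

end GBDS

namespace GBDS

variable {B : Type v} {L : Type w} [GeneralizedBooleanAlgebra B] (S : GBDS B L)
variable (R : Type u) [CommRing R]

/-! ### The system with minimal ideals -/

theorem θ_mono (a : L) {A A' : B} (h : A ≤ A') : S.θ a A ≤ S.θ a A' := by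
  rw [← inf_eq_left, ← (S.θ a).map_inf, inf_eq_left.2 h]

/-- The same action with the smallest possible ideals `{C | ∃ A, C ≤ θ a A}`. -/
def minSystem : GBDS B L where
  θ := S.θ
  I a :=
    { carrier := {C | ∃ A, C ≤ S.θ a A}
      lower' := fun _ _ h ⟨A, hA⟩ => ⟨A, h.trans hA⟩
      nonempty' := ⟨⊥, ⊥, bot_le⟩
      directed' := fun C ⟨A, hA⟩ C' ⟨A', hA'⟩ => ⟨C ⊔ C',
        ⟨A ⊔ A', by rw [(S.θ a).map_sup]; exact sup_le_sup hA hA'⟩, le_sup_left, le_sup_right⟩ }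
  mem_I _ _ A' h := ⟨A', h⟩

@[simp] theorem minSystem_θ : S.minSystem.θ = S.θ := rfl

variable {S R}

theorem minSystem_I_le {a : L} {C : B} (h : C ∈ S.minSystem.I a) : C ∈ S.I a :=
  let ⟨A, hA⟩ := h
  S.mem_I a C A hA

theorem mem_minSystem_I {a : L} {A C : B} (h : C ≤ S.θ a A) : C ∈ S.minSystem.I a := ⟨A, h⟩

theorem exists_forall_ge_P_mul_eq (v : S.minSystem.Alg R) :
    ∃ D₀, ∀ D ≥ D₀, S.minSystem.P R D * v = v := by
  induction v using alg_induction with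
  | P C => exact ⟨C, fun D h => P_mul_P_of_ge h⟩
  | s a C hC =>
    obtain ⟨A, hA⟩ := id hC
    exact ⟨A, fun D h => P_mul_s_of_le hC (hA.trans (S.θ_mono a h))⟩
  | t a C hC => exact ⟨C, fun D h => P_mul_t_of_le hC h⟩
  | mul x y hx _ =>
    obtain ⟨D₀, hx⟩ := hx
    exact ⟨D₀, fun D h => by rw [← mul_assoc, hx D h]⟩
  | add x y hx hy =>
    obtain ⟨D₁, hx⟩ := hx
    obtain ⟨D₂, hy⟩ := hy
    exact ⟨D₁ ⊔ D₂, fun D h => by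
      rw [mul_add, hx D (le_sup_left.trans h), hy D (le_sup_right.trans h)]⟩
  | smul r x hx =>
    obtain ⟨D₀, hx⟩ := hx
    exact ⟨D₀, fun D h => by rw [mul_smul_comm, hx D h]⟩

theorem exists_forall_ge_mul_P_eq (v : S.minSystem.Alg R) :
    ∃ D₀, ∀ D ≥ D₀, v * S.minSystem.P R D = v := by
  obtain ⟨D₀, h⟩ := exists_forall_ge_P_mul_eq (star v)
  exact ⟨D₀, fun D hD => star_injective (by rw [star_mul, star_P, h D hD])⟩

variable (S R)

/-- The representation of `S.minSystem` in the algebra of `S`. -/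
def minRep : S.minSystem.Rep (S.Alg R) where
  __ := S.univRep R
  s a C h := S.s R a C (minSystem_I_le h)
  t a C h := S.t R a C (minSystem_I_le h)
  p_s _ _ _ _ := (S.univRep R).p_s _ _ _ _
  t_p _ _ _ _ := (S.univRep R).t_p _ _ _ _
  t_s_self _ _ _ _ _ := (S.univRep R).t_s_self _ _ _ _ _
  t_s_ne _ _ h _ _ _ _ := (S.univRep R).t_s_ne _ _ h _ _ _ _
  s_p _ _ _ _ := (S.univRep R).s_p _ _ _ _
  p_t _ _ _ _ := (S.univRep R).p_t _ _ _ _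
  cuntzKrieger C hC F hF := (S.univRep R).cuntzKrieger C hC F hF

/-- The homomorphism `L_R(B, L, θ, I_min) → L_R(B, L, θ, I)` that sends generators to
generators. -/
def minHom : S.minSystem.Alg R →ₙₐ[R] S.Alg R := (S.minRep R).lift R

variable {S R}

@[simp] theorem minHom_P (C : B) : S.minHom R (S.minSystem.P R C) = S.P R C :=
  (S.minRep R).lift_P C

@[simp] theorem minHom_s (a : L) (C : B) (h : C ∈ S.minSystem.I a) :
    S.minHom R (S.minSystem.s R a C h) = S.s R a C (minSystem_I_le h) := (S.minRep R).lift_s a C h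

@[simp] theorem minHom_t (a : L) (C : B) (h : C ∈ S.minSystem.I a) :
    S.minHom R (S.minSystem.t R a C h) = S.t R a C (minSystem_I_le h) := (S.minRep R).lift_t a C h

/-! ### Injectivity of the homomorphism from the system with minimal ideals -/

variable (S R)

/-- The families `(p_A w)_A`, `(s_{a,C}^* w)_{a,C}` with values in the algebra of `S.minSystem`,
where `C` runs over all of the ideal `I a`. They form a module over the algebra of `S`, coinduced
from the left regular module of the algebra of `S.minSystem`. -/
def familySubmodule :
    Submodule R ((B → S.minSystem.Alg R) × (∀ a, {C // C ∈ S.I a} → S.minSystem.Alg R)) where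
  carrier := {w | (∀ A A', S.minSystem.P R A * w.1 A' = w.1 (A' ⊓ A)) ∧
    (∀ a C A (hC : C ∈ S.I a),
      S.minSystem.P R A * w.2 a ⟨C, hC⟩ = w.2 a ⟨C ⊓ A, S.inf_mem_I hC A⟩) ∧
    ∀ a A C (h : C ≤ S.θ a A),
      S.minSystem.t R a C (mem_minSystem_I h) * w.1 A = w.2 a ⟨C, S.mem_I a C A h⟩}
  add_mem' := by
    rintro x y ⟨hf, hg, ht⟩ ⟨hf', hg', ht'⟩
    exact ⟨fun A A' => by simp [mul_add, hf, hf'], fun a C A hC => by simp [mul_add, hg, hg'],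
      fun a A C h => by simp [mul_add, ht a A C h, ht' a A C h]⟩
  zero_mem' := by simp
  smul_mem' := by
    rintro r x ⟨hf, hg, ht⟩
    exact ⟨fun A A' => by simp [mul_smul_comm, hf], fun a C A hC => by simp [mul_smul_comm, hg],
      fun a A C h => by simp [mul_smul_comm, ht a A C h]⟩

/-- The space of families, as a type. -/
abbrev FamilySpace : Type (max u v w) := S.familySubmodule R

namespace FamilySpace

variable {S R}

/-- The component `p_A w` of a family `w`. -/
def pPart (A : B) : S.FamilySpace R →ₗ[R] S.minSystem.Alg R :=
  LinearMap.proj A ∘ₗ LinearMap.fst R _ _ ∘ₗ (S.familySubmodule R).subtype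

/-- The component `s_{a,C}^* w` of a family `w`. -/
def tPart {a : L} {C : B} (hC : C ∈ S.I a) : S.FamilySpace R →ₗ[R] S.minSystem.Alg R :=
  LinearMap.proj ⟨C, hC⟩ ∘ₗ LinearMap.proj a ∘ₗ LinearMap.snd R _ _ ∘ₗ
    (S.familySubmodule R).subtype

@[ext] theorem ext {w w' : S.FamilySpace R} (hp : ∀ A, pPart A w = pPart A w')
    (ht : ∀ a C (hC : C ∈ S.I a), tPart hC w = tPart hC w') : w = w' :=
  Subtype.ext (Prod.ext (funext hp) (funext fun a => funext fun C => ht a C.1 C.2))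

section OfComponents

variable {V : Type*} [AddCommGroup V] [Module R V] (f : B → V →ₗ[R] S.minSystem.Alg R)
  (g : ∀ a C, C ∈ S.I a → V →ₗ[R] S.minSystem.Alg R)
  (hf : ∀ v A A', S.minSystem.P R A * f A' v = f (A' ⊓ A) v)
  (hg : ∀ v a C A hC, S.minSystem.P R A * g a C hC v = g a (C ⊓ A) (S.inf_mem_I hC A) v)
  (ht : ∀ v a A C (h : C ≤ S.θ a A),
    S.minSystem.t R a C (mem_minSystem_I h) * f A v = g a C (S.mem_I a C A h) v)

/-- The linear map into the space of families with prescribed components. -/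
def ofComponents : V →ₗ[R] S.FamilySpace R :=
  ((LinearMap.pi f).prod
    (LinearMap.pi fun a => LinearMap.pi fun C : {C // C ∈ S.I a} => g a C.1 C.2)).codRestrict
    (S.familySubmodule R) fun v => ⟨hf v, hg v, ht v⟩

end OfComponents

variable (w : S.FamilySpace R)

theorem P_mul_pPart (A A' : B) : S.minSystem.P R A * pPart A' w = pPart (A' ⊓ A) w := w.2.1 A A'

theorem P_mul_tPart {a : L} {C : B} (hC : C ∈ S.I a) (A : B) :
    S.minSystem.P R A * tPart hC w = tPart (S.inf_mem_I hC A) w := w.2.2.1 a C A hC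

theorem t_mul_pPart {a : L} {A C : B} (h : C ≤ S.θ a A) :
    S.minSystem.t R a C (mem_minSystem_I h) * pPart A w = tPart (S.mem_I a C A h) w :=
  w.2.2.2 a A C h

theorem tPart_congr {a : L} {C D : B} (h : C = D) (hC : C ∈ S.I a) (hD : D ∈ S.I a) :
    tPart hC w = tPart hD w := by subst h; rfl

theorem pPart_of_le {A D : B} (h : A ≤ D) : pPart A w = S.minSystem.P R A * pPart D w := by
  rw [P_mul_pPart, inf_eq_right.2 h]

theorem pPart_bot : pPart ⊥ w = 0 := by
  rw [pPart_of_le w le_rfl, P_bot, zero_mul]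

theorem tPart_eq_zero {a : L} {C : B} (h : C = ⊥) (hC : C ∈ S.I a) : tPart hC w = 0 := by
  subst h
  rw [tPart_congr w (inf_idem ⊥).symm hC (S.inf_mem_I hC ⊥), ← P_mul_tPart w hC, P_bot, zero_mul]

theorem pPart_inf_sup (A C D : B) :
    pPart (A ⊓ (C ⊔ D)) w = pPart (A ⊓ C) w + pPart (A ⊓ D) w - pPart (A ⊓ (C ⊓ D)) w := by
  rw [← P_mul_pPart, ← P_mul_pPart, ← P_mul_pPart, ← P_mul_pPart, P_sup, sub_mul, add_mul]

theorem tPart_inf_sup {a : L} {C : B} (hC : C ∈ S.I a) (D E : B) :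
    tPart (S.inf_mem_I hC (D ⊔ E)) w = tPart (S.inf_mem_I hC D) w +
      tPart (S.inf_mem_I hC E) w - tPart (S.inf_mem_I hC (D ⊓ E)) w := by
  rw [← P_mul_tPart w hC, ← P_mul_tPart w hC, ← P_mul_tPart w hC, ← P_mul_tPart w hC, P_sup,
    sub_mul, add_mul]

/-- The action of `p_D` on families. -/
def actP (D : B) : Module.End R (S.FamilySpace R) :=
  ofComponents (fun A => pPart (A ⊓ D)) (fun a C hC => tPart (S.inf_mem_I hC (S.θ a D)))
    (fun w A A' => by rw [P_mul_pPart, inf_right_comm])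
    (fun w a C A hC => by
      rw [P_mul_tPart]
      exact tPart_congr w (inf_right_comm _ _ _) _ _)
    (fun w a A C h => by
      rw [← P_mul_pPart, ← mul_assoc, t_mul_P]
      exact t_mul_pPart w (inf_le_left.trans h))

open Classical in
/-- The action of `s_{a,C}` on families. -/
def actS (a : L) (C : B) (_ : C ∈ S.I a) : Module.End R (S.FamilySpace R) :=
  ofComponents
    (fun A => LinearMap.mulLeft R
      (S.minSystem.s R a (C ⊓ S.θ a A) (mem_minSystem_I inf_le_right)) ∘ₗ pPart C)
    (fun b D _ => if b = a then pPart (D ⊓ C) else 0)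
    (fun w A A' => by
      rw [LinearMap.comp_apply, LinearMap.mulLeft_apply, ← mul_assoc, P_mul_s]
      exact congrArg (· * _) (s_congr (by rw [minSystem_θ, inf_assoc, (S.θ a).map_inf]) _ _))
    (fun w b D A _ => by
      split_ifs
      · rw [P_mul_pPart, inf_right_comm]
      · exact mul_zero _)
    (fun w b A D h => by
      rw [LinearMap.comp_apply, LinearMap.mulLeft_apply, ← mul_assoc]
      split_ifs with hb
      · subst hb
        rw [t_mul_s_self, P_mul_pPart, inf_left_comm, ← inf_assoc C C, inf_idem, inf_left_comm,
          inf_eq_left.2 h, inf_comm]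
      · rw [t_mul_s_of_ne hb, zero_mul]
        rfl)

/-- The action of `s_{a,C}^*` on families. -/
def actT (a : L) (C : B) (hC : C ∈ S.I a) : Module.End R (S.FamilySpace R) :=
  ofComponents (fun A => tPart (S.inf_mem_I hC A))
    (fun b D _ => LinearMap.mulLeft R
      (S.minSystem.t R b (D ⊓ S.θ b C) (mem_minSystem_I inf_le_right)) ∘ₗ tPart hC)
    (fun w A A' => by
      rw [P_mul_tPart]
      exact tPart_congr w (inf_assoc _ _ _) _ _)
    (fun w b D A _ => by
      rw [LinearMap.comp_apply, LinearMap.mulLeft_apply, ← mul_assoc, P_mul_t]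
      exact congrArg (· * _) (t_congr (inf_right_comm _ _ _) _ _))
    (fun w b A D h => by
      have hD : D ⊓ S.θ b (C ⊓ A) = D ⊓ S.θ b C := by
        rw [(S.θ b).map_inf, inf_left_comm, inf_eq_left.2 h, inf_comm]
      rw [tPart_congr w (by rw [← inf_assoc, inf_idem]) _ (S.inf_mem_I hC (C ⊓ A)),
        ← P_mul_tPart w hC, ← mul_assoc, t_mul_P]
      exact congrArg (· * _) (t_congr hD _ _))

@[simp] theorem pPart_actP (D A : B) : pPart A (actP D w) = pPart (A ⊓ D) w := rfl

@[simp] theorem tPart_actP (D : B) {a : L} {C : B} (hC : C ∈ S.I a) :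
    tPart hC (actP D w) = tPart (S.inf_mem_I hC (S.θ a D)) w := rfl

@[simp] theorem pPart_actS {a : L} {C : B} (hC : C ∈ S.I a) (A : B) : pPart A (actS a C hC w) =
    S.minSystem.s R a (C ⊓ S.θ a A) (mem_minSystem_I inf_le_right) * pPart C w := rfl

@[simp] theorem tPart_actS_self {a : L} {C D : B} (hC : C ∈ S.I a) (hD : D ∈ S.I a) :
    tPart hD (actS a C hC w) = pPart (D ⊓ C) w :=
  congrArg (fun g : S.FamilySpace R →ₗ[R] S.minSystem.Alg R => g w) (if_pos rfl)

theorem tPart_actS_of_ne {a b : L} (h : b ≠ a) {C D : B} (hC : C ∈ S.I a) (hD : D ∈ S.I b) :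
    tPart hD (actS a C hC w) = 0 :=
  congrArg (fun g : S.FamilySpace R →ₗ[R] S.minSystem.Alg R => g w) (if_neg h)

@[simp] theorem pPart_actT {a : L} {C : B} (hC : C ∈ S.I a) (A : B) :
    pPart A (actT a C hC w) = tPart (S.inf_mem_I hC A) w := rfl

@[simp] theorem tPart_actT {a b : L} {C D : B} (hC : C ∈ S.I a) (hD : D ∈ S.I b) :
    tPart hD (actT a C hC w) =
      S.minSystem.t R b (D ⊓ S.θ b C) (mem_minSystem_I inf_le_right) * tPart hC w := rfl

theorem end_ext {f g : Module.End R (S.FamilySpace R)}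
    (hp : ∀ A w, pPart A (f w) = pPart A (g w))
    (ht : ∀ a C (hC : C ∈ S.I a) w, tPart hC (f w) = tPart hC (g w)) : f = g :=
  LinearMap.ext fun w => FamilySpace.ext (fun A => hp A w) fun a C hC => ht a C hC w

theorem actP_bot : actP (R := R) (⊥ : B) = (0 : Module.End R (S.FamilySpace R)) :=
  end_ext (fun A w => by simp [pPart_bot]) fun b E hE w => by
    simpa using tPart_eq_zero w (by rw [(S.θ b).map_bot, inf_bot_eq]) _

theorem actP_inf (C D : B) :
    actP (C ⊓ D) = (actP C * actP D : Module.End R (S.FamilySpace R)) :=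
  end_ext (fun A w => by simp [inf_assoc]) fun b E hE w => by
    simpa using tPart_congr w (by rw [(S.θ b).map_inf, inf_assoc]) _ _

theorem actP_sup (C D : B) :
    actP (C ⊔ D) = (actP C + actP D - actP (C ⊓ D) : Module.End R (S.FamilySpace R)) :=
  end_ext (fun A w => by simp [pPart_inf_sup]) fun b E hE w => by
    simp only [tPart_actP, LinearMap.add_apply, LinearMap.sub_apply, map_add, map_sub,
      (S.θ b).map_sup, (S.θ b).map_inf, tPart_inf_sup w hE]

section Letter

variable {a : L} {C : B} (hC : C ∈ S.I a)

theorem actP_mul_actS (D : B) :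
    (actP D * actS a C hC : Module.End R (S.FamilySpace R)) = actS a C hC * actP (S.θ a D) := by
  refine end_ext (fun A w => ?_) fun b E hE w => ?_
  · simp only [Module.End.mul_apply, pPart_actP, pPart_actS]
    rw [← P_mul_pPart, ← mul_assoc, s_mul_P]
    exact congrArg (· * _) (s_congr (by rw [(S.θ a).map_inf, inf_assoc]) _ _)
  · obtain rfl | h := eq_or_ne b a
    · simp [inf_right_comm, inf_assoc]
    · simp [tPart_actS_of_ne _ h]

theorem actT_mul_actP (D : B) :
    (actT a C hC * actP D : Module.End R (S.FamilySpace R)) = actP (S.θ a D) * actT a C hC := by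
  refine end_ext (fun A w => ?_) fun b E hE w => ?_
  · simp only [Module.End.mul_apply, pPart_actT, pPart_actP, tPart_actP]
    exact tPart_congr w (inf_assoc _ _ _) _ _
  · simp only [Module.End.mul_apply, tPart_actP, tPart_actT]
    rw [← P_mul_tPart w hC, ← mul_assoc, t_mul_P]
    exact congrArg (· * _) (t_congr (inf_right_comm _ _ _) _ _)

theorem actT_mul_actS_self {D : B} (hD : D ∈ S.I a) :
    (actT a C hC * actS a D hD : Module.End R (S.FamilySpace R)) = actP (C ⊓ D) := by
  refine end_ext (fun A w => ?_) fun b E hE w => ?_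
  · simp only [Module.End.mul_apply, pPart_actT, tPart_actS_self, pPart_actP]
    rw [inf_right_comm, inf_comm]
  · have hE' : E ⊓ S.θ b C ⊓ S.θ b (C ⊓ D) = E ⊓ S.θ b (C ⊓ D) := by
      rw [(S.θ b).map_inf, inf_assoc, ← inf_assoc (S.θ b C), inf_idem]
    simp only [Module.End.mul_apply, tPart_actP, tPart_actT, tPart_actS_self]
    rw [pPart_of_le w le_rfl, ← mul_assoc, t_mul_P, ← t_mul_pPart w inf_le_right]
    exact congrArg (· * _) (t_congr hE' _ _)

theorem actT_mul_actS_of_ne {b : L} (h : a ≠ b) {D : B} (hD : D ∈ S.I b) :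
    (actT a C hC * actS b D hD : Module.End R (S.FamilySpace R)) = 0 :=
  end_ext (fun A w => tPart_actS_of_ne w h hD (S.inf_mem_I hC A)) fun c E hE w => by
    rw [Module.End.mul_apply, tPart_actT, tPart_actS_of_ne w h hD hC, mul_zero,
      LinearMap.zero_apply, map_zero]

theorem actS_mul_actP (D : B) : actS (R := R) a C hC * actP D =
    actS a (C ⊓ D) (S.inf_mem_I hC D) := by
  refine end_ext (fun A w => ?_) fun b E hE w => ?_
  · simp only [Module.End.mul_apply, pPart_actP, pPart_actS]
    rw [pPart_of_le w le_rfl, ← mul_assoc, ← mul_assoc, s_mul_P, s_mul_P]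
    exact congrArg (· * _) (s_congr (by ac_rfl) _ _)
  · obtain rfl | h := eq_or_ne b a
    · simp [inf_assoc]
    · simp [tPart_actS_of_ne _ h]

theorem actP_mul_actT (D : B) : actP D * actT (R := R) a C hC =
    actT a (C ⊓ D) (S.inf_mem_I hC D) := by
  refine end_ext (fun A w => ?_) fun b E hE w => ?_
  · simp only [Module.End.mul_apply, pPart_actP, pPart_actT]
    exact tPart_congr w (by rw [inf_assoc, inf_comm D]) _ _
  · simp only [Module.End.mul_apply, tPart_actP, tPart_actT]
    rw [← P_mul_tPart w hC, ← mul_assoc, t_mul_P]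
    refine congrArg (· * _) (t_congr ?_ _ _)
    rw [minSystem_θ, (S.θ b).map_inf]
    ac_rfl

end Letter

theorem pPart_cuntzKrieger {C : B} (hC : C ∈ S.regular) {F : Finset L}
    (hF : ∀ a, a ∈ F ↔ a ∈ S.Δ C) (A : B) (w : S.FamilySpace R) :
    pPart (A ⊓ C) w = ∑ a ∈ F, pPart A
      (actS a (S.θ a C) (S.θ_mem_I a C) (actT a (S.θ a C) (S.θ_mem_I a C) w)) := by
  have hCK : S.minSystem.P R C = _ := (S.minSystem.univRep R).cuntzKrieger C hC F hF
  rw [pPart_of_le w inf_le_right, ← P_mul_P, hCK, Finset.mul_sum, Finset.sum_mul]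
  refine Finset.sum_congr rfl fun a _ => ?_
  change S.minSystem.P R A * (S.minSystem.s R a (S.θ a C) (mem_minSystem_I le_rfl) *
    S.minSystem.t R a (S.θ a C) (mem_minSystem_I le_rfl)) *
    pPart C w = _
  rw [mul_assoc, mul_assoc, t_mul_pPart w le_rfl, ← mul_assoc, P_mul_s, pPart_actS, pPart_actT]
  exact congrArg (_ * ·) (tPart_congr w (inf_idem _).symm _ _)

theorem tPart_cuntzKrieger {C : B} {F : Finset L} (hF : ∀ a, a ∈ F ↔ a ∈ S.Δ C) {b : L} {E : B}
    (hE : E ∈ S.I b) (w : S.FamilySpace R) :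
    tPart (S.inf_mem_I hE (S.θ b C)) w = ∑ a ∈ F, tPart hE
      (actS a (S.θ a C) (S.θ_mem_I a C) (actT a (S.θ a C) (S.θ_mem_I a C) w)) := by
  by_cases hb : b ∈ F
  · rw [Finset.sum_eq_single b (fun a _ ha => tPart_actS_of_ne _ ha.symm _ _)
      fun h => absurd hb h, tPart_actS_self, pPart_actT]
    exact tPart_congr w (by rw [inf_left_comm, inf_idem]) _ _
  · rw [Finset.sum_eq_zero fun a ha => tPart_actS_of_ne _ (fun h => hb (by rwa [h])) _ _]
    rw [hF, Δ, Set.mem_ofPred_eq, not_not] at hb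
    exact tPart_eq_zero w (by rw [hb, inf_bot_eq]) _

end FamilySpace

open FamilySpace

/-- The representation of `S` on the space of families. -/
def familyRep : S.Rep (Module.End R (S.FamilySpace R)) where
  p := actP
  s := actS
  t := actT
  p_bot := actP_bot
  p_inf := actP_inf
  p_sup := actP_sup
  p_s D _ _ hC := actP_mul_actS hC D
  t_p D _ _ hC := actT_mul_actP hC D
  t_s_self _ _ _ hC hD := actT_mul_actS_self hC hD
  t_s_ne _ _ h _ _ hC hD := actT_mul_actS_of_ne hC h hD
  s_p _ _ D hC := actS_mul_actP hC D
  p_t _ _ D hC := actP_mul_actT hC D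
  cuntzKrieger C hC F hF := end_ext
    (fun A w => by
      rw [LinearMap.sum_apply, map_sum]
      exact pPart_cuntzKrieger hC hF A w)
    fun b E hE w => by
      rw [LinearMap.sum_apply, map_sum]
      exact tPart_cuntzKrieger hF hE w

/-- The family `(p_A p_D)_A`, `(s_{a,C}^* p_D)_{a,C}` of the idempotent `p_D`. -/
def familyOfP (D : B) : S.FamilySpace R :=
  ⟨(fun A => S.minSystem.P R (A ⊓ D),
    fun a C => S.minSystem.t R a (C.1 ⊓ S.θ a D) (mem_minSystem_I inf_le_right)), by
    refine ⟨fun A A' => ?_, fun a C A hC => ?_, fun a A C h => ?_⟩ <;> dsimp only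
    · rw [P_mul_P, inf_left_comm, inf_assoc]
    · rw [P_mul_t]
      exact t_congr (inf_right_comm _ _ _) _ _
    · rw [t_mul_P]
      refine t_congr ?_ _ _
      rw [minSystem_θ, (S.θ a).map_inf, ← inf_assoc, inf_eq_left.2 h]⟩

variable {S R}

theorem exists_forall_ge_pPart_lift_minHom (v : S.minSystem.Alg R) :
    ∃ D₀, ∀ D ≥ D₀, ∀ A w,
      pPart A ((S.familyRep R).lift R (S.minHom R v) w) = S.minSystem.P R A * v * pPart D w := by
  induction v using alg_induction with
  | P C =>
    refine ⟨C, fun D h A w => ?_⟩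
    rw [minHom_P, Rep.lift_P, P_mul_P, P_mul_pPart, inf_eq_right.2 (inf_le_right.trans h)]
    rfl
  | s a C hC =>
    refine ⟨C, fun D h A w => ?_⟩
    rw [minHom_s, Rep.lift_s]
    change pPart A (actS a C (minSystem_I_le hC) w) = _
    rw [pPart_actS, P_mul_s, pPart_of_le w h, ← mul_assoc, s_mul_P_of_le _ inf_le_left]
    rfl
  | t a C hC =>
    obtain ⟨A₀, hA₀⟩ := id hC
    refine ⟨A₀, fun D h A w => ?_⟩
    rw [minHom_t, Rep.lift_t, P_mul_t]
    exact (t_mul_pPart w (inf_le_left.trans (hA₀.trans (S.θ_mono a h)))).symm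
  | mul x y hx hy =>
    obtain ⟨D₁, hx⟩ := hx
    obtain ⟨D₂, hy⟩ := hy
    obtain ⟨D₃, hD₃⟩ := exists_forall_ge_P_mul_eq y
    refine ⟨D₂, fun D h A w => ?_⟩
    rw [map_mul, map_mul, Module.End.mul_apply, hx (D₁ ⊔ D₃) le_sup_left, hy D h,
      hD₃ _ le_sup_right, mul_assoc, mul_assoc, mul_assoc]
  | add x y hx hy =>
    obtain ⟨D₁, hx⟩ := hx
    obtain ⟨D₂, hy⟩ := hy
    refine ⟨D₁ ⊔ D₂, fun D h A w => ?_⟩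
    rw [map_add, map_add, LinearMap.add_apply, map_add, hx D (le_sup_left.trans h),
      hy D (le_sup_right.trans h), mul_add, add_mul]
  | smul r x hx =>
    obtain ⟨D₀, hx⟩ := hx
    refine ⟨D₀, fun D h A w => ?_⟩
    rw [map_smul, map_smul, LinearMap.smul_apply, map_smul, hx D h, mul_smul_comm, smul_mul_assoc]

theorem minHom_injective : Function.Injective (S.minHom R) := by
  rw [injective_iff_map_eq_zero]
  intro v hv
  obtain ⟨D₁, h_left⟩ := exists_forall_ge_P_mul_eq v
  obtain ⟨D₂, h_right⟩ := exists_forall_ge_mul_P_eq v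
  obtain ⟨D₃, h_act⟩ := exists_forall_ge_pPart_lift_minHom v
  let D := D₁ ⊔ D₂ ⊔ D₃
  have hD : pPart D (S.familyOfP R D) = S.minSystem.P R D :=
    congrArg (S.minSystem.P R) (inf_idem D)
  have h := h_act D le_sup_right D (S.familyOfP R D)
  rw [hv, map_zero, LinearMap.zero_apply, map_zero, hD,
    h_left D (le_sup_left.trans le_sup_left), h_right D (le_sup_right.trans le_sup_left)] at h
  exact h.symm

end GBDS

/-! ### Matrices as endomorphisms of a module of columns -/

section Columns

variable (R : Type u) [CommRing R] (ι : Type v) (A : Type x) [NonUnitalRing A] [Module R A]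

/-- The endomorphisms of the module of columns with entries in `A`, indexed by `ι`. This ring
contains the matrices over `A` with finitely many nonzero entries in each row, acting by left
multiplication. -/
abbrev ColEnd : Type (max v x) := Module.End R (ι → A)

namespace ColEnd

variable {R ι A} [SMulCommClass R A A]

variable (R) in
/-- The diagonal matrix with entries `d i`. -/
def diag (d : ι → A) : ColEnd R ι A := LinearMap.pi fun i => LinearMap.mulLeft R (d i) ∘ₗ .proj i

@[simp] theorem diag_apply (d y : ι → A) (i : ι) : diag R d y i = d i * y i := rfl

theorem diag_mul_diag (c d : ι → A) : diag R c * diag R d = diag R (c * d) :=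
  LinearMap.ext fun y => funext fun i => (mul_assoc (c i) (d i) (y i)).symm

variable [DecidableEq ι]

variable (R) in
/-- The matrix with the single entry `c` at place `(i, j)`. -/
def unit [IsScalarTower R A A] (i j : ι) : A →ₗ[R] ColEnd R ι A where
  toFun c := .single R _ i ∘ₗ LinearMap.mulLeft R c ∘ₗ .proj j
  map_add' c d := LinearMap.ext fun y => by simp [add_mul, Pi.single_add]
  map_smul' r c := LinearMap.ext fun y => by simp [smul_mul_assoc, Pi.single_smul]

variable [IsScalarTower R A A]

@[simp] theorem unit_apply (i j : ι) (c : A) (y : ι → A) :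
    unit R i j c y = Pi.single i (c * y j) := rfl

theorem unit_mul_unit (i j k : ι) (c d : A) :
    unit R i j c * unit R j k d = unit R i k (c * d) := by
  ext1 y
  rw [Module.End.mul_apply, unit_apply, unit_apply, unit_apply, Pi.single_eq_same, mul_assoc]

theorem unit_mul_unit_of_ne {i j k l : ι} (h : j ≠ k) (c d : A) :
    unit R i j c * unit R k l d = 0 := by
  ext1 y
  rw [Module.End.mul_apply, unit_apply, unit_apply, Pi.single_eq_of_ne h, mul_zero,
    Pi.single_zero, LinearMap.zero_apply]

theorem diag_mul_unit (d : ι → A) (i j : ι) (c : A) :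
    diag R d * unit R i j c = unit R i j (d i * c) := by
  ext1 y
  funext k
  rw [Module.End.mul_apply, diag_apply, unit_apply, unit_apply, mul_assoc,
    Pi.apply_single (fun k => (d k * ·)) fun _ => mul_zero _]

theorem unit_mul_diag (d : ι → A) (i j : ι) (c : A) :
    unit R i j c * diag R d = unit R i j (c * d j) := by
  ext1 y
  rw [Module.End.mul_apply, unit_apply, unit_apply, diag_apply, mul_assoc]

theorem unit_injective [FaithfulSMul A A] (i j : ι) :
    Function.Injective (unit R (A := A) i j) := fun c d h =>
  eq_of_smul_eq_smul fun x : A => by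
    simpa using congrFun (LinearMap.congr_fun h fun _ => x) i

end ColEnd

end Columns

namespace GBDS

variable {B : Type v} {L : Type w} [GeneralizedBooleanAlgebra B] {S : GBDS B L}
  {R : Type u} [CommRing R]

instance : FaithfulSMul (S.Alg R) (S.Alg R) where
  eq_of_smul_eq_smul {x y} h := by
    obtain ⟨u, hu⟩ := exists_self_mul_eq (x - y)
    rwa [sub_mul, show x * u = y * u from h u, sub_self, eq_comm, sub_eq_zero] at hu

end GBDS

theorem IdealQuotient.exists_eq_mk {B : Type v} [GeneralizedBooleanAlgebra B] {I : Order.Ideal B}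
    (x : IdealQuotient I) : ∃ A, x = mk I A :=
  let ⟨A, hA⟩ := Quotient.exists_rep x
  ⟨A, hA.symm⟩

theorem IdealQuotient.mk_eq_bot {B : Type v} [GeneralizedBooleanAlgebra B] {I : Order.Ideal B}
    {A : B} : mk I A = ⊥ ↔ A ∈ I := by
  refine (mk_eq (A' := ⊥)).trans ⟨?_, fun h => ⟨A, h, by rw [sup_idem, bot_sup_eq]⟩⟩
  rintro ⟨U, hU, h⟩
  rw [bot_sup_eq, sup_eq_right] at h
  exact I.lower h hU

namespace FinSum

variable {B : ℕ → Type v} [∀ i, GeneralizedBooleanAlgebra (B i)]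

theorem single_val_self (i : ℕ) (x : B i) : (single i x).1 i = x := Function.update_self _ _ _

theorem single_val_of_ne {i j : ℕ} (h : j ≠ i) (x : B i) : (single i x).1 j = ⊥ :=
  Function.update_of_ne h _ _

theorem single_eq_bot {i : ℕ} {x : B i} : single i x = ⊥ ↔ x = ⊥ := by
  refine ⟨fun h => ?_, fun h => ext_iff'.2 fun j => ?_⟩
  · rw [← single_val_self i x, h]
    rfl
  · obtain rfl | hj := eq_or_ne j i
    · rw [single_val_self, h]
      rfl
    · rw [single_val_of_ne hj]
      rfl

end FinSum

namespace GBDS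

variable {B : Type v} {L : Type w} [GeneralizedBooleanAlgebra B] {S : GBDS B L}
variable {R : Type u} [CommRing R]

/-! ### Gap projections -/

variable (S R) in
/-- The range projection `s_{a,θ_a A} s_{a,θ_a A}^*`. -/
def rangeProj (a : L) (A : B) : S.Alg R :=
  S.s R a (S.θ a A) (S.θ_mem_I a A) * S.t R a (S.θ a A) (S.θ_mem_I a A)

theorem isSelfAdjoint_rangeProj (a : L) (A : B) : IsSelfAdjoint (S.rangeProj R a A) :=
  isSelfAdjoint_of_mem_diagonal (.inr ⟨a, _, _, rfl⟩)

theorem P_mul_rangeProj (a : L) (A D : B) :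
    S.P R D * S.rangeProj R a A = S.rangeProj R a (A ⊓ D) := by
  have hs : S.s R a (S.θ a A) (S.θ_mem_I a A) * S.P R (S.θ a D) =
      S.s R a (S.θ a (A ⊓ D)) (S.θ_mem_I a _) :=
    (s_mul_P _ _).trans (s_congr ((S.θ a).map_inf A D).symm _ _)
  have ht : S.P R (S.θ a D) * S.t R a (S.θ a A) (S.θ_mem_I a A) =
      S.t R a (S.θ a (A ⊓ D)) (S.θ_mem_I a _) :=
    (P_mul_t _ _).trans (t_congr ((S.θ a).map_inf A D).symm _ _)
  rw [rangeProj, P_mul_s_mul_t, star_s, ← inf_idem (S.θ a D), ← P_mul_P, ← mul_assoc, hs,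
    mul_assoc, ht, rangeProj]

theorem rangeProj_mul_s {a : L} {C : B} (A : B) (hC : C ∈ S.I a) :
    S.rangeProj R a A * S.s R a C hC = S.s R a (C ⊓ S.θ a A) (S.inf_mem_I hC _) := by
  rw [rangeProj, mul_assoc, t_mul_s_self, s_mul_P]
  exact s_congr (by ac_rfl) _ _

theorem rangeProj_mul_s_of_ne {a b : L} (h : a ≠ b) {C : B} (A : B) (hC : C ∈ S.I b) :
    S.rangeProj R a A * S.s R b C hC = 0 := by
  rw [rangeProj, mul_assoc, t_mul_s_of_ne h, mul_zero]

theorem rangeProj_eq_zero {a : L} {A : B} (h : S.θ a A = ⊥) : S.rangeProj R a A = 0 := by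
  rw [rangeProj, s_eq_zero h, zero_mul]

theorem P_eq_sum_rangeProj {A : B} (hA : A ∈ S.regular) {F : Finset L} (hF : S.Δ A ⊆ F) :
    S.P R A = ∑ a ∈ F, S.rangeProj R a A := by
  classical
  calc S.P R A
    _ = ∑ a ∈ F.filter (· ∈ S.Δ A), S.rangeProj R a A :=
      (S.univRep R).cuntzKrieger A hA _ fun a =>
        Finset.mem_filter.trans (and_iff_right_of_imp fun h => hF h)
    _ = ∑ a ∈ F, S.rangeProj R a A := Finset.sum_filter_of_ne fun a _ ha h =>
      ha (rangeProj_eq_zero h)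

variable (S R) in
/-- The part `p_A - ∑_{a ∈ F} s_{a,θ_a A} s_{a,θ_a A}^*` of `p_A` that the letters in `F` do not
reach. -/
def gap (F : Finset L) (A : B) : S.Alg R := S.P R A - ∑ a ∈ F, S.rangeProj R a A

variable {F F' : Finset L}

theorem isSelfAdjoint_gap (F : Finset L) (A : B) : IsSelfAdjoint (S.gap R F A) :=
  .sub (star_P A) (isSelfAdjoint_sum F fun a _ => isSelfAdjoint_rangeProj a A)

theorem gap_empty (A : B) : S.gap R ∅ A = S.P R A := sub_zero _

theorem P_mul_gap (A D : B) : S.P R D * S.gap R F A = S.gap R F (A ⊓ D) := by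
  simp only [gap, mul_sub, P_mul_P, Finset.mul_sum, P_mul_rangeProj, inf_comm D A]

theorem gap_mul_P (A D : B) : S.gap R F A * S.P R D = S.gap R F (A ⊓ D) :=
  star_injective (by
    rw [star_mul, star_P, isSelfAdjoint_gap F A, isSelfAdjoint_gap F (A ⊓ D), P_mul_gap])

theorem gap_mul_s_of_mem {a : L} {C : B} (ha : a ∈ F) (A : B) (hC : C ∈ S.I a) :
    S.gap R F A * S.s R a C hC = 0 := by
  rw [gap, sub_mul, P_mul_s, Finset.sum_mul,
    Finset.sum_eq_single a (fun b _ hb => rangeProj_mul_s_of_ne hb _ _) (absurd ha),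
    rangeProj_mul_s, sub_self]

theorem gap_mul_s_of_notMem {a : L} {C : B} (ha : a ∉ F) (A : B) (hC : C ∈ S.I a) :
    S.gap R F A * S.s R a C hC = S.s R a (C ⊓ S.θ a A) (S.inf_mem_I hC _) := by
  rw [gap, sub_mul, P_mul_s, Finset.sum_mul, Finset.sum_eq_zero, sub_zero]
  exact fun b hb => rangeProj_mul_s_of_ne (ne_of_mem_of_not_mem hb ha) _ _

theorem gap_mul_gap_of_subset (h : F ⊆ F') (A D : B) :
    S.gap R F' A * S.gap R F D = S.gap R F' (A ⊓ D) := by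
  rw [gap.eq_1 S R F D, mul_sub, gap_mul_P, Finset.mul_sum, Finset.sum_eq_zero, sub_zero]
  intro a ha
  rw [rangeProj, ← mul_assoc, gap_mul_s_of_mem (h ha), zero_mul]

theorem gap_bot (F : Finset L) : S.gap R F ⊥ = 0 := by
  rw [← inf_bot_eq ⊥, ← gap_mul_P, P_bot, mul_zero]

theorem gap_sup (F : Finset L) (A D : B) :
    S.gap R F (A ⊔ D) = S.gap R F A + S.gap R F D - S.gap R F (A ⊓ D) := by
  have h (C : B) (hC : C ≤ A ⊔ D) : S.gap R F C = S.P R C * S.gap R F (A ⊔ D) := by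
    rw [P_mul_gap, inf_eq_right.2 hC]
  rw [h _ le_rfl, h A le_sup_left, h D le_sup_right, h _ (inf_le_left.trans le_sup_left), P_sup,
    sub_mul, add_mul]

theorem gap_eq_gap_insert_add [DecidableEq L] {a : L} (ha : a ∉ F) (A : B) :
    S.gap R F A = S.gap R (insert a F) A + S.rangeProj R a A := by
  rw [gap, gap, Finset.sum_insert ha]
  abel

theorem gap_eq_zero {A : B} (hA : A ∈ S.regular) (hF : S.Δ A ⊆ F) : S.gap R F A = 0 :=
  sub_eq_zero.2 (P_eq_sum_rangeProj hA hF)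

/-! ### The levels of the desingularization -/

variable {e : L ↪ ℕ}

theorem finite_letters_lt (e : L ↪ ℕ) (i : ℕ) : {a : L | e a + 1 < i}.Finite :=
  ((Set.finite_lt_nat i).preimage e.injective.injOn).subset fun _ h =>
    (Nat.lt_succ_self _).trans h

/-- The letters `a_j` with `j < i`, for the enumeration in which `a` is `a_{e a + 1}`. -/
def lettersBelow (e : L ↪ ℕ) (i : ℕ) : Finset L := (finite_letters_lt e i).toFinset

theorem mem_lettersBelow {i : ℕ} {a : L} : a ∈ lettersBelow e i ↔ e a + 1 < i :=
  Set.Finite.mem_toFinset _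

theorem lettersBelow_zero : lettersBelow e 0 = ∅ :=
  Finset.eq_empty_of_forall_notMem fun _ h => Nat.not_lt_zero _ (mem_lettersBelow.1 h)

theorem lettersBelow_mono {i j : ℕ} (h : i ≤ j) : lettersBelow e i ⊆ lettersBelow e j :=
  fun _ ha => mem_lettersBelow.2 ((mem_lettersBelow.1 ha).trans_le h)

theorem self_notMem_lettersBelow (a : L) : a ∉ lettersBelow e (e a + 1) :=
  fun h => (mem_lettersBelow.1 h).false

theorem lettersBelow_letter_succ [DecidableEq L] (a : L) :
    lettersBelow e (e a + 1 + 1) = insert a (lettersBelow e (e a + 1)) := by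
  ext b
  rw [Finset.mem_insert, mem_lettersBelow, mem_lettersBelow, Nat.lt_succ_iff_lt_or_eq, or_comm,
    Nat.succ_inj, e.injective.eq_iff]

theorem lettersBelow_succ_of_forall_ne {i : ℕ} (h : ∀ a, e a + 1 ≠ i) :
    lettersBelow e (i + 1) = lettersBelow e i := by
  ext b
  rw [mem_lettersBelow, mem_lettersBelow, Nat.lt_succ_iff_lt_or_eq, or_iff_left (h b)]

theorem Δ_mono {A A' : B} (h : A ≤ A') : S.Δ A ⊆ S.Δ A' := fun a ha h' =>
  ha (le_bot_iff.1 ((S.θ_mono a h).trans h'.le))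

theorem regular_of_mem_X {i : ℕ} {U : B} (h : U ∈ S.X e i) : U ∈ S.regular := by
  refine fun A hA hA' => ⟨?_, (finite_letters_lt e i).subset fun a ha => h.2 a (Δ_mono hA ha)⟩
  rw [Set.nonempty_iff_ne_empty]
  exact fun h' => hA' ((inf_eq_right.2 hA).symm.trans (h.1 A h'))

theorem mem_X_of_mem_X_succ {i : ℕ} {U : B} (h : U ∈ S.X e (i + 1))
    (h' : ∀ a ∈ S.Δ U, e a + 1 ≠ i) : U ∈ S.X e i :=
  ⟨h.1, fun a ha => lt_of_le_of_ne (Nat.lt_succ_iff.1 (h.2 a ha)) (h' a ha)⟩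

theorem gap_lettersBelow_eq_zero {i : ℕ} {U : B} (h : U ∈ S.X e i) :
    S.gap R (lettersBelow e i) U = 0 :=
  gap_eq_zero (regular_of_mem_X h) fun a ha => mem_lettersBelow.2 (h.2 a ha)

variable (S R e) in
/-- The gap projection of the letters `a_j` with `j < i`, as a function on `B / X_i`. -/
def levelGap (i : ℕ) : S.Level e i → S.Alg R := Quotient.lift (S.gap R (lettersBelow e i)) (by
  rintro A A' ⟨U, hU, h⟩
  have gap_sup_eq (C : B) :
      S.gap R (lettersBelow e i) (C ⊔ U) = S.gap R (lettersBelow e i) C := by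
    rw [gap_sup, gap_lettersBelow_eq_zero hU, ← gap_mul_gap_of_subset subset_rfl,
      gap_lettersBelow_eq_zero hU, mul_zero, sub_zero, add_zero]
  rw [← gap_sup_eq A, h, gap_sup_eq])

theorem levelGap_mk (i : ℕ) (A : B) : S.levelGap R e i (IdealQuotient.mk (S.X e i) A) =
    S.gap R (lettersBelow e i) A := rfl

theorem levelGap_bot (i : ℕ) : S.levelGap R e i ⊥ = 0 := gap_bot _

theorem isSelfAdjoint_levelGap (i : ℕ) (x : S.Level e i) : IsSelfAdjoint (S.levelGap R e i x) := by
  obtain ⟨A, rfl⟩ := x.exists_eq_mk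
  exact isSelfAdjoint_gap _ A

theorem levelGap_inf (i : ℕ) (x y : S.Level e i) :
    S.levelGap R e i (x ⊓ y) = S.levelGap R e i x * S.levelGap R e i y := by
  obtain ⟨A, rfl⟩ := x.exists_eq_mk
  obtain ⟨D, rfl⟩ := y.exists_eq_mk
  exact (gap_mul_gap_of_subset subset_rfl A D).symm

theorem levelGap_sup (i : ℕ) (x y : S.Level e i) : S.levelGap R e i (x ⊔ y) =
    S.levelGap R e i x + S.levelGap R e i y - S.levelGap R e i (x ⊓ y) := by
  obtain ⟨A, rfl⟩ := x.exists_eq_mk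
  obtain ⟨D, rfl⟩ := y.exists_eq_mk
  exact gap_sup _ A D

variable (S e) in
/-- The identification of `B / X_0` with `B`. -/
def levelZero : S.Level e 0 → B := Quotient.lift id (by
  rintro A A' ⟨U, hU, h⟩
  rwa [S.mem_X_zero.1 hU, sup_bot_eq, sup_bot_eq] at h)

theorem levelZero_mk (A : B) : S.levelZero e (IdealQuotient.mk (S.X e 0) A) = A := rfl

theorem levelZero_inf (x y : S.Level e 0) :
    S.levelZero e (x ⊓ y) = S.levelZero e x ⊓ S.levelZero e y := by
  obtain ⟨A, rfl⟩ := x.exists_eq_mk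
  obtain ⟨D, rfl⟩ := y.exists_eq_mk
  rfl

theorem levelGap_zero (x : S.Level e 0) : S.levelGap R e 0 x = S.P R (S.levelZero e x) := by
  obtain ⟨A, rfl⟩ := x.exists_eq_mk
  rw [levelGap_mk, lettersBelow_zero, gap_empty, levelZero_mk]

theorem cls_val_self (i : ℕ) (A : B) : (S.cls e i A).1 i = IdealQuotient.mk (S.X e i) A :=
  FinSum.single_val_self _ _

theorem cls_eq_bot {i : ℕ} {A : B} : S.cls e i A = ⊥ ↔ A ∈ S.X e i :=
  FinSum.single_eq_bot.trans IdealQuotient.mk_eq_bot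

theorem desing_θ_inl_eq_cls {a : L} {x : S.BF e} {A : B}
    (h : x.1 (e a + 1) = IdealQuotient.mk _ A) :
    (S.desing e).θ (.inl a) x = S.cls e 0 (S.θ a A) := by
  change FinSum.single (B := S.Level e) 0 (IdealQuotient.map _ _ _ _ (x.1 (e a + 1))) = _
  rw [h]
  rfl

theorem desing_θ_inr_eq_cls {n : ℕ} {x : S.BF e} {A : B} (h : x.1 n = IdealQuotient.mk _ A) :
    (S.desing e).θ (.inr n) x = S.cls e (n + 1) A := by
  change FinSum.single (B := S.Level e) (n + 1) (IdealQuotient.map _ _ _ _ (x.1 n)) = _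
  rw [h]
  rfl

/-! ### Regularity of the desingularization -/

/-- The level on which the action of a letter of `L^F` is not `∅`. -/
def source (e : L ↪ ℕ) : L ⊕ ℕ → ℕ
  | .inl a => e a + 1
  | .inr n => n

theorem inl_mem_Δ_iff {a : L} {x : S.BF e} {A : B} (h : x.1 (e a + 1) = IdealQuotient.mk _ A) :
    .inl a ∈ (S.desing e).Δ x ↔ a ∈ S.Δ A := by
  rw [Δ, Set.mem_ofPred_eq, desing_θ_inl_eq_cls h, Ne, cls_eq_bot, mem_X_zero]
  rfl

theorem inr_mem_Δ_iff {n : ℕ} {x : S.BF e} {A : B} (h : x.1 n = IdealQuotient.mk _ A) :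
    .inr n ∈ (S.desing e).Δ x ↔ A ∉ S.X e (n + 1) := by
  rw [Δ, Set.mem_ofPred_eq, desing_θ_inr_eq_cls h, Ne, cls_eq_bot]

theorem exists_mem_Δ_of_val_ne_bot {x : S.BF e} {i : ℕ} (hi : x.1 i ≠ ⊥) :
    ((S.desing e).Δ x).Nonempty := by
  obtain ⟨A, hA⟩ := (x.1 i).exists_eq_mk
  rw [hA, Ne, IdealQuotient.mk_eq_bot] at hi
  by_cases hA_succ : A ∈ S.X e (i + 1)
  · obtain ⟨a, ha, rfl⟩ : ∃ a ∈ S.Δ A, e a + 1 = i := by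
      by_contra! h
      exact hi (mem_X_of_mem_X_succ hA_succ h)
    exact ⟨.inl a, (inl_mem_Δ_iff hA).2 ha⟩
  · exact ⟨.inr i, (inr_mem_Δ_iff hA).2 hA_succ⟩

theorem val_source_ne_bot {x : S.BF e} {l : L ⊕ ℕ} (h : l ∈ (S.desing e).Δ x) :
    x.1 (source e l) ≠ ⊥ := by
  obtain ⟨A, hA⟩ := (x.1 (source e l)).exists_eq_mk
  rw [hA, Ne, IdealQuotient.mk_eq_bot]
  intro hA_mem
  obtain a | n := l
  · exact (inl_mem_Δ_iff hA).1 h (S.mem_X_zero.1 (S.θ_mem_X_zero e a _ hA_mem))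
  · exact (inr_mem_Δ_iff hA).1 h (S.X_mono e n _ hA_mem)

theorem finite_source_preimage {s : Set ℕ} (hs : s.Finite) : (source e ⁻¹' s).Finite := by
  have h_inl : Function.Injective (source e ∘ Sum.inl) := fun a b h =>
    e.injective (Nat.succ_injective h)
  refine (((hs.preimage h_inl.injOn).image Sum.inl).union (hs.image Sum.inr)).subset ?_
  rintro (a | n) h
  exacts [.inl ⟨a, h, rfl⟩, .inr ⟨n, h, rfl⟩]

theorem regular_desing (S : GBDS B L) (e : L ↪ ℕ) : (S.desing e).regular = Set.univ := by
  refine Set.eq_univ_of_forall fun y x _ hx => ⟨?_, ?_⟩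
  · obtain ⟨i, hi⟩ : ∃ i, x.1 i ≠ ⊥ := by
      by_contra! h
      exact hx (FinSum.ext_iff'.2 h)
    exact exists_mem_Δ_of_val_ne_bot hi
  · exact (finite_source_preimage x.2).subset fun l => val_source_ne_bot

end GBDS

namespace GBDS

variable {B : Type v} {L : Type w} [GeneralizedBooleanAlgebra B] {S : GBDS B L}
  {R : Type u} [CommRing R] {e : L ↪ ℕ}

/-! ### The desingularization acts by matrices over the original algebra -/

/-- The level that contains the image of the action of a letter of `L^F`. -/
def target : L ⊕ ℕ → ℕ
  | .inl _ => 0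
  | .inr n => n + 1

theorem exists_eq_cls_of_mem_I {l : L ⊕ ℕ} {x : S.BF e} (h : x ∈ (S.desing e).I l) :
    ∃ A, x = S.cls e (target l) A := by
  obtain a | n := l <;> exact ⟨_, h.choose_spec.2⟩

theorem levelZero_mem_I {a : L} {x : S.BF e} (h : x ∈ (S.desing e).I (.inl a)) :
    S.levelZero e (x.1 0) ∈ S.I a := by
  obtain ⟨C, hC, rfl⟩ := h
  rwa [cls_val_self, levelZero_mk]

variable (S R e) in
/-- The nonzero entry of the matrix that represents `s_{l,x}`. -/
def entry : ∀ (l : L ⊕ ℕ) (x : S.BF e), x ∈ (S.desing e).I l → S.Alg R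
  | .inl a, x, h => S.s R a (S.levelZero e (x.1 0)) (levelZero_mem_I h)
  | .inr n, x, _ => S.levelGap R e (n + 1) (x.1 (n + 1))

section Entry

variable {l : L ⊕ ℕ} {y : S.BF e}

theorem levelGap_mul_entry (hy : y ∈ (S.desing e).I l) (x : S.BF e) :
    S.levelGap R e (source e l) (x.1 (source e l)) * S.entry R e l y hy =
      S.entry R e l y hy * S.levelGap R e (target l) (((S.desing e).θ l x).1 (target l)) := by
  obtain ⟨A, hA⟩ := (x.1 (source e l)).exists_eq_mk
  rw [hA, levelGap_mk]
  obtain a | n := l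
  · rw [desing_θ_inl_eq_cls hA, target, cls_val_self, levelGap_zero, levelZero_mk, entry,
      s_mul_P]
    exact gap_mul_s_of_notMem (self_notMem_lettersBelow a) _ _
  · rw [desing_θ_inr_eq_cls (n := n) hA, target, cls_val_self, levelGap_mk, entry, source]
    obtain ⟨D, hD⟩ := (y.1 (n + 1)).exists_eq_mk
    rw [hD, levelGap_mk, gap_mul_gap_of_subset subset_rfl]
    refine star_injective ?_
    rw [star_mul, isSelfAdjoint_gap, isSelfAdjoint_gap, isSelfAdjoint_gap,
      gap_mul_gap_of_subset (lettersBelow_mono n.le_succ)]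

theorem entry_mul_levelGap (hy : y ∈ (S.desing e).I l) (x : S.BF e) :
    S.entry R e l y hy * S.levelGap R e (target l) (x.1 (target l)) =
      S.entry R e l (y ⊓ x) ((S.desing e).inf_mem_I hy x) := by
  obtain a | n := l
  · rw [target, levelGap_zero, entry, s_mul_P]
    exact s_congr (levelZero_inf _ _).symm _ _
  · exact (levelGap_inf _ _ _).symm

theorem star_entry_mul_entry_self {x : S.BF e} (hx : x ∈ (S.desing e).I l)
    (hy : y ∈ (S.desing e).I l) : star (S.entry R e l x hx) * S.entry R e l y hy =
      S.levelGap R e (target l) ((x ⊓ y).1 (target l)) := by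
  obtain a | n := l
  · rw [entry, entry, star_s, t_mul_s_self, target, levelGap_zero]
    exact congrArg _ (levelZero_inf _ _).symm
  · rw [entry, entry, isSelfAdjoint_levelGap]
    exact (levelGap_inf _ _ _).symm

theorem levelGap_mul_s_of_lt {i : ℕ} {a : L} (h : e a + 1 < i) (x : S.Level e i) {C : B}
    (hC : C ∈ S.I a) : S.levelGap R e i x * S.s R a C hC = 0 := by
  obtain ⟨A, rfl⟩ := x.exists_eq_mk
  exact gap_mul_s_of_mem (mem_lettersBelow.2 h) A hC

theorem star_entry_mul_entry_of_ne {k : L ⊕ ℕ} (hkl : k ≠ l) (h : source e k = source e l)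
    {x : S.BF e} (hx : x ∈ (S.desing e).I k) (hy : y ∈ (S.desing e).I l) :
    star (S.entry R e k x hx) * S.entry R e l y hy = 0 := by
  obtain a | m := k <;> obtain b | n := l
  · exact absurd (congrArg Sum.inl (e.injective (Nat.succ_injective h))) hkl
  · obtain rfl : e a + 1 = n := h
    refine star_injective ?_
    rw [star_mul, star_star, star_zero, entry, entry, isSelfAdjoint_levelGap,
      levelGap_mul_s_of_lt (Nat.lt_succ_self _)]
  · obtain rfl : m = e b + 1 := h
    rw [entry, entry, isSelfAdjoint_levelGap, levelGap_mul_s_of_lt (Nat.lt_succ_self _)]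
  · exact absurd (congrArg Sum.inr h) hkl

end Entry

variable (R) in
/-- The nonzero entry of the matrix that represents the range projection of `l` at `x`. -/
def entryProj (x : S.BF e) (l : L ⊕ ℕ) : S.Alg R :=
  S.entry R e l ((S.desing e).θ l x) ((S.desing e).θ_mem_I l x) *
    star (S.entry R e l ((S.desing e).θ l x) ((S.desing e).θ_mem_I l x))

section EntryProj

variable {x : S.BF e}

theorem entryProj_inl {a : L} {A : B} (h : x.1 (e a + 1) = IdealQuotient.mk _ A) :
    entryProj R x (.inl a) = S.rangeProj R a A := by
  rw [entryProj, entry, star_s, rangeProj]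
  simp only [desing_θ_inl_eq_cls h, cls_val_self, levelZero_mk]

theorem entryProj_inr {n : ℕ} {A : B} (h : x.1 n = IdealQuotient.mk _ A) :
    entryProj R x (.inr n) = S.gap R (lettersBelow e (n + 1)) A := by
  rw [entryProj, entry, isSelfAdjoint_levelGap, desing_θ_inr_eq_cls h, cls_val_self,
    levelGap_mk, gap_mul_gap_of_subset subset_rfl, inf_idem]

theorem entryProj_eq_zero {l : L ⊕ ℕ} (h : l ∉ (S.desing e).Δ x) : entryProj R x l = 0 := by
  obtain ⟨A, hA⟩ := (x.1 (source e l)).exists_eq_mk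
  obtain a | n := l
  · rw [entryProj_inl hA, rangeProj_eq_zero]
    exact not_not.1 fun h' => h ((inl_mem_Δ_iff hA).2 h')
  · rw [entryProj_inr (n := n) hA, gap_lettersBelow_eq_zero]
    exact not_not.1 fun h' => h ((inr_mem_Δ_iff hA).2 h')

theorem sum_entryProj_of_source_eq {i : ℕ} {T : Finset (L ⊕ ℕ)}
    (hT : ∀ l, l ∈ T ↔ source e l = i) :
    ∑ l ∈ T, entryProj R x l = S.levelGap R e i (x.1 i) := by
  classical
  obtain ⟨A, hA⟩ := (x.1 i).exists_eq_mk
  by_cases h : ∃ a, e a + 1 = i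
  · obtain ⟨a, rfl⟩ := h
    obtain rfl : T = {.inr (e a + 1), .inl a} := by
      ext (b | n) <;> simp [hT, source]
    rw [Finset.sum_pair Sum.inr_ne_inl, entryProj_inl hA, entryProj_inr hA, hA, levelGap_mk,
      gap_eq_gap_insert_add (self_notMem_lettersBelow a), lettersBelow_letter_succ]
  · push Not at h
    obtain rfl : T = {.inr i} := by
      ext (b | n) <;> simp [hT, source, h]
    rw [Finset.sum_singleton, entryProj_inr hA, hA, levelGap_mk, lettersBelow_succ_of_forall_ne h]

open Classical in
theorem levelGap_eq_sum_entryProj {F : Finset (L ⊕ ℕ)} (hF : (S.desing e).Δ x ⊆ F) (i : ℕ) :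
    S.levelGap R e i (x.1 i) = ∑ l ∈ F with source e l = i, entryProj R x l := by
  have hT (l : L ⊕ ℕ) :
      l ∈ (finite_source_preimage (e := e) (Set.finite_singleton i)).toFinset ↔
        source e l = i := Set.Finite.mem_toFinset _
  rw [← sum_entryProj_of_source_eq hT]
  refine (Finset.sum_subset (fun l hl => (hT l).2 (Finset.mem_filter.1 hl).2) ?_).symm
  exact fun l hl hlF => entryProj_eq_zero fun h =>
    hlF (Finset.mem_filter.2 ⟨hF h, (hT l).1 hl⟩)

end EntryProj

variable (R) in
/-- The matrix that represents `p_x`. -/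
def matP (x : S.BF e) : ColEnd R ℕ (S.Alg R) :=
  ColEnd.diag R fun i => S.levelGap R e i (x.1 i)

theorem matP_cls (i : ℕ) (A : B) :
    matP R (S.cls e i A) = ColEnd.unit R i i (S.gap R (lettersBelow e i) A) := by
  refine LinearMap.ext fun y => funext fun j => ?_
  rw [matP, ColEnd.diag_apply, ColEnd.unit_apply]
  obtain rfl | h := eq_or_ne j i
  · rw [cls_val_self, Pi.single_eq_same, levelGap_mk]
  · rw [cls, FinSum.single_val_of_ne h, levelGap_bot, Pi.single_eq_of_ne h, zero_mul]

theorem matP_of_mem_I {l : L ⊕ ℕ} {x : S.BF e} (hx : x ∈ (S.desing e).I l) : matP R x =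
    ColEnd.unit R (target l) (target l) (S.levelGap R e (target l) (x.1 (target l))) := by
  obtain ⟨A, rfl⟩ := exists_eq_cls_of_mem_I hx
  rw [matP_cls, cls_val_self, levelGap_mk]

theorem matP_eq_sum {x : S.BF e} {F : Finset (L ⊕ ℕ)} (hF : (S.desing e).Δ x ⊆ F) :
    matP R x = ∑ l ∈ F, ColEnd.unit R (source e l) (source e l) (entryProj R x l) := by
  classical
  refine LinearMap.ext fun y => funext fun i => ?_
  rw [matP, ColEnd.diag_apply, levelGap_eq_sum_entryProj hF, Finset.sum_mul, Finset.sum_filter,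
    LinearMap.sum_apply, Finset.sum_apply]
  refine Finset.sum_congr rfl fun l _ => ?_
  rw [ColEnd.unit_apply, Pi.single_apply]
  split_ifs with h h' h'
  exacts [by rw [h], absurd h.symm h', absurd h'.symm h, rfl]

variable (S R e) in
/-- The representation of the desingularization by matrices over `L_R(B, L, θ, I)`. -/
def matRep : (S.desing e).Rep (ColEnd R ℕ (S.Alg R)) where
  p := matP R
  s l x hx := ColEnd.unit R (source e l) (target l) (S.entry R e l x hx)
  t l x hx := ColEnd.unit R (target l) (source e l) (star (S.entry R e l x hx))
  p_bot := LinearMap.ext fun y => funext fun i => by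
    rw [matP, ColEnd.diag_apply]
    exact (congrArg (· * y i) (levelGap_bot i)).trans (zero_mul _)
  p_inf x y :=
    (congrArg (ColEnd.diag R) (funext fun i => levelGap_inf i (x.1 i) (y.1 i))).trans
      (ColEnd.diag_mul_diag _ _).symm
  p_sup x y := LinearMap.ext fun z => funext fun i => by
    change S.levelGap R e i (x.1 i ⊔ y.1 i) * z i = S.levelGap R e i (x.1 i) * z i +
      S.levelGap R e i (y.1 i) * z i - S.levelGap R e i (x.1 i ⊓ y.1 i) * z i
    rw [levelGap_sup, sub_mul, add_mul]
  p_s x l y hy := by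
    rw [matP, matP, ColEnd.diag_mul_unit, ColEnd.unit_mul_diag, levelGap_mul_entry]
  t_p x l y hy := by
    rw [matP, matP, ColEnd.diag_mul_unit, ColEnd.unit_mul_diag,
      ← isSelfAdjoint_levelGap (source e l), ← star_mul, levelGap_mul_entry, star_mul,
      isSelfAdjoint_levelGap]
  t_s_self l x y hx hy := by
    rw [ColEnd.unit_mul_unit, star_entry_mul_entry_self,
      matP_of_mem_I ((S.desing e).inf_mem_I hx y)]
  t_s_ne k l hkl x y hx hy := by
    by_cases h : source e k = source e l
    · rw [h, ColEnd.unit_mul_unit, star_entry_mul_entry_of_ne hkl h, map_zero]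
    · exact ColEnd.unit_mul_unit_of_ne h _ _
  s_p l y x hy := by
    rw [matP, ColEnd.unit_mul_diag, entry_mul_levelGap]
  p_t l y x hy := by
    rw [matP, ColEnd.diag_mul_unit, ← isSelfAdjoint_levelGap (target l), ← star_mul,
      entry_mul_levelGap]
  cuntzKrieger x _ F hF := by
    rw [matP_eq_sum fun l => (hF l).2]
    exact Finset.sum_congr rfl fun l _ => (ColEnd.unit_mul_unit _ _ _ _ _).symm

end GBDS

namespace GBDS

variable {B : Type v} {L : Type w} [GeneralizedBooleanAlgebra B] {S : GBDS B L}
  {R : Type u} [CommRing R] {e : L ↪ ℕ}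

/-! ### Generators of the algebra of the desingularization -/

section Cls

theorem cls_inf_cls (i : ℕ) (A D : B) : S.cls e i A ⊓ S.cls e i D = S.cls e i (A ⊓ D) :=
  (FinSum.ext_iff'.2 fun j => FinSum.single_op (B := S.Level e) (fun _ a b => a ⊓ b)
    (fun _ => inf_idem _) i (IdealQuotient.mk (S.X e i) A) (IdealQuotient.mk (S.X e i) D) j).symm

theorem cls_sup_cls (i : ℕ) (A D : B) : S.cls e i A ⊔ S.cls e i D = S.cls e i (A ⊔ D) :=
  (FinSum.ext_iff'.2 fun j => FinSum.single_op (B := S.Level e) (fun _ a b => a ⊔ b)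
    (fun _ => sup_idem _) i (IdealQuotient.mk (S.X e i) A) (IdealQuotient.mk (S.X e i) D) j).symm

theorem cls_bot (i : ℕ) : S.cls e i ⊥ = ⊥ := cls_eq_bot.2 (S.X e i).bot_mem

theorem cls_val_of_ne {i j : ℕ} (h : j ≠ i) (A : B) :
    (S.cls e i A).1 j = IdealQuotient.mk (S.X e j) ⊥ :=
  FinSum.single_val_of_ne h _

theorem cls_inf_cls_of_ne {i j : ℕ} (h : i ≠ j) (A D : B) : S.cls e i A ⊓ S.cls e j D = ⊥ := by
  refine FinSum.ext_iff'.2 fun k => ?_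
  change (S.cls e i A).1 k ⊓ (S.cls e j D).1 k = ⊥
  obtain rfl | hk := eq_or_ne k i
  · exact (congrArg (_ ⊓ ·) (FinSum.single_val_of_ne h _)).trans (inf_bot_eq _)
  · exact (congrArg (· ⊓ _) (FinSum.single_val_of_ne hk _)).trans (bot_inf_eq _)

theorem desing_θ_inl_cls_of_ne {i : ℕ} {a : L} (h : i ≠ e a + 1) (A : B) :
    (S.desing e).θ (.inl a) (S.cls e i A) = ⊥ := by
  rw [desing_θ_inl_eq_cls (cls_val_of_ne h.symm A), (S.θ a).map_bot, cls_bot]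

theorem desing_θ_inr_cls_of_ne {i n : ℕ} (h : i ≠ n) (A : B) :
    (S.desing e).θ (.inr n) (S.cls e i A) = ⊥ := by
  rw [desing_θ_inr_eq_cls (cls_val_of_ne h.symm A), cls_bot]

theorem Δ_cls_subset (i : ℕ) (A : B) : (S.desing e).Δ (S.cls e i A) ⊆ source e ⁻¹' {i} := by
  rintro (a | n) h <;> by_contra h'
  · exact h (desing_θ_inl_cls_of_ne (Ne.symm h') A)
  · exact h (desing_θ_inr_cls_of_ne (Ne.symm h') A)

theorem cls_mem_I_inr (n : ℕ) (A : B) : S.cls e (n + 1) A ∈ (S.desing e).I (.inr n) :=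
  ⟨A, trivial, rfl⟩

theorem cls_mem_I_inl {a : L} {C : B} (hC : C ∈ S.I a) :
    S.cls e 0 C ∈ (S.desing e).I (.inl a) := ⟨C, hC, rfl⟩

end Cls

variable (S R e) in
/-- The projection `p_{[A]_i}`. -/
def levelP (i : ℕ) (A : B) : (S.desing e).Alg R := (S.desing e).P R (S.cls e i A)

variable (S R e) in
/-- The generator `s_{b,[A]_{n+1}}` for `b = b_{n+1}`, which steps from level `n` to level
`n + 1`. -/
def stepS (n : ℕ) (A : B) : (S.desing e).Alg R :=
  (S.desing e).s R (.inr n) (S.cls e (n + 1) A) (cls_mem_I_inr n A)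

variable (S R e) in
/-- The generator `s_{a,[C]_0}`, which returns from level `e a + 1` to level `0`. -/
def returnS (a : L) (C : B) (hC : C ∈ S.I a) : (S.desing e).Alg R :=
  (S.desing e).s R (.inl a) (S.cls e 0 C) (cls_mem_I_inl hC)

theorem isSelfAdjoint_levelP (i : ℕ) (A : B) : IsSelfAdjoint (S.levelP R e i A) := star_P _

theorem levelP_mul_levelP (i : ℕ) (A D : B) :
    S.levelP R e i A * S.levelP R e i D = S.levelP R e i (A ⊓ D) := by
  rw [levelP, levelP, P_mul_P, cls_inf_cls, levelP]

theorem levelP_mul_levelP_of_ne {i j : ℕ} (h : i ≠ j) (A D : B) :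
    S.levelP R e i A * S.levelP R e j D = 0 := by
  rw [levelP, levelP, P_mul_P, cls_inf_cls_of_ne h, P_bot]

theorem levelP_eq_zero {i : ℕ} {A : B} (h : A ∈ S.X e i) : S.levelP R e i A = 0 := by
  rw [levelP, cls_eq_bot.2 h, P_bot]

theorem levelP_mul_stepS (n : ℕ) (A C : B) :
    S.levelP R e n A * S.stepS R e n C = S.stepS R e n (C ⊓ A) :=
  (P_mul_s _ _).trans (s_congr (by rw [desing_θ_inr, cls_inf_cls]) _ _)

theorem stepS_mul_levelP (n : ℕ) (C A : B) :
    S.stepS R e n C * S.levelP R e (n + 1) A = S.stepS R e n (C ⊓ A) :=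
  (s_mul_P _ _).trans (s_congr (cls_inf_cls _ _ _) _ _)

theorem star_stepS_mul_stepS (n : ℕ) (A C : B) :
    star (S.stepS R e n A) * S.stepS R e n C = S.levelP R e (n + 1) (A ⊓ C) := by
  rw [stepS, stepS, star_s, t_mul_s_self, cls_inf_cls, levelP]

section Letter

variable {a : L} {C : B}

theorem returnS_congr {D : B} (h : C = D) (hC : C ∈ S.I a) (hD : D ∈ S.I a) :
    S.returnS R e a C hC = S.returnS R e a D hD := by subst h; rfl

theorem levelP_mul_returnS (A : B) (hC : C ∈ S.I a) :
    S.levelP R e (e a + 1) A * S.returnS R e a C hC =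
      S.returnS R e a (C ⊓ S.θ a A) (S.inf_mem_I hC _) :=
  (P_mul_s _ _).trans (s_congr (by rw [desing_θ_inl, cls_inf_cls]) _ _)

theorem levelP_mul_returnS_of_le {A : B} (hC : C ∈ S.I a) (h : C ≤ S.θ a A) :
    S.levelP R e (e a + 1) A * S.returnS R e a C hC = S.returnS R e a C hC :=
  (levelP_mul_returnS A hC).trans (returnS_congr (inf_eq_left.2 h) _ _)

theorem returnS_mul_levelP (hC : C ∈ S.I a) (A : B) :
    S.returnS R e a C hC * S.levelP R e 0 A = S.returnS R e a (C ⊓ A) (S.inf_mem_I hC _) :=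
  (s_mul_P _ _).trans (s_congr (cls_inf_cls _ _ _) _ _)

theorem star_returnS_mul_returnS {D : B} (hC : C ∈ S.I a) (hD : D ∈ S.I a) :
    star (S.returnS R e a C hC) * S.returnS R e a D hD = S.levelP R e 0 (C ⊓ D) := by
  rw [returnS, returnS, star_s, t_mul_s_self, cls_inf_cls, levelP]

theorem star_returnS_mul_stepS (hC : C ∈ S.I a) (n : ℕ) (D : B) :
    star (S.returnS R e a C hC) * S.stepS R e n D = 0 := by
  rw [returnS, stepS, star_s, t_mul_s_of_ne Sum.inl_ne_inr]

theorem returnS_eq_zero (h : C = ⊥) (hC : C ∈ S.I a) : S.returnS R e a C hC = 0 :=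
  s_eq_zero (by rw [h, cls_bot]) _

end Letter

theorem rangeProj_inr_cls (n : ℕ) (A : B) : (S.desing e).rangeProj R (.inr n) (S.cls e n A) =
    S.stepS R e n A * star (S.stepS R e n A) := by
  rw [rangeProj, ← star_s, s_congr (S.desing_θ_inr e n A) _ (cls_mem_I_inr n A), stepS]

theorem rangeProj_inl_cls (a : L) (A : B) :
    (S.desing e).rangeProj R (.inl a) (S.cls e (e a + 1) A) =
      S.returnS R e a (S.θ a A) (S.θ_mem_I a A) *
        star (S.returnS R e a (S.θ a A) (S.θ_mem_I a A)) := by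
  rw [rangeProj, ← star_s, s_congr (S.desing_θ_inl e a A) _
    (cls_mem_I_inl (S.θ_mem_I a A)), returnS]

theorem levelP_eq_sum_rangeProj {i : ℕ} {F : Finset (L ⊕ ℕ)} (hF : source e ⁻¹' {i} ⊆ F)
    (A : B) : S.levelP R e i A = ∑ l ∈ F, (S.desing e).rangeProj R l (S.cls e i A) :=
  P_eq_sum_rangeProj (regular_desing S e ▸ Set.mem_univ _) ((Δ_cls_subset i A).trans hF)

theorem levelP_letter_eq (a : L) (A : B) : S.levelP R e (e a + 1) A =
    S.stepS R e (e a + 1) A * star (S.stepS R e (e a + 1) A) +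
      S.returnS R e a (S.θ a A) (S.θ_mem_I a A) *
        star (S.returnS R e a (S.θ a A) (S.θ_mem_I a A)) := by
  classical
  have hF : source e ⁻¹' {e a + 1} ⊆ ({.inr (e a + 1), .inl a} : Finset (L ⊕ ℕ)) := by
    rintro (b | n) <;> simp [source]
  rw [levelP_eq_sum_rangeProj hF, Finset.sum_pair Sum.inr_ne_inl, rangeProj_inr_cls,
    rangeProj_inl_cls]

theorem levelP_eq_of_forall_ne {n : ℕ} (hn : ∀ a, e a + 1 ≠ n) (A : B) :
    S.levelP R e n A = S.stepS R e n A * star (S.stepS R e n A) := by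
  have hF : source e ⁻¹' {n} ⊆ ({.inr n} : Finset (L ⊕ ℕ)) := by
    rintro (b | m) <;> simp [source, hn]
  rw [levelP_eq_sum_rangeProj hF, Finset.sum_singleton, rangeProj_inr_cls]

/-! ### Paths along the new letters -/

variable (S R e) in
/-- The product `p_{[A]_0} s_{b_1,[A]_1} ⋯ s_{b_n,[A]_n}`. -/
def path (A : B) : ℕ → (S.desing e).Alg R
  | 0 => S.levelP R e 0 A
  | n + 1 => path A n * S.stepS R e n A

theorem path_zero (A : B) : S.path R e A 0 = S.levelP R e 0 A := rfl

theorem path_succ (A : B) (n : ℕ) :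
    S.path R e A (n + 1) = S.path R e A n * S.stepS R e n A := rfl

theorem path_mul_levelP (n : ℕ) (A D : B) :
    S.path R e A n * S.levelP R e n D = S.path R e (A ⊓ D) n := by
  induction n generalizing D with
  | zero => exact levelP_mul_levelP 0 A D
  | succ n ih =>
    rw [path_succ, path_succ, ← ih, mul_assoc, mul_assoc, stepS_mul_levelP, levelP_mul_stepS,
      inf_assoc, inf_idem]

theorem path_mul_levelP_self (n : ℕ) (A : B) :
    S.path R e A n * S.levelP R e n A = S.path R e A n := by
  rw [path_mul_levelP, inf_idem]

theorem levelP_mul_star_path_self (n : ℕ) (A : B) :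
    S.levelP R e n A * star (S.path R e A n) = star (S.path R e A n) := by
  rw [← isSelfAdjoint_levelP, ← star_mul, path_mul_levelP_self]

theorem levelP_mul_path (n : ℕ) (A D : B) :
    S.levelP R e 0 D * S.path R e A n = S.path R e (A ⊓ D) n := by
  induction n with
  | zero => rw [path_zero, path_zero, levelP_mul_levelP, inf_comm]
  | succ n ih =>
    rw [path_succ, path_succ, ← mul_assoc, ih, ← path_mul_levelP, mul_assoc, mul_assoc,
      levelP_mul_stepS, levelP_mul_stepS, inf_assoc, inf_idem]

theorem star_path_mul_path (n : ℕ) (A D : B) :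
    star (S.path R e A n) * S.path R e D n = S.levelP R e n (A ⊓ D) := by
  induction n with
  | zero => rw [path_zero, path_zero, isSelfAdjoint_levelP, levelP_mul_levelP]
  | succ n ih =>
    rw [path_succ, path_succ, star_mul, mul_assoc, ← mul_assoc (star (S.path R e A n)), ih,
      levelP_mul_stepS, star_stepS_mul_stepS, ← inf_assoc, inf_idem]

theorem exists_path_eq {i j : ℕ} (h : i < j) (A : B) :
    ∃ z, S.path R e A j = S.path R e A i * S.stepS R e i A * z := by
  induction j, h using Nat.le_induction with
  | base =>
    refine ⟨S.levelP R e (i + 1) A, ?_⟩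
    rw [mul_assoc, stepS_mul_levelP, inf_idem, path_succ]
  | succ j _ ih =>
    obtain ⟨z, hz⟩ := ih
    exact ⟨z * S.stepS R e j A, by rw [path_succ, hz, mul_assoc]⟩

/-! ### The corner of level zero -/

variable (S R e) in
/-- The product `s_{b_1} ⋯ s_{b_i} s_{a,C}` with `a = a_i`, where the sets in the indices of the
first `i` factors are the classes of some `A` with `C ⊆ θ_a A`; the choice of `A` is immaterial. -/
def cornerS (a : L) (C : B) (h : C ∈ S.minSystem.I a) : (S.desing e).Alg R :=
  S.path R e h.choose (e a + 1) * S.returnS R e a C (minSystem_I_le h)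

section CornerS

variable {a : L} {C : B}

theorem cornerS_eq {A : B} (hC : C ≤ S.θ a A) (h : C ∈ S.minSystem.I a) :
    S.cornerS R e a C h = S.path R e A (e a + 1) * S.returnS R e a C (minSystem_I_le h) := by
  have h' : C ≤ S.θ a h.choose := h.choose_spec
  conv_lhs => rw [cornerS, ← levelP_mul_returnS_of_le _ hC, ← mul_assoc, path_mul_levelP]
  conv_rhs => rw [← levelP_mul_returnS_of_le _ h', ← mul_assoc, path_mul_levelP, inf_comm]

theorem levelP_mul_cornerS (hC : C ∈ S.minSystem.I a) (D : B) :
    S.levelP R e 0 D * S.cornerS R e a C hC =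
      S.cornerS R e a C hC * S.levelP R e 0 (S.θ a D) := by
  rw [cornerS, ← mul_assoc, levelP_mul_path, ← path_mul_levelP, mul_assoc, mul_assoc,
    levelP_mul_returnS, returnS_mul_levelP]

theorem cornerS_mul_levelP (hC : C ∈ S.minSystem.I a) (D : B) :
    S.cornerS R e a C hC * S.levelP R e 0 D =
      S.cornerS R e a (C ⊓ D) (S.minSystem.inf_mem_I hC D) := by
  obtain ⟨A, hA⟩ := id hC
  rw [cornerS_eq hA, cornerS_eq (inf_le_left.trans hA), mul_assoc, returnS_mul_levelP]

theorem star_cornerS_mul_cornerS {D : B} (hC : C ∈ S.minSystem.I a)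
    (hD : D ∈ S.minSystem.I a) :
    star (S.cornerS R e a C hC) * S.cornerS R e a D hD = S.levelP R e 0 (C ⊓ D) := by
  obtain ⟨A, hA⟩ := id hC
  obtain ⟨A', hA'⟩ := id hD
  rw [cornerS_eq (hA.trans (S.θ_mono a (le_sup_left (b := A')))),
    cornerS_eq (hA'.trans (S.θ_mono a (le_sup_right (a := A)))), star_mul, mul_assoc,
    ← mul_assoc (star (S.path R e _ _)), star_path_mul_path, inf_idem,
    levelP_mul_returnS_of_le _ (hA'.trans (S.θ_mono a le_sup_right)), star_returnS_mul_returnS]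

theorem star_cornerS_mul_cornerS_of_lt {b : L} {D : B} (h : e a < e b)
    (hC : C ∈ S.minSystem.I a) (hD : D ∈ S.minSystem.I b) :
    star (S.cornerS R e a C hC) * S.cornerS R e b D hD = 0 := by
  rw [cornerS, cornerS, star_mul]
  set A := hC.choose
  set A' := hD.choose
  obtain ⟨z, hz⟩ := exists_path_eq (S := S) (R := R) (Nat.succ_lt_succ h) A'
  rw [hz, mul_assoc, mul_assoc, mul_assoc, ← mul_assoc (star (S.path R e A _)),
    star_path_mul_path, ← mul_assoc (S.levelP R e _ _), levelP_mul_stepS, ← mul_assoc,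
    star_returnS_mul_stepS, zero_mul]

theorem star_cornerS_mul_cornerS_of_ne {b : L} {D : B} (h : a ≠ b)
    (hC : C ∈ S.minSystem.I a) (hD : D ∈ S.minSystem.I b) :
    star (S.cornerS R e a C hC) * S.cornerS R e b D hD = 0 := by
  obtain h' | h' := (e.injective.ne h).lt_or_gt
  · exact star_cornerS_mul_cornerS_of_lt h' hC hD
  · refine star_injective ?_
    rw [star_mul, star_star, star_cornerS_mul_cornerS_of_lt h', star_zero]

end CornerS

variable (S R e) in
/-- The range projection of `cornerS` at `θ_a A`. -/
def cornerProj (a : L) (A : B) : (S.desing e).Alg R :=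
  S.cornerS R e a (S.θ a A) (mem_minSystem_I le_rfl) *
    star (S.cornerS R e a (S.θ a A) (mem_minSystem_I le_rfl))

theorem cornerProj_eq (a : L) (A : B) : S.cornerProj R e a A = S.path R e A (e a + 1) *
    (S.returnS R e a (S.θ a A) (S.θ_mem_I a A) *
      star (S.returnS R e a (S.θ a A) (S.θ_mem_I a A))) * star (S.path R e A (e a + 1)) := by
  rw [cornerProj, cornerS_eq le_rfl, star_mul]
  simp only [mul_assoc]

theorem path_mul_star_path (A : B) (n : ℕ) :
    S.path R e A n * star (S.path R e A n) =
      S.path R e A n * S.levelP R e n A * star (S.path R e A n) := by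
  rw [path_mul_levelP_self]

theorem levelP_zero_eq (A : B) (n : ℕ) : S.levelP R e 0 A =
    S.path R e A n * star (S.path R e A n) + ∑ a ∈ lettersBelow e n, S.cornerProj R e a A := by
  classical
  induction n with
  | zero =>
    rw [lettersBelow_zero, Finset.sum_empty, add_zero, path_zero, isSelfAdjoint_levelP,
      levelP_mul_levelP, inf_idem]
  | succ n ih =>
    rw [ih, path_mul_star_path, path_succ, star_mul]
    by_cases h : ∃ a, e a + 1 = n
    · obtain ⟨a, rfl⟩ := h
      rw [lettersBelow_letter_succ, Finset.sum_insert (self_notMem_lettersBelow a),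
        cornerProj_eq, levelP_letter_eq]
      simp only [mul_add, add_mul, mul_assoc, add_assoc]
    · push Not at h
      rw [lettersBelow_succ_of_forall_ne h, levelP_eq_of_forall_ne h]
      simp only [mul_assoc]

theorem path_eq_zero {A : B} {n : ℕ} (h : A ∈ S.X e n) : S.path R e A n = 0 := by
  rw [← path_mul_levelP_self, levelP_eq_zero h, mul_zero]

variable (e) in
theorem exists_mem_X_of_regular {A : B} (h : A ∈ S.regular) : ∃ n, A ∈ S.X e n := by
  have finite_Δ : (S.Δ A).Finite := by
    by_cases hA : A = ⊥
    · refine Set.finite_empty.subset fun a ha => ha ?_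
      rw [hA, (S.θ a).map_bot]
    · exact (h A le_rfl hA).2
  refine ⟨finite_Δ.toFinset.sup (fun a => e a + 1) + 1, fun V hV => ?_, fun a ha => ?_⟩
  · by_contra h'
    obtain ⟨a, ha⟩ := (h (A ⊓ V) inf_le_left h').1
    exact Set.notMem_empty a (hV.le (Δ_mono inf_le_right ha))
  · exact Nat.lt_succ_of_le
      (Finset.le_sup (f := fun a => e a + 1) (finite_Δ.mem_toFinset.2 ha))

theorem levelP_zero_eq_sum_cornerProj {A : B} (hA : A ∈ S.regular) {F : Finset L}
    (hF : ∀ a, a ∈ F ↔ a ∈ S.Δ A) : S.levelP R e 0 A = ∑ a ∈ F, S.cornerProj R e a A := by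
  obtain ⟨n, hn⟩ := exists_mem_X_of_regular e hA
  rw [levelP_zero_eq A n, path_eq_zero hn, zero_mul, zero_add]
  refine (Finset.sum_subset (fun a ha => mem_lettersBelow.2 (hn.2 a ((hF a).1 ha)))
    fun a _ ha => ?_).symm
  rw [cornerProj_eq, returnS_eq_zero (not_not.1 (mt (hF a).2 ha)), zero_mul, mul_zero, zero_mul]

variable (S R e) in
/-- The representation of the minimal system in the corner of level zero. -/
def cornerRep : S.minSystem.Rep ((S.desing e).Alg R) where
  p := S.levelP R e 0
  s := S.cornerS R e
  t a C hC := star (S.cornerS R e a C hC)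
  p_bot := levelP_eq_zero (S.X e 0).bot_mem
  p_inf C D := (levelP_mul_levelP 0 C D).symm
  p_sup C D := by
    rw [levelP, ← cls_sup_cls, P_sup, cls_inf_cls]
    rfl
  p_s D a C hC := levelP_mul_cornerS hC D
  t_p D a C hC := by
    rw [← isSelfAdjoint_levelP 0 D, ← star_mul, levelP_mul_cornerS hC, star_mul,
      isSelfAdjoint_levelP, minSystem_θ]
  t_s_self a C D hC hD := star_cornerS_mul_cornerS hC hD
  t_s_ne a b h C D hC hD := star_cornerS_mul_cornerS_of_ne h hC hD
  s_p a C D hC := cornerS_mul_levelP hC D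
  p_t a C D hC := by
    rw [← isSelfAdjoint_levelP 0 D, ← star_mul, cornerS_mul_levelP hC]
  cuntzKrieger _ hC _ hF := levelP_zero_eq_sum_cornerProj (S := S) hC hF

variable (S R e) in
/-- The homomorphism from the algebra of the minimal system to the corner of level zero. -/
def cornerHom : S.minSystem.Alg R →ₙₐ[R] (S.desing e).Alg R := (S.cornerRep R e).lift R

theorem cornerHom_P (A : B) : S.cornerHom R e (S.minSystem.P R A) = S.levelP R e 0 A :=
  (S.cornerRep R e).lift_P A

theorem cornerHom_s {a : L} {C : B} (h : C ∈ S.minSystem.I a) :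
    S.cornerHom R e (S.minSystem.s R a C h) = S.cornerS R e a C h :=
  (S.cornerRep R e).lift_s a C h

theorem cornerHom_t {a : L} {C : B} (h : C ∈ S.minSystem.I a) :
    S.cornerHom R e (S.minSystem.t R a C h) = star (S.cornerS R e a C h) :=
  (S.cornerRep R e).lift_t a C h

variable (S R e) in
/-- The homomorphism from the algebra of the desingularization to matrices over
`L_R(B, L, θ, I)`. -/
def matHom : (S.desing e).Alg R →ₙₐ[R] ColEnd R ℕ (S.Alg R) := (S.matRep R e).lift R

theorem matHom_levelP (i : ℕ) (A : B) :
    S.matHom R e (S.levelP R e i A) = ColEnd.unit R i i (S.gap R (lettersBelow e i) A) :=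
  ((S.matRep R e).lift_P _).trans (matP_cls i A)

theorem matHom_stepS (n : ℕ) (A : B) : S.matHom R e (S.stepS R e n A) =
    ColEnd.unit R n (n + 1) (S.gap R (lettersBelow e (n + 1)) A) :=
  ((S.matRep R e).lift_s _ _ _).trans (congrArg (ColEnd.unit R n (n + 1))
    (congrArg (S.levelGap R e (n + 1)) (cls_val_self _ _)))

theorem matHom_star_stepS (n : ℕ) (A : B) : S.matHom R e (star (S.stepS R e n A)) =
    ColEnd.unit R (n + 1) n (S.gap R (lettersBelow e (n + 1)) A) := by
  rw [stepS, star_s]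
  exact ((S.matRep R e).lift_t _ _ _).trans (congrArg (ColEnd.unit R (n + 1) n)
    ((isSelfAdjoint_levelGap _ _).trans
      (congrArg (S.levelGap R e (n + 1)) (cls_val_self _ _))))

section Letter

variable {a : L} {C : B}

theorem entry_inl_cls (hC : C ∈ S.I a) :
    S.entry R e (.inl a) (S.cls e 0 C) (cls_mem_I_inl hC) = S.s R a C hC :=
  s_congr (congrArg (S.levelZero e) (cls_val_self 0 C)) _ _

theorem matHom_returnS (hC : C ∈ S.I a) : S.matHom R e (S.returnS R e a C hC) =
    ColEnd.unit R (e a + 1) 0 (S.s R a C hC) :=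
  ((S.matRep R e).lift_s _ _ _).trans (congrArg (ColEnd.unit R (e a + 1) 0) (entry_inl_cls hC))

theorem matHom_star_returnS (hC : C ∈ S.I a) : S.matHom R e (star (S.returnS R e a C hC)) =
    ColEnd.unit R 0 (e a + 1) (S.t R a C hC) := by
  rw [returnS, star_s, ← star_s a C hC, ← entry_inl_cls hC]
  exact (S.matRep R e).lift_t _ _ _

end Letter

theorem matHom_path (A : B) (n : ℕ) :
    S.matHom R e (S.path R e A n) = ColEnd.unit R 0 n (S.gap R (lettersBelow e n) A) := by
  induction n with
  | zero => exact matHom_levelP 0 A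
  | succ n ih =>
    rw [path_succ, map_mul, ih, matHom_stepS, ColEnd.unit_mul_unit,
      ← isSelfAdjoint_gap (lettersBelow e n), ← isSelfAdjoint_gap (lettersBelow e (n + 1)),
      ← star_mul, gap_mul_gap_of_subset (lettersBelow_mono n.le_succ), inf_idem]

theorem matHom_star_path (A : B) (n : ℕ) :
    S.matHom R e (star (S.path R e A n)) = ColEnd.unit R n 0 (S.gap R (lettersBelow e n) A) := by
  induction n with
  | zero => rw [path_zero, isSelfAdjoint_levelP, matHom_levelP]
  | succ n ih =>
    rw [path_succ, star_mul, map_mul, ih, matHom_star_stepS, ColEnd.unit_mul_unit,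
      gap_mul_gap_of_subset (lettersBelow_mono n.le_succ), inf_idem]

end GBDS

/-! ### Full corners -/

section FullCorner

variable {R : Type u} [CommRing R] {Q : Type x} [NonUnitalRing Q] [Module R Q]
  {A : Type y} [NonUnitalRing A] [Module R A]

/-- The two-sided ideal generated by the products `x c(v) y`, that is, `A c(Q) A`. -/
def cornerSpan (c : Q →ₙₐ[R] A) : Submodule R A :=
  Submodule.span R {z | ∃ x v y, z = x * c v * y}

/-- The subspace `X c(Q)`. -/
def leftSpan (c : Q →ₙₐ[R] A) (X : Set A) : Submodule R A :=
  Submodule.span R {z | ∃ l ∈ X, ∃ v, z = l * c v}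

/-- The homomorphism `c` identifies `Q` with a full corner of `A`: with `D = c(Q)`, these are the
conditions `D A D ⊆ D` and `A D A = A`. Neither `Q` nor `A` needs a unit, so that the corner is not
described by an idempotent. -/
structure IsFullCorner (c : Q →ₙₐ[R] A) : Prop where
  mul_mul_mem_range : ∀ v z v', c v * z * c v' ∈ Set.range c
  cornerSpan_eq_top : cornerSpan c = ⊤

variable {c : Q →ₙₐ[R] A} {X : Set A}

theorem mul_mem_cornerSpan (x : A) (v : Q) (y : A) : x * c v * y ∈ cornerSpan c :=
  Submodule.subset_span ⟨x, v, y, rfl⟩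

theorem mul_mem_leftSpan {l : A} (hl : l ∈ X) (v : Q) : l * c v ∈ leftSpan c X :=
  Submodule.subset_span ⟨l, hl, v, rfl⟩

theorem mul_left_mem_cornerSpan [SMulCommClass R A A] (z : A) {w : A} (hw : w ∈ cornerSpan c) :
    z * w ∈ cornerSpan c := by
  suffices cornerSpan c ≤ (cornerSpan c).comap (LinearMap.mulLeft R z) from this hw
  refine Submodule.span_le.2 ?_
  rintro _ ⟨x, v, y, rfl⟩
  change z * (x * c v * y) ∈ cornerSpan c
  simpa only [mul_assoc] using mul_mem_cornerSpan (c := c) (z * x) v y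

theorem mul_right_mem_cornerSpan [IsScalarTower R A A] (z : A) {w : A} (hw : w ∈ cornerSpan c) :
    w * z ∈ cornerSpan c := by
  suffices cornerSpan c ≤ (cornerSpan c).comap (LinearMap.mulRight R z) from this hw
  refine Submodule.span_le.2 ?_
  rintro _ ⟨x, v, y, rfl⟩
  change x * c v * y * z ∈ cornerSpan c
  simpa only [mul_assoc] using mul_mem_cornerSpan (c := c) x v (y * z)

theorem mul_map_mem_leftSpan [IsScalarTower R A A] (v : Q) {w : A} (hw : w ∈ leftSpan c X) :
    w * c v ∈ leftSpan c X := by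
  suffices leftSpan c X ≤ (leftSpan c X).comap (LinearMap.mulRight R (c v)) from this hw
  refine Submodule.span_le.2 ?_
  rintro _ ⟨l, hl, v', rfl⟩
  change l * c v' * c v ∈ leftSpan c X
  rw [mul_assoc, ← map_mul]
  exact mul_mem_leftSpan hl (v' * v)

theorem mul_left_mem_leftSpan [IsScalarTower R A A] [SMulCommClass R A A] {z : A}
    (hz : ∀ l ∈ X, z * l ∈ leftSpan c X) {w : A} (hw : w ∈ leftSpan c X) :
    z * w ∈ leftSpan c X := by
  suffices leftSpan c X ≤ (leftSpan c X).comap (LinearMap.mulLeft R z) from this hw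
  refine Submodule.span_le.2 ?_
  rintro _ ⟨l, hl, v, rfl⟩
  change z * (l * c v) ∈ leftSpan c X
  rw [← mul_assoc]
  exact mul_map_mem_leftSpan v (hz l hl)

theorem mul_mem_range_of_mem_leftSpan [SMulCommClass R A A] {z : A}
    (hz : ∀ l ∈ X, z * l ∈ Set.range c) {w : A} (hw : w ∈ leftSpan c X) :
    z * w ∈ Set.range c := by
  suffices leftSpan c X ≤ (LinearMap.range (c : Q →ₗ[R] A)).comap (LinearMap.mulLeft R z) from
    this hw
  refine Submodule.span_le.2 ?_
  rintro _ ⟨l, hl, v, rfl⟩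
  obtain ⟨v', hv'⟩ := hz l hl
  exact ⟨v' * v, by simp [hv', mul_assoc]⟩

namespace IsFullCorner

theorem eq_zero_of_forall_mul_mul (hc : IsFullCorner c) {M : Type*} [AddCommGroup M] [Module R M]
    {f : A →ₗ[R] M} (h : ∀ x v y, f (x * c v * y) = 0) : f = 0 := by
  have : cornerSpan c ≤ LinearMap.ker f := Submodule.span_le.2 <| by
    rintro _ ⟨x, v, y, rfl⟩
    exact h x v y
  rwa [hc.cornerSpan_eq_top, top_le_iff, LinearMap.ker_eq_top] at this

theorem mul_mul_eq_zero [IsScalarTower R A A] [SMulCommClass R A A] (hc : IsFullCorner c) {x : A}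
    (h : ∀ v y z v', c v * (y * x * z) * c v' = 0) (u w : A) : u * x * w = 0 := by
  have left (z : A) (v : Q) : u * (x * z * c v) = 0 := by
    have : LinearMap.mulRight R (x * z * c v) = 0 := hc.eq_zero_of_forall_mul_mul fun l v' r => by
      have := congrArg (l * ·) (h v' r z v)
      simpa [mul_assoc] using this
    exact LinearMap.congr_fun this u
  have right : LinearMap.mulLeft R (u * x) = 0 := hc.eq_zero_of_forall_mul_mul fun l v r => by
    have := congrArg (· * r) (left l v)
    simpa [mul_assoc] using this
  exact LinearMap.congr_fun right w

theorem injective [IsScalarTower R A A] [SMulCommClass R A A] (hc : IsFullCorner c)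
    {K : Type*} [NonUnitalRing K] [Module R K] {f : A →ₙₐ[R] K}
    (hf : Function.Injective (f.comp c)) (hA : ∀ x : A, ∃ u w, u * x * w = x) :
    Function.Injective f := by
  rw [injective_iff_map_eq_zero]
  intro x hx
  obtain ⟨u, w, h⟩ := hA x
  rw [← h]
  refine hc.mul_mul_eq_zero (fun v y z v' => ?_) u w
  obtain ⟨q, hq⟩ := hc.mul_mul_mem_range v (y * x * z) v'
  have hq0 : q = 0 := hf <| by
    rw [NonUnitalAlgHom.comp_apply, hq, map_zero]
    simp [hx]
  rw [← hq, hq0, map_zero]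

end IsFullCorner

end FullCorner

namespace GBDS

variable {B : Type v} {L : Type w} [GeneralizedBooleanAlgebra B] {S : GBDS B L}
  {R : Type u} [CommRing R] {e : L ↪ ℕ}

theorem exists_mul_mul_eq_self (z : S.Alg R) : ∃ u w, u * z * w = z := by
  obtain ⟨u, hu⟩ := exists_mul_eq_self z
  obtain ⟨w, hw⟩ := exists_self_mul_eq z
  exact ⟨u, w, by rw [hu, hw]⟩

section Criterion

variable {Q : Type x} [NonUnitalRing Q] [Module R Q] {c : Q →ₙₐ[R] S.Alg R} {X : Set (S.Alg R)}

theorem mul_left_mem_leftSpan_of_generators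
    (hP : ∀ A, ∀ l ∈ X, S.P R A * l ∈ leftSpan c X)
    (hs : ∀ a C hC, ∀ l ∈ X, S.s R a C hC * l ∈ leftSpan c X)
    (ht : ∀ a C hC, ∀ l ∈ X, S.t R a C hC * l ∈ leftSpan c X) (z : S.Alg R) :
    ∀ w ∈ leftSpan c X, z * w ∈ leftSpan c X := by
  induction z using alg_induction with
  | P A => exact fun _ => mul_left_mem_leftSpan (hP A)
  | s a C hC => exact fun _ => mul_left_mem_leftSpan (hs a C hC)
  | t a C hC => exact fun _ => mul_left_mem_leftSpan (ht a C hC)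
  | mul x y hx hy => exact fun w hw => mul_assoc x y w ▸ hx _ (hy w hw)
  | add x y hx hy => exact fun w hw => add_mul x y w ▸ add_mem (hx w hw) (hy w hw)
  | smul r x hx => exact fun w hw => smul_mul_assoc r x w ▸ Submodule.smul_mem _ r (hx w hw)

theorem cornerSpan_eq_top_of_P_mem (h : ∀ A, S.P R A ∈ cornerSpan c) : cornerSpan c = ⊤ := by
  refine Submodule.eq_top_iff'.2 fun z => ?_
  induction z using alg_induction with
  | P A => exact h A
  | s a C hC =>
    rw [← s_mul_P_of_le hC le_rfl]
    exact mul_left_mem_cornerSpan _ (h C)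
  | t a C hC =>
    rw [← P_mul_t_of_le hC le_rfl]
    exact mul_right_mem_cornerSpan _ (h C)
  | mul x y _ hy => exact mul_left_mem_cornerSpan x hy
  | add x y hx hy => exact add_mem hx hy
  | smul r x hx => exact Submodule.smul_mem _ r hx

end Criterion

theorem isFullCorner_of_generators {B' : Type x} {L' : Type y} [GeneralizedBooleanAlgebra B']
    {T : GBDS B' L'} {c : S.minSystem.Alg R →ₙₐ[R] T.Alg R} {X : Set (T.Alg R)}
    (hX : ∀ A, c (S.minSystem.P R A) ∈ X)
    (h_range : ∀ A, ∀ l ∈ X, c (S.minSystem.P R A) * l ∈ Set.range c)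
    (hP : ∀ A, ∀ l ∈ X, T.P R A * l ∈ leftSpan c X)
    (hs : ∀ a C hC, ∀ l ∈ X, T.s R a C hC * l ∈ leftSpan c X)
    (ht : ∀ a C hC, ∀ l ∈ X, T.t R a C hC * l ∈ leftSpan c X)
    (h_full : ∀ A, T.P R A ∈ cornerSpan c) : IsFullCorner c where
  mul_mul_mem_range v z v' := by
    obtain ⟨D, hD⟩ := exists_forall_ge_mul_P_eq v
    obtain ⟨D', hD'⟩ := exists_forall_ge_P_mul_eq v'
    have h_left : z * c v' ∈ leftSpan c X := by
      refine mul_left_mem_leftSpan_of_generators hP hs ht z _ ?_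
      rw [← hD' D' le_rfl, map_mul]
      exact mul_mem_leftSpan (hX D') v'
    obtain ⟨q, hq⟩ := mul_mem_range_of_mem_leftSpan (h_range D) h_left
    refine ⟨v * q, ?_⟩
    rw [map_mul, hq, ← mul_assoc, ← mul_assoc, ← map_mul, hD D le_rfl]
  cornerSpan_eq_top := cornerSpan_eq_top_of_P_mem h_full

/-! ### The corner of `L_R(B, L, θ, I)` -/

variable (S R) in
/-- The generators `p_A` and `s_{a,C}`. The role of this set is that left multiplication by any
element of the algebra maps `leftSpan (S.minHom R) (S.leftGens R)` into itself. -/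
def leftGens : Set (S.Alg R) := {z | (∃ A, z = S.P R A) ∨ ∃ a C hC, z = S.s R a C hC}

theorem P_mem_leftGens (A : B) : S.P R A ∈ S.leftGens R := .inl ⟨A, rfl⟩

theorem s_mem_leftGens (a : L) (C : B) (hC : C ∈ S.I a) : S.s R a C hC ∈ S.leftGens R :=
  .inr ⟨a, C, hC, rfl⟩

theorem P_mem_leftSpan_minHom (A : B) : S.P R A ∈ leftSpan (S.minHom R) (S.leftGens R) := by
  have h : S.P R A * S.minHom R (S.minSystem.P R A) = S.P R A := by
    rw [minHom_P, P_mul_P_of_le le_rfl]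
  exact h ▸ mul_mem_leftSpan (P_mem_leftGens A) _

theorem s_mem_leftSpan_minHom (a : L) (C : B) (hC : C ∈ S.I a) :
    S.s R a C hC ∈ leftSpan (S.minHom R) (S.leftGens R) := by
  have h : S.s R a C hC * S.minHom R (S.minSystem.P R C) = S.s R a C hC := by
    rw [minHom_P, s_mul_P_of_le hC le_rfl]
  exact h ▸ mul_mem_leftSpan (s_mem_leftGens a C hC) _

theorem s_mul_mem_leftSpan_minHom (a : L) (C : B) (hC : C ∈ S.I a) {l : S.Alg R}
    (hl : l ∈ S.leftGens R) : S.s R a C hC * l ∈ leftSpan (S.minHom R) (S.leftGens R) := by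
  obtain ⟨A, rfl⟩ | ⟨b, D, hD, rfl⟩ := hl
  · rw [s_mul_P]
    exact s_mem_leftSpan_minHom _ _ _
  · rw [← s_mul_P_of_le hC le_rfl, mul_assoc, P_mul_s,
      ← minHom_s b _ (mem_minSystem_I inf_le_right)]
    exact mul_mem_leftSpan (s_mem_leftGens a C hC) _

theorem t_mul_mem_leftSpan_minHom (a : L) (C : B) (hC : C ∈ S.I a) {l : S.Alg R}
    (hl : l ∈ S.leftGens R) : S.t R a C hC * l ∈ leftSpan (S.minHom R) (S.leftGens R) := by
  obtain ⟨A, rfl⟩ | ⟨b, D, hD, rfl⟩ := hl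
  · rw [t_mul_P, ← P_mul_t_of_le _ le_rfl, ← minHom_t a _ (mem_minSystem_I inf_le_right)]
    exact mul_mem_leftSpan (P_mem_leftGens _) _
  · obtain rfl | h := eq_or_ne a b
    · rw [t_mul_s_self]
      exact P_mem_leftSpan_minHom _
    · rw [t_mul_s_of_ne h]
      exact zero_mem _

theorem isFullCorner_minHom : IsFullCorner (S.minHom R) := by
  refine isFullCorner_of_generators (X := S.leftGens R)
    (fun A => minHom_P (S := S) (R := R) A ▸ P_mem_leftGens A) ?_ ?_
    (fun a C hC _ => s_mul_mem_leftSpan_minHom a C hC)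
    (fun a C hC _ => t_mul_mem_leftSpan_minHom a C hC) fun A => ?_
  · rintro A _ (⟨C, rfl⟩ | ⟨a, C, hC, rfl⟩)
    · exact ⟨S.minSystem.P R (A ⊓ C), by rw [minHom_P, minHom_P, P_mul_P]⟩
    · exact ⟨S.minSystem.s R a (C ⊓ S.θ a A) (mem_minSystem_I inf_le_right), by
        rw [minHom_P, minHom_s, P_mul_s]⟩
  · rintro A _ (⟨C, rfl⟩ | ⟨a, C, hC, rfl⟩)
    · rw [P_mul_P]
      exact P_mem_leftSpan_minHom _
    · rw [P_mul_s]
      exact s_mem_leftSpan_minHom _ _ _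
  · have h : S.P R A * S.minHom R (S.minSystem.P R A) * S.P R A = S.P R A := by
      rw [minHom_P, P_mul_P_of_le le_rfl, P_mul_P_of_le le_rfl]
    exact h ▸ mul_mem_cornerSpan _ _ _

end GBDS

namespace GBDS

variable {B : Type v} {L : Type w} [GeneralizedBooleanAlgebra B] {S : GBDS B L}
  {R : Type u} [CommRing R] {e : L ↪ ℕ}

/-! ### The corner of the algebra of the desingularization -/

theorem P_mul_levelP {x : S.BF e} {i : ℕ} {D : B} (h : x.1 i = IdealQuotient.mk _ D) (A : B) :
    (S.desing e).P R x * S.levelP R e i A = S.levelP R e i (D ⊓ A) := by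
  suffices x ⊓ S.cls e i A = S.cls e i (D ⊓ A) by rw [levelP, P_mul_P, this, levelP]
  refine FinSum.ext_iff'.2 fun j => ?_
  change x.1 j ⊓ (S.cls e i A).1 j = (S.cls e i (D ⊓ A)).1 j
  obtain rfl | hj := eq_or_ne j i
  · rw [cls_val_self, cls_val_self, h]
    rfl
  · rw [cls_val_of_ne hj, cls_val_of_ne hj]
    exact inf_bot_eq _

theorem P_mul_returnS {x : S.BF e} {a : L} {A : B} (h : x.1 (e a + 1) = IdealQuotient.mk _ A)
    {C : B} (hC : C ∈ S.I a) :
    (S.desing e).P R x * S.returnS R e a C hC =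
      S.returnS R e a (C ⊓ S.θ a A) (S.inf_mem_I hC _) :=
  (P_mul_s _ _).trans (s_congr (by rw [desing_θ_inl_eq_cls h, cls_inf_cls]) _ _)

theorem levelP_mul_returnS_of_ne {i : ℕ} {a : L} (h : i ≠ e a + 1) (A : B) {C : B}
    (hC : C ∈ S.I a) : S.levelP R e i A * S.returnS R e a C hC = 0 :=
  (P_mul_s _ _).trans (s_eq_zero (by rw [desing_θ_inl_cls_of_ne h, inf_bot_eq]) _)

theorem levelP_mul_star_path (n : ℕ) (A D : B) :
    S.levelP R e n D * star (S.path R e A n) = star (S.path R e (A ⊓ D) n) := by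
  rw [← path_mul_levelP, star_mul, isSelfAdjoint_levelP]

theorem levelP_mul_star_path_of_ne {i n : ℕ} (h : i ≠ n) (A D : B) :
    S.levelP R e i D * star (S.path R e A n) = 0 := by
  rw [← levelP_mul_star_path_self, ← mul_assoc, levelP_mul_levelP_of_ne h, zero_mul]

theorem path_mul_stepS (n : ℕ) (D A : B) :
    S.path R e D n * S.stepS R e n A = S.path R e (D ⊓ A) (n + 1) := by
  rw [← path_mul_levelP_self, mul_assoc, levelP_mul_stepS, ← path_mul_levelP, path_succ,
    mul_assoc, stepS_mul_levelP, inf_comm]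

theorem path_mul_stepS_of_ne {i n : ℕ} (h : i ≠ n) (D A : B) :
    S.path R e D i * S.stepS R e n A = 0 := by
  rw [← path_mul_levelP_self, ← inf_idem A, ← levelP_mul_stepS, mul_assoc,
    ← mul_assoc (S.levelP R e i D), levelP_mul_levelP_of_ne h, zero_mul, mul_zero]

theorem path_mul_returnS {a : L} {C : B} (hC : C ∈ S.I a) (D : B) :
    S.path R e D (e a + 1) * S.returnS R e a C hC =
      S.cornerS R e a (C ⊓ S.θ a D) (mem_minSystem_I inf_le_right) := by
  rw [cornerS_eq inf_le_right]
  conv_lhs => rw [← path_mul_levelP_self, mul_assoc, levelP_mul_returnS]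

theorem path_mul_returnS_of_ne {i : ℕ} {a : L} (h : i ≠ e a + 1) {C : B} (hC : C ∈ S.I a)
    (D : B) : S.path R e D i * S.returnS R e a C hC = 0 := by
  rw [← path_mul_levelP_self, mul_assoc, levelP_mul_returnS_of_ne h, mul_zero]

theorem stepS_eq (n : ℕ) (A : B) :
    S.stepS R e n A = star (S.path R e A n) * S.path R e A (n + 1) := by
  rw [path_succ, ← mul_assoc, star_path_mul_path, levelP_mul_stepS, inf_idem, inf_idem]

theorem stepS_mul_star_stepS (n : ℕ) (A D : B) :
    S.stepS R e n A * star (S.stepS R e n D) =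
      S.levelP R e n A * (S.stepS R e n D * star (S.stepS R e n D)) := by
  have h : S.levelP R e (n + 1) D * star (S.stepS R e n D) = star (S.stepS R e n D) := by
    rw [← isSelfAdjoint_levelP, ← star_mul, stepS_mul_levelP, inf_idem]
  rw [← mul_assoc, levelP_mul_stepS, inf_comm, ← stepS_mul_levelP, mul_assoc, h]

variable (S R e) in
/-- The elements `s_{b_i,A}^* ⋯ s_{b_1,A}^* p_A` and `s_{a,C}`, which play for the desingularization
the role that `leftGens` plays for the system itself. -/
def leftPaths : Set ((S.desing e).Alg R) :=
  {z | (∃ A i, z = star (S.path R e A i)) ∨ ∃ a C hC, z = S.returnS R e a C hC}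

theorem star_path_mem_leftPaths (A : B) (i : ℕ) : star (S.path R e A i) ∈ S.leftPaths R e :=
  .inl ⟨A, i, rfl⟩

theorem returnS_mem_leftPaths {a : L} {C : B} (hC : C ∈ S.I a) :
    S.returnS R e a C hC ∈ S.leftPaths R e := .inr ⟨a, C, hC, rfl⟩

theorem cornerHom_P_mem_leftPaths (A : B) :
    S.cornerHom R e (S.minSystem.P R A) ∈ S.leftPaths R e := by
  rw [cornerHom_P, ← isSelfAdjoint_levelP]
  exact star_path_mem_leftPaths A 0

theorem star_path_mul_cornerHom (A : B) (i : ℕ) :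
    star (S.path R e A i) * S.cornerHom R e (S.minSystem.P R A) = star (S.path R e A i) := by
  rw [cornerHom_P, ← isSelfAdjoint_levelP, ← star_mul, levelP_mul_path, inf_idem]

theorem star_path_mem_leftSpan (A : B) (i : ℕ) :
    star (S.path R e A i) ∈ leftSpan (S.cornerHom R e) (S.leftPaths R e) :=
  star_path_mul_cornerHom (S := S) (R := R) A i ▸ mul_mem_leftSpan (star_path_mem_leftPaths A i) _

theorem returnS_mem_leftSpan {a : L} {C : B} (hC : C ∈ S.I a) :
    S.returnS R e a C hC ∈ leftSpan (S.cornerHom R e) (S.leftPaths R e) := by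
  have h : S.returnS R e a C hC * S.cornerHom R e (S.minSystem.P R C) =
      S.returnS R e a C hC := by
    rw [cornerHom_P, returnS_mul_levelP]
    exact returnS_congr (inf_idem C) _ _
  exact h ▸ mul_mem_leftSpan (returnS_mem_leftPaths hC) _

theorem cornerHom_mem_leftSpan (v : S.minSystem.Alg R) :
    S.cornerHom R e v ∈ leftSpan (S.cornerHom R e) (S.leftPaths R e) := by
  obtain ⟨D, hD⟩ := exists_forall_ge_P_mul_eq v
  rw [← hD D le_rfl, map_mul]
  exact mul_mem_leftSpan (cornerHom_P_mem_leftPaths D) v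

theorem P_mul_mem_leftSpan (x : S.BF e) {l : (S.desing e).Alg R} (hl : l ∈ S.leftPaths R e) :
    (S.desing e).P R x * l ∈ leftSpan (S.cornerHom R e) (S.leftPaths R e) := by
  obtain ⟨A, i, rfl⟩ | ⟨a, C, hC, rfl⟩ := hl
  · obtain ⟨D, hD⟩ := IdealQuotient.exists_eq_mk (x.1 i)
    rw [← levelP_mul_star_path_self, ← mul_assoc, P_mul_levelP hD, levelP_mul_star_path]
    exact star_path_mem_leftSpan _ _
  · obtain ⟨A, hA⟩ := IdealQuotient.exists_eq_mk (x.1 (e a + 1))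
    rw [P_mul_returnS hA]
    exact returnS_mem_leftSpan _

theorem star_returnS_mul_star_path_mem_leftSpan {a : L} {C : B} (hC : C ∈ S.I a) (D : B) (i : ℕ) :
    star (S.returnS R e a C hC) * star (S.path R e D i) ∈
      leftSpan (S.cornerHom R e) (S.leftPaths R e) := by
  rw [← star_mul]
  obtain rfl | h := eq_or_ne i (e a + 1)
  · rw [path_mul_returnS, ← cornerHom_t]
    exact cornerHom_mem_leftSpan _
  · rw [path_mul_returnS_of_ne h, star_zero]
    exact zero_mem _

theorem returnS_mul_mem_leftSpan {a : L} {C : B} (hC : C ∈ S.I a) {l : (S.desing e).Alg R}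
    (hl : l ∈ S.leftPaths R e) :
    S.returnS R e a C hC * l ∈ leftSpan (S.cornerHom R e) (S.leftPaths R e) := by
  have h_self : S.returnS R e a C hC * S.levelP R e 0 C = S.returnS R e a C hC :=
    (returnS_mul_levelP hC C).trans (returnS_congr (inf_idem C) _ _)
  obtain ⟨A, i, rfl⟩ | ⟨b, D, hD, rfl⟩ := hl
  · obtain rfl | h := eq_or_ne i 0
    · rw [path_zero, isSelfAdjoint_levelP, returnS_mul_levelP]
      exact returnS_mem_leftSpan _
    · rw [← h_self, mul_assoc, levelP_mul_star_path_of_ne h.symm, mul_zero]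
      exact zero_mem _
  · rw [← h_self, mul_assoc, levelP_mul_returnS_of_ne (Nat.succ_ne_zero _).symm, mul_zero]
    exact zero_mem _

theorem star_returnS_mul_mem_leftSpan {a : L} {C : B} (hC : C ∈ S.I a)
    {l : (S.desing e).Alg R} (hl : l ∈ S.leftPaths R e) :
    star (S.returnS R e a C hC) * l ∈ leftSpan (S.cornerHom R e) (S.leftPaths R e) := by
  obtain ⟨A, i, rfl⟩ | ⟨b, D, hD, rfl⟩ := hl
  · exact star_returnS_mul_star_path_mem_leftSpan hC A i
  · obtain rfl | h := eq_or_ne a b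
    · rw [star_returnS_mul_returnS, ← cornerHom_P]
      exact cornerHom_mem_leftSpan _
    · rw [returnS, returnS, star_s, t_mul_s_of_ne (Sum.inl_injective.ne h)]
      exact zero_mem _

theorem star_stepS_mul_mem_leftSpan (n : ℕ) (A : B) {l : (S.desing e).Alg R}
    (hl : l ∈ S.leftPaths R e) :
    star (S.stepS R e n A) * l ∈ leftSpan (S.cornerHom R e) (S.leftPaths R e) := by
  obtain ⟨D, i, rfl⟩ | ⟨b, D, hD, rfl⟩ := hl
  · rw [← star_mul]
    obtain rfl | h := eq_or_ne i n
    · rw [path_mul_stepS]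
      exact star_path_mem_leftSpan _ _
    · rw [path_mul_stepS_of_ne h, star_zero]
      exact zero_mem _
  · rw [← star_star (S.returnS R e b D hD), ← star_mul, star_returnS_mul_stepS, star_zero]
    exact zero_mem _

/-- The Cuntz-Krieger relation expresses `s s^*`, for `s` the generator of the letter `b_{n+1}`, by
`p` and the generator of `a_n`. -/
theorem stepS_mul_star_stepS_mul_star_path_mem_leftSpan (n : ℕ) (D : B) :
    S.stepS R e n D * star (S.stepS R e n D) * star (S.path R e D n) ∈
      leftSpan (S.cornerHom R e) (S.leftPaths R e) := by
  by_cases h : ∃ a, e a + 1 = n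
  · obtain ⟨a, rfl⟩ := h
    rw [eq_sub_of_add_eq (levelP_letter_eq a D).symm, sub_mul, levelP_mul_star_path, mul_assoc]
    refine sub_mem (star_path_mem_leftSpan _ _) ?_
    rw [← star_mul, path_mul_returnS, ← cornerHom_t]
    exact mul_mem_leftSpan (returnS_mem_leftPaths _) _
  · push Not at h
    rw [← levelP_eq_of_forall_ne h, levelP_mul_star_path]
    exact star_path_mem_leftSpan _ _

theorem stepS_mul_star_path_mem_leftSpan (n : ℕ) (A D : B) (i : ℕ) :
    S.stepS R e n A * star (S.path R e D i) ∈
      leftSpan (S.cornerHom R e) (S.leftPaths R e) := by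
  obtain rfl | h := eq_or_ne i (n + 1)
  · rw [path_succ, star_mul, ← mul_assoc, stepS_mul_star_stepS, mul_assoc]
    exact mul_left_mem_leftSpan (fun _ => P_mul_mem_leftSpan (S.cls e n A))
      (stepS_mul_star_stepS_mul_star_path_mem_leftSpan n D)
  · rw [← inf_idem A, ← stepS_mul_levelP, mul_assoc, levelP_mul_star_path_of_ne h.symm, mul_zero]
    exact zero_mem _

theorem stepS_mul_returnS_mem_leftSpan (n : ℕ) (A : B) {a : L} {C : B} (hC : C ∈ S.I a) :
    S.stepS R e n A * S.returnS R e a C hC ∈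
      leftSpan (S.cornerHom R e) (S.leftPaths R e) := by
  rw [stepS_eq, mul_assoc]
  obtain rfl | h := eq_or_ne n (e a)
  · rw [path_mul_returnS, ← cornerHom_s]
    exact mul_mem_leftSpan (star_path_mem_leftPaths _ _) _
  · rw [path_mul_returnS_of_ne (Nat.succ_injective.ne h), mul_zero]
    exact zero_mem _

theorem cornerHom_P_mul_mem_range (A : B) {l : (S.desing e).Alg R} (hl : l ∈ S.leftPaths R e) :
    S.cornerHom R e (S.minSystem.P R A) * l ∈ Set.range (S.cornerHom R e) := by
  rw [cornerHom_P]
  obtain ⟨D, i, rfl⟩ | ⟨b, D, hD, rfl⟩ := hl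
  · obtain rfl | h := eq_or_ne 0 i
    · exact ⟨S.minSystem.P R (D ⊓ A), by
        rw [levelP_mul_star_path, path_zero, isSelfAdjoint_levelP, cornerHom_P]⟩
    · exact ⟨0, by rw [map_zero, levelP_mul_star_path_of_ne h]⟩
  · exact ⟨0, by rw [map_zero, levelP_mul_returnS_of_ne (Nat.succ_ne_zero _).symm]⟩

theorem levelP_mem_cornerSpan (i : ℕ) (A : B) :
    S.levelP R e i A ∈ cornerSpan (S.cornerHom R e) := by
  rw [← inf_idem A, ← star_path_mul_path, ← star_path_mul_cornerHom]
  exact mul_mem_cornerSpan _ _ _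

theorem P_mem_cornerSpan_of_forall_ge (N : ℕ) :
    ∀ x : S.BF e, (∀ i ≥ N, x.1 i = ⊥) → (S.desing e).P R x ∈ cornerSpan (S.cornerHom R e) := by
  induction N with
  | zero =>
    intro x hx
    rw [show x = ⊥ from FinSum.ext_iff'.2 fun i => hx i (Nat.zero_le i), P_bot]
    exact zero_mem _
  | succ N ih =>
    intro x hx
    obtain ⟨A, hA⟩ := IdealQuotient.exists_eq_mk (x.1 N)
    have h_split : (S.desing e).P R x =
        S.levelP R e N (A ⊓ A) + (S.desing e).P R (x \ S.cls e N A) := by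
      conv_lhs => rw [← sup_inf_sdiff x (S.cls e N A), P_sup, inf_inf_sdiff, P_bot, sub_zero,
        ← P_mul_P]
      exact congrArg (· + _) (P_mul_levelP hA A)
    rw [h_split]
    refine add_mem (levelP_mem_cornerSpan _ _) (ih _ fun i hi => ?_)
    change x.1 i \ (S.cls e N A).1 i = ⊥
    obtain rfl | hi := hi.eq_or_lt
    · rw [cls_val_self, hA]
      exact sdiff_self
    · rw [hx i hi]
      exact bot_sdiff

theorem P_mem_cornerSpan (x : S.BF e) :
    (S.desing e).P R x ∈ cornerSpan (S.cornerHom R e) := by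
  obtain ⟨N, hN⟩ := Set.Finite.bddAbove (show {i | x.1 i ≠ ⊥}.Finite from x.2)
  refine P_mem_cornerSpan_of_forall_ge (N + 1) x fun i hi => ?_
  by_contra h
  exact absurd (hN h) (Nat.not_le_of_lt hi)

theorem isFullCorner_cornerHom : IsFullCorner (S.cornerHom R e) := by
  refine isFullCorner_of_generators (X := S.leftPaths R e) cornerHom_P_mem_leftPaths
    (fun A _ => cornerHom_P_mul_mem_range A) (fun x _ => P_mul_mem_leftSpan x) ?_ ?_
    P_mem_cornerSpan
  · rintro (a | n) _ ⟨C, hC, rfl⟩ l hl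
    · exact returnS_mul_mem_leftSpan hC hl
    · obtain ⟨A, i, rfl⟩ | ⟨a, D, hD, rfl⟩ := hl
      · exact stepS_mul_star_path_mem_leftSpan n C A i
      · exact stepS_mul_returnS_mem_leftSpan n C hD
  · rintro (a | n) _ ⟨C, hC, rfl⟩ l hl
    · have h := star_returnS_mul_mem_leftSpan (R := R) (e := e) hC hl
      rwa [returnS, star_s] at h
    · have h := star_stepS_mul_mem_leftSpan (R := R) n C hl
      rwa [stepS, star_s] at h

/-! ### Injectivity of the homomorphism into the matrices -/

theorem matHom_cornerHom (v : S.minSystem.Alg R) :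
    S.matHom R e (S.cornerHom R e v) = ColEnd.unit R 0 0 (S.minHom R v) := by
  induction v using alg_induction with
  | P A => rw [cornerHom_P, matHom_levelP, lettersBelow_zero, gap_empty, minHom_P]
  | s a C hC =>
    obtain ⟨A, hA⟩ := id hC
    rw [cornerHom_s, cornerS_eq hA, map_mul, matHom_path, matHom_returnS, ColEnd.unit_mul_unit,
      gap_mul_s_of_notMem (self_notMem_lettersBelow a), minHom_s]
    exact congrArg _ (s_congr (inf_eq_left.2 hA) _ _)
  | t a C hC =>
    obtain ⟨A, hA⟩ := id hC
    have h : S.t R a C (minSystem_I_le hC) * S.gap R (lettersBelow e (e a + 1)) A =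
        S.t R a C (minSystem_I_le hC) := by
      refine star_injective ?_
      rw [star_mul, star_t, isSelfAdjoint_gap, gap_mul_s_of_notMem (self_notMem_lettersBelow a)]
      exact s_congr (inf_eq_left.2 hA) _ _
    rw [cornerHom_t, cornerS_eq hA, star_mul, map_mul, matHom_star_path, matHom_star_returnS,
      ColEnd.unit_mul_unit, h, minHom_t]
  | mul x y hx hy => rw [map_mul, map_mul, map_mul, hx, hy, ColEnd.unit_mul_unit]
  | add x y hx hy => rw [map_add, map_add, map_add, map_add, hx, hy]
  | smul r x hx => rw [map_smul, map_smul, map_smul, map_smul, hx]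

theorem matHom_injective : Function.Injective (S.matHom R e) :=
  isFullCorner_cornerHom.injective
    (fun v v' h => minHom_injective <| ColEnd.unit_injective 0 0 <| by
      rw [← matHom_cornerHom, ← matHom_cornerHom]
      exact h)
    exists_mul_mul_eq_self

end GBDS

/-! ### Morita contexts of subspaces of an algebra -/

section Morita

variable {R : Type u} [CommRing R] {K : Type w} [Ring K] [Algebra R K]

theorem span_eq_top_of_mul {V : Type y} [AddCommGroup V] [Module R V] {f : V →ₗ[R] K}
    (hf : Function.Injective f) {X Y : Submodule R K} (h : LinearMap.range f ≤ X * Y) {s : Set V}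
    (hs : ∀ x ∈ X, ∀ y ∈ Y, ∃ z ∈ s, f z = x * y) : Submodule.span R s = ⊤ := by
  have h_map : X * Y ≤ (Submodule.span R s).map f := Submodule.mul_le.2 fun x hx y hy => by
    obtain ⟨z, hz, h⟩ := hs x hx y hy
    exact ⟨z, Submodule.subset_span hz, h⟩
  refine Submodule.eq_top_iff'.2 fun v => ?_
  obtain ⟨v', hv', h'⟩ := h_map (h ⟨v, rfl⟩)
  exact hf h' ▸ hv'

section Actions

variable {A : Type x} [NonUnitalRing A] [Module R A] {C : Type y} [NonUnitalRing C] [Module R C]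

/-- Left multiplication by `j a` on a subspace `W` with `j(A) W ⊆ W`, for a homomorphism `j` of `A`
into an algebra that contains `W`. -/
def leftAction (j : A →ₙₐ[R] K) (W : Submodule R K)
    (h : LinearMap.range (j : A →ₗ[R] K) * W ≤ W) : A →ₗ[R] W →ₗ[R] W :=
  LinearMap.mk₂ R (fun a m => ⟨j a * m, h (Submodule.mul_mem_mul ⟨a, rfl⟩ m.2)⟩)
    (fun _ _ _ => Subtype.ext (by simp [add_mul])) (fun _ _ _ => Subtype.ext (by simp))
    (fun _ _ _ => Subtype.ext (by simp [mul_add])) (fun _ _ _ => Subtype.ext (by simp))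

/-- Right multiplication by `j a` on a subspace `W` with `W j(A) ⊆ W`, for a homomorphism `j` of
`A` into an algebra that contains `W`. -/
def rightAction (j : A →ₙₐ[R] K) (W : Submodule R K)
    (h : W * LinearMap.range (j : A →ₗ[R] K) ≤ W) : W →ₗ[R] A →ₗ[R] W :=
  LinearMap.mk₂ R (fun m a => ⟨m * j a, h (Submodule.mul_mem_mul m.2 ⟨a, rfl⟩)⟩)
    (fun _ _ _ => Subtype.ext (by simp [add_mul])) (fun _ _ _ => Subtype.ext (by simp))
    (fun _ _ _ => Subtype.ext (by simp [mul_add])) (fun _ _ _ => Subtype.ext (by simp))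

/-- The product of two subspaces whose product lies in the image of the injective homomorphism `j`,
read as an element of the domain of `j`. -/
def mulPairing (j : A →ₙₐ[R] K) (hj : Function.Injective j) (V W : Submodule R K)
    (h : V * W ≤ LinearMap.range (j : A →ₗ[R] K)) : V →ₗ[R] W →ₗ[R] A :=
  LinearMap.mk₂ R (fun m n => (LinearEquiv.ofInjective (j : A →ₗ[R] K) hj).symm
      ⟨m * n, h (Submodule.mul_mem_mul m.2 n.2)⟩)
    (fun _ _ _ => by rw [← map_add]; exact congrArg _ (Subtype.ext (by simp [add_mul])))
    (fun _ _ _ => by rw [← map_smul]; exact congrArg _ (Subtype.ext (by simp)))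
    (fun _ _ _ => by rw [← map_add]; exact congrArg _ (Subtype.ext (by simp [mul_add])))
    (fun _ _ _ => by rw [← map_smul]; exact congrArg _ (Subtype.ext (by simp)))

variable {j : A →ₙₐ[R] K} {k : C →ₙₐ[R] K} {V W : Submodule R K}

@[simp] theorem coe_leftAction (h : LinearMap.range (j : A →ₗ[R] K) * W ≤ W) (a : A) (m : W) :
    (leftAction j W h a m : K) = j a * m := rfl

@[simp] theorem coe_rightAction (h : W * LinearMap.range (j : A →ₗ[R] K) ≤ W) (m : W) (a : A) :
    (rightAction j W h m a : K) = m * j a := rfl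

@[simp] theorem map_mulPairing (hj : Function.Injective j)
    (h : V * W ≤ LinearMap.range (j : A →ₗ[R] K)) (m : V) (n : W) :
    j (mulPairing j hj V W h m n) = m * n :=
  congrArg Subtype.val ((LinearEquiv.ofInjective (j : A →ₗ[R] K) hj).apply_symm_apply
    ⟨m * n, h (Submodule.mul_mem_mul m.2 n.2)⟩)

theorem span_leftAction_eq_top (h : LinearMap.range (j : A →ₗ[R] K) * W = W) :
    Submodule.span R {x | ∃ a m, x = leftAction j W h.le a m} = ⊤ := by
  refine span_eq_top_of_mul W.injective_subtype (W.range_subtype.le.trans h.ge) ?_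
  rintro _ ⟨a, rfl⟩ m hm
  exact ⟨_, ⟨a, ⟨m, hm⟩, rfl⟩, rfl⟩

theorem span_rightAction_eq_top (h : W * LinearMap.range (j : A →ₗ[R] K) = W) :
    Submodule.span R {x | ∃ m a, x = rightAction j W h.le m a} = ⊤ := by
  refine span_eq_top_of_mul W.injective_subtype (W.range_subtype.le.trans h.ge) ?_
  rintro m hm _ ⟨a, rfl⟩
  exact ⟨_, ⟨⟨m, hm⟩, a, rfl⟩, rfl⟩

theorem span_mulPairing_eq_top (hj : Function.Injective j)
    (h : V * W = LinearMap.range (j : A →ₗ[R] K)) :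
    Submodule.span R {x | ∃ m n, x = mulPairing j hj V W h.le m n} = ⊤ :=
  span_eq_top_of_mul (f := (j : A →ₗ[R] K)) hj h.ge fun m hm n hn =>
    ⟨_, ⟨⟨m, hm⟩, ⟨n, hn⟩, rfl⟩, map_mulPairing hj h.le ⟨m, hm⟩ ⟨n, hn⟩⟩

theorem mul_leftAction (h : LinearMap.range (j : A →ₗ[R] K) * W ≤ W) (a a' : A) (m : W) :
    leftAction j W h (a * a') m = leftAction j W h a (leftAction j W h a' m) :=
  Subtype.ext <| by simp [mul_assoc]

theorem rightAction_mul (h : W * LinearMap.range (j : A →ₗ[R] K) ≤ W) (m : W) (a a' : A) :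
    rightAction j W h m (a * a') = rightAction j W h (rightAction j W h m a) a' :=
  Subtype.ext <| by simp [mul_assoc]

theorem rightAction_leftAction (hj : LinearMap.range (j : A →ₗ[R] K) * W ≤ W)
    (hk : W * LinearMap.range (k : C →ₗ[R] K) ≤ W) (a : A) (m : W) (c : C) :
    rightAction k W hk (leftAction j W hj a m) c = leftAction j W hj a (rightAction k W hk m c) :=
  Subtype.ext <| mul_assoc _ _ _

theorem mulPairing_rightAction_left (hj : Function.Injective j)
    (h : V * W ≤ LinearMap.range (j : A →ₗ[R] K)) (hV : V * LinearMap.range (k : C →ₗ[R] K) ≤ V)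
    (hW : LinearMap.range (k : C →ₗ[R] K) * W ≤ W) (m : V) (c : C) (n : W) :
    mulPairing j hj V W h (rightAction k V hV m c) n =
      mulPairing j hj V W h m (leftAction k W hW c n) :=
  hj <| by simp [mul_assoc]

theorem mulPairing_leftAction_left (hj : Function.Injective j)
    (h : V * W ≤ LinearMap.range (j : A →ₗ[R] K)) (hV : LinearMap.range (j : A →ₗ[R] K) * V ≤ V)
    (a : A) (m : V) (n : W) :
    mulPairing j hj V W h (leftAction j V hV a m) n = a * mulPairing j hj V W h m n :=
  hj <| by simp [mul_assoc]

theorem mulPairing_rightAction_right (hj : Function.Injective j)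
    (h : V * W ≤ LinearMap.range (j : A →ₗ[R] K)) (hW : W * LinearMap.range (j : A →ₗ[R] K) ≤ W)
    (m : V) (n : W) (a : A) :
    mulPairing j hj V W h m (rightAction j W hW n a) = mulPairing j hj V W h m n * a :=
  hj <| by simp [mul_assoc]

theorem leftAction_mulPairing (hj : Function.Injective j) (hk : Function.Injective k)
    (hVW : V * W ≤ LinearMap.range (j : A →ₗ[R] K)) (hWV : W * V ≤ LinearMap.range (k : C →ₗ[R] K))
    (hjV : LinearMap.range (j : A →ₗ[R] K) * V ≤ V) (hVk : V * LinearMap.range (k : C →ₗ[R] K) ≤ V)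
    (m : V) (n : W) (m' : V) :
    leftAction j V hjV (mulPairing j hj V W hVW m n) m' =
      rightAction k V hVk m (mulPairing k hk W V hWV n m') :=
  Subtype.ext <| by simp [mul_assoc]

end Actions

variable {A : Type x} [NonUnitalRing A] [Module R A] [IsScalarTower R A A] [SMulCommClass R A A]
  {C : Type y} [NonUnitalRing C] [Module R C] [IsScalarTower R C C] [SMulCommClass R C C]
  {K : Type (max x y)} [Ring K] [Algebra R K]

theorem moritaEquivalent_of_mul_eq {j : A →ₙₐ[R] K} {k : C →ₙₐ[R] K} (hj : Function.Injective j)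
    (hk : Function.Injective k) {T F M N : Submodule R K}
    (hT : LinearMap.range (j : A →ₗ[R] K) = T) (hF : LinearMap.range (k : C →ₗ[R] K) = F)
    (hTM : T * M = M) (hMF : M * F = M) (hFN : F * N = N) (hNT : N * T = N)
    (hMN : M * N = T) (hNM : N * M = F) : MoritaEquivalent R A C := by
  subst hT hF
  exact ⟨{
    M, N
    AM := leftAction j M hTM.le
    MC := rightAction k M hMF.le
    CN := leftAction k N hFN.le
    NA := rightAction j N hNT.le
    φ := mulPairing j hj M N hMN.le
    ψ := mulPairing k hk N M hNM.le
    AM_mul := mul_leftAction _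
    MC_mul := rightAction_mul _
    AM_MC := rightAction_leftAction _ _
    CN_mul := mul_leftAction _
    NA_mul := rightAction_mul _
    CN_NA := rightAction_leftAction _ _
    AM_unital := span_leftAction_eq_top hTM
    MC_unital := span_rightAction_eq_top hMF
    CN_unital := span_leftAction_eq_top hFN
    NA_unital := span_rightAction_eq_top hNT
    φ_balanced := mulPairing_rightAction_left hj _ _ _
    φ_left := mulPairing_leftAction_left hj _ _
    φ_right := mulPairing_rightAction_right hj _ _
    ψ_balanced := mulPairing_rightAction_left hk _ _ _
    ψ_left := mulPairing_leftAction_left hk _ _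
    ψ_right := mulPairing_rightAction_right hk _ _
    φ_ψ := leftAction_mulPairing hj hk _ _ _ _
    ψ_φ := leftAction_mulPairing hk hj _ _ _ _
    φ_surjective := span_mulPairing_eq_top hj hMN
    ψ_surjective := span_mulPairing_eq_top hk hNM }⟩

theorem moritaEquivalent_of_common_corner {j : A →ₙₐ[R] K} {k : C →ₙₐ[R] K}
    (hj : Function.Injective j) (hk : Function.Injective k) {T F U : Submodule R K}
    (hT : LinearMap.range (j : A →ₗ[R] K) = T) (hF : LinearMap.range (k : C →ₗ[R] K) = F)
    (hTT : T * T = T) (hFF : F * F = F) (hTUT : T * U * T = T) (hFUF : F * U * F = F)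
    (hUTU : U * T * U = U) (hUFU : U * F * U = U) : MoritaEquivalent R A C := by
  refine moritaEquivalent_of_mul_eq hj hk hT hF (M := T * U * F) (N := F * U * T)
    ?_ ?_ ?_ ?_ ?_ ?_
  · simp only [← mul_assoc, hTT]
  · simp only [mul_assoc, hFF]
  · simp only [← mul_assoc, hFF]
  · simp only [mul_assoc, hTT]
  · calc T * U * F * (F * U * T) = T * (U * (F * F) * U) * T := by simp only [mul_assoc]
      _ = T := by rw [hFF, hUFU, hTUT]
  · calc F * U * T * (T * U * F) = F * (U * (T * T) * U) * F := by simp only [mul_assoc]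
      _ = F := by rw [hTT, hUTU, hFUF]

end Morita

namespace IsFullCorner

variable {R : Type u} [CommRing R] {Q : Type v} [NonUnitalRing Q] [Module R Q]

section Range

variable {A : Type x} [NonUnitalRing A] [Module R A] {K : Type y} [Ring K] [Algebra R K]
  {c : Q →ₙₐ[R] A} (j : A →ₙₐ[R] K)

theorem range_mul_range_le :
    LinearMap.range (j : A →ₗ[R] K) * LinearMap.range (j : A →ₗ[R] K) ≤
      LinearMap.range (j : A →ₗ[R] K) := by
  refine Submodule.mul_le.2 ?_
  rintro _ ⟨y, rfl⟩ _ ⟨z, rfl⟩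
  exact ⟨y * z, map_mul j y z⟩

theorem range_le_mul_mul (hc : IsFullCorner c) :
    LinearMap.range (j : A →ₗ[R] K) ≤ LinearMap.range (j : A →ₗ[R] K) *
      LinearMap.range (j.comp c : Q →ₗ[R] K) * LinearMap.range (j : A →ₗ[R] K) := by
  suffices cornerSpan c ≤ (LinearMap.range (j : A →ₗ[R] K) *
      LinearMap.range (j.comp c : Q →ₗ[R] K) * LinearMap.range (j : A →ₗ[R] K)).comap
        (j : A →ₗ[R] K) by
    rwa [hc.cornerSpan_eq_top, top_le_iff, ← LinearMap.range_le_iff_comap] at this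
  refine Submodule.span_le.2 ?_
  rintro _ ⟨x, v, y, rfl⟩
  have h_mul : (j : A →ₗ[R] K) (x * c v * y) = j x * j (c v) * j y := by simp
  rw [SetLike.mem_coe, Submodule.mem_comap, h_mul]
  exact Submodule.mul_mem_mul (Submodule.mul_mem_mul ⟨x, rfl⟩ ⟨v, rfl⟩) ⟨y, rfl⟩

theorem mul_mul_range_le :
    LinearMap.range (j : A →ₗ[R] K) * LinearMap.range (j.comp c : Q →ₗ[R] K) *
      LinearMap.range (j : A →ₗ[R] K) ≤
        LinearMap.range (j : A →ₗ[R] K) * LinearMap.range (j : A →ₗ[R] K) := by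
  have h_le : LinearMap.range (j.comp c : Q →ₗ[R] K) ≤ LinearMap.range (j : A →ₗ[R] K) :=
    LinearMap.range_comp_le_range (c : Q →ₗ[R] A) (j : A →ₗ[R] K)
  exact mul_le_mul_left ((mul_le_mul_right h_le _).trans (range_mul_range_le j)) _

theorem range_mul_mul (hc : IsFullCorner c) :
    LinearMap.range (j : A →ₗ[R] K) * LinearMap.range (j.comp c : Q →ₗ[R] K) *
      LinearMap.range (j : A →ₗ[R] K) = LinearMap.range (j : A →ₗ[R] K) :=
  ((mul_mul_range_le j).trans (range_mul_range_le j)).antisymm (hc.range_le_mul_mul j)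

theorem range_mul_range (hc : IsFullCorner c) :
    LinearMap.range (j : A →ₗ[R] K) * LinearMap.range (j : A →ₗ[R] K) =
      LinearMap.range (j : A →ₗ[R] K) :=
  (range_mul_range_le j).antisymm ((hc.range_le_mul_mul j).trans (mul_mul_range_le j))

theorem range_comp_mul_mul (hc : IsFullCorner c) (hQ : ∀ v : Q, ∃ p q, p * v * q = v) :
    LinearMap.range (j.comp c : Q →ₗ[R] K) * LinearMap.range (j : A →ₗ[R] K) *
      LinearMap.range (j.comp c : Q →ₗ[R] K) = LinearMap.range (j.comp c : Q →ₗ[R] K) := by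
  refine le_antisymm ?_ ?_
  · rw [← Submodule.span_eq (LinearMap.range (j : A →ₗ[R] K)),
      ← Submodule.span_eq (LinearMap.range (j.comp c : Q →ₗ[R] K)), Submodule.span_mul_span,
      Submodule.span_mul_span, Submodule.span_eq, Submodule.span_le]
    rintro _ ⟨_, ⟨_, ⟨v, rfl⟩, _, ⟨z, rfl⟩, rfl⟩, _, ⟨v', rfl⟩, rfl⟩
    obtain ⟨u, hu⟩ := hc.mul_mul_mem_range v z v'
    refine ⟨u, ?_⟩
    change j (c u) = j (c v) * j z * j (c v')
    rw [hu, map_mul, map_mul]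
  · rintro _ ⟨v, rfl⟩
    obtain ⟨p, q, h⟩ := hQ v
    change j (c v) ∈ _
    rw [← h, map_mul, map_mul, map_mul, map_mul]
    exact Submodule.mul_mem_mul (Submodule.mul_mem_mul ⟨p, rfl⟩ ⟨c v, rfl⟩) ⟨q, rfl⟩

end Range

variable {A : Type x} [NonUnitalRing A] [Module R A] [IsScalarTower R A A] [SMulCommClass R A A]
  {C : Type y} [NonUnitalRing C] [Module R C] [IsScalarTower R C C] [SMulCommClass R C C]
  {K : Type (max x y)} [Ring K] [Algebra R K]

theorem moritaEquivalent {c : Q →ₙₐ[R] A} {d : Q →ₙₐ[R] C} (hc : IsFullCorner c)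
    (hd : IsFullCorner d) (hQ : ∀ v : Q, ∃ p q, p * v * q = v) {j : A →ₙₐ[R] K} {k : C →ₙₐ[R] K}
    (hj : Function.Injective j) (hk : Function.Injective k) (h : j.comp c = k.comp d) :
    MoritaEquivalent R A C :=
  moritaEquivalent_of_common_corner hj hk rfl rfl (hc.range_mul_range j) (hd.range_mul_range k)
    (hc.range_mul_mul j) (h ▸ hd.range_mul_mul k) (hc.range_comp_mul_mul j hQ)
    (h ▸ hd.range_comp_mul_mul k hQ)

end IsFullCorner

namespace GBDS

variable {B : Type v} {L : Type w} [GeneralizedBooleanAlgebra B] {S : GBDS B L}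
  {R : Type u} [CommRing R] {e : L ↪ ℕ}

variable (S R) in
/-- The embedding of the algebra as the matrices supported at the place `(0, 0)`. -/
def unitHom : S.Alg R →ₙₐ[R] ColEnd R ℕ (S.Alg R) where
  __ := ColEnd.unit R 0 0
  map_zero' := map_zero (ColEnd.unit R 0 0)
  map_mul' c d := (ColEnd.unit_mul_unit 0 0 0 c d).symm

theorem moritaEquivalent_desing : MoritaEquivalent R (S.Alg R) ((S.desing e).Alg R) :=
  isFullCorner_minHom.moritaEquivalent isFullCorner_cornerHom exists_mul_mul_eq_self
    (j := S.unitHom R) (ColEnd.unit_injective 0 0) matHom_injective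
    (NonUnitalAlgHom.ext fun v => (matHom_cornerHom v).symm)

end GBDS

end BooleanDynamics

end

/-- Desingularization: for a generalized Boolean dynamical system `S = (B, L, θ, I)` whose alphabet
is countable, with enumeration `e`, all sets of `S.desing e = (B^F, L^F, θ^F, I^F)` are regular, and
the algebras of the two systems are Morita equivalent. -/
theorem mainTheorem7 (R : Type*) [CommRing R] {B : Type*} [GeneralizedBooleanAlgebra B]
    {L : Type*} (S : BooleanDynamics.GBDS B L) (e : L ↪ ℕ) :
    (S.desing e).regular = Set.univ ∧
      BooleanDynamics.MoritaEquivalent R (S.Alg R) ((S.desing e).Alg R) :=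
  ⟨BooleanDynamics.GBDS.regular_desing S e, BooleanDynamics.GBDS.moritaEquivalent_desing⟩
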